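/- **Theorem (Ill-posedness for large data, $\gamma=1/2$).** On $\mathbb T^3=\mathbb R^3/(2\pi\mathbb Z)^3$ consider, for real parameters $\kappa,\mu,\Omega>0$, the magneto-geostrophic (MG) equation with fractional diffusion of exponent $\gamma=1/2$, $$\partial_t\Theta+\boldsymbol U\cdot\nabla\Theta+\kappa(-\Delta)^{1/2}\Theta=S,\qquad U_j=M_j\Theta\quad(j=1,2,3),$$ where $M_j$ is the Fourier multiplier whose symbol is, for $k\in\mathbb Z^3$ with $k_3\ne0$ and with $D(k)=4\Omega^2k_3^2|k|^2+\mu^2k_2^4$, $$\hat M_1=\frac{2\Omega k_2k_3|k|^2-\mu k_1k_2^2k_3}{D},\qquad \hat M_2=\frac{-2\Omega k_1k_3|k|^2-\mu k_2^3k_3}{D},\qquad \hat M_3=\frac{\mu k_2^2(k_1^2+k_2^2)}{D},$$ and $\hat M_j(k)=0$ if $k_3=0$. A solution on $[0,T]$ with initial datum $\Theta_0$ is a real function $\Theta\in L^\infty(0,T;X)$ such that for all $t\in[0,T]$ and all $\varphi\in C^\infty(\mathbb T^3)$ $$\int(\Theta(t)-\Theta_0)\varphi\,dx+\kappa\int_0^t\!\!\int\Theta\,(-\Delta)^{1/2}\varphi\,dx\,d\tau-\int_0^t\!\!\int\Theta\,\boldsymbol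 U\cdot\nabla\varphi\,dx\,d\tau=\int_0^t\!\!\int S\varphi\,dx\,d\tau .$$ Let $Y=H^{r,q}(\mathbb T^3)$ and $X=H^{s,p}(\mathbb T^3)$, $1<p,q<\infty$, be Sobolev spaces, with norm $\|f\|_{H^{s,p}}=\|(1-\Delta)^{s/2}f\|_{L^p}$ (so $H^{s,2}=H^s$), and suppose that $Y\subset X\subset W^{1,4}(\mathbb T^3)$ with continuous embeddings. Let $m\ge1$ be an integer and let $a>0$ be so large that $$\kappa<\frac{a\mu m}{2^5\Omega^2m^2+2\mu^2}.$$ Put $\Theta^{(1)}=a\sin(mx_3)$ and $S=\kappa a m\sin(mx_3)$. Then: 1. $\Theta^{(1)}\in Y$ has zero vertical mean (that is, its integral in $x_3$ vanishes), and it is a steady state: the constant function of time $\Theta^{(1)}$ is a solution on $[0,T]$ for every $T>0$. 2. For all $T>0$, $K>0$ and $\delta>0$ there are an initial datum $\Theta^{(2)}_0\in Y$ with $0<\|\Theta^{(2)}_0-\Theta^{(1)}\|_Y<\delta$ and a solution $\Theta^{(2)}\in L^\infty(0,T;X)$ on $[0,T]$ with this initial datum, with $\Theta^{(2)}(t)$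 of zero vertical mean for all $t\in[0,T]$, such that $$\sup_{t\in[0,T]}\|\Theta^{(2)}(t)-\Theta^{(1)}\|_X\ \ge\ 2K\,\|\Theta^{(2)}_0-\Theta^{(1)}\|_Y .$$ 3. The Cauchy problem with the source $S$ is not locally Lipschitz $(X,Y)$ well-posed. Here it is called locally Lipschitz $(X,Y)$ well-posed if there are continuous functions $T,K:[0,\infty)^2\to(0,\infty)$ such that for every pair of data $f_1,f_2\in Y$ of zero vertical mean, with $T=T(\|f_1\|_Y,\|f_2\|_Y)$ and $K=K(\|f_1\|_Y,\|f_2\|_Y)$, there are unique solutions $\Theta_1,\Theta_2\in L^\infty(0,T;X)$ on $[0,T]$ with initial data $f_1,f_2$, and $\|\Theta_1(t)-\Theta_2(t)\|_X\le K\|f_1-f_2\|_Y$ for all $t\in[0,T]$. -/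

import Mathlib

open MeasureTheory Set
open scoped ENNReal NNReal

noncomputable section

namespace MG

/-- The torus `𝕋³ = ℝ³ / (2πℤ)³`.  A point `x` of it is stored as the tuple of the classes of
`x i / (2π)` modulo `1`.  The vertical variable `x₃` has index `2 : Fin 3`. -/
abbrev Torus : Type := UnitAddTorus (Fin 3)

/-- The Lebesgue measure on the torus, normalised to total mass `1`: `dx / (2π)³`. -/
abbrev vol : Measure Torus := Measure.pi (fun _ => AddCircle.haarAddCircle)

/-- The quotient map `ℝ³ → ℝ³ / (2πℤ)³`. -/
def proj (x : Fin 3 → ℝ) : Torus := fun i => ((x i / (2 * Real.pi) : ℝ) : UnitAddCircle)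

/-- Real square integrable functions on the torus. -/
abbrev L2 : Type := Lp ℝ 2 vol

/-- The Fourier coefficient of a real function with respect to `exp (i k · x)`. -/
def fcoeff (f : Torus → ℝ) (k : Fin 3 → ℤ) : ℂ :=
  UnitAddTorus.mFourierCoeff (fun y => (f y : ℂ)) k

/-- `|k|²`. -/
def normSq (k : Fin 3 → ℤ) : ℝ := ∑ i, (k i : ℝ) ^ 2

/-- `g` is the image of `f` under the Fourier multiplier with symbol `σ`. -/
def IsMultiplier (σ : (Fin 3 → ℤ) → ℝ) (f g : Torus → ℝ) : Prop :=
  ∀ k, fcoeff g k = (σ k : ℂ) * fcoeff f k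

/-- Smooth functions on the torus: the periodic lift to `ℝ³` is `C^∞`. -/
def IsSmooth (φ : Torus → ℝ) : Prop := ContDiff ℝ ((⊤ : ℕ∞) : WithTop ℕ∞) (fun x : Fin 3 → ℝ => φ (proj x))

/-- The partial derivative `∂φ/∂x_j`. -/
def pderiv (j : Fin 3) (φ : Torus → ℝ) (y : Torus) : ℝ :=
  deriv (fun h : ℝ => φ (y + proj (Pi.single j h))) 0

/-- The vertical mean `∫ f dx₃` vanishes: all Fourier coefficients on `k₃ = 0` are zero. -/
def HasZeroVerticalMean (f : Torus → ℝ) : Prop :=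
  ∀ k : Fin 3 → ℤ, k 2 = 0 → fcoeff f k = 0

/-! ### Sobolev spaces -/

/-- The norm of the Sobolev space `H^{s,p}(𝕋³)`, that is `‖(1 - Δ)^{s/2} f‖_{L^p}`.  It is `∞` if
`f` is not in the space.  The infimum is over the functions representing `(1 - Δ)^{s/2} f`, which
are unique almost everywhere if there are any.  For `p = 2` this is the usual norm of `H^s`. -/
def sobolevNorm (s : ℝ) (p : ℝ≥0∞) (f : L2) : ℝ≥0∞ :=
  ⨅ (g : Torus → ℝ)
    (_ : MemLp g p vol ∧ IsMultiplier (fun k => (1 + normSq k) ^ (s / 2)) f g),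
    eLpNorm g p vol

/-- `g` is the weak derivative of `f` with respect to `x_j`. -/
def IsWeakPartial (j : Fin 3) (f g : Torus → ℝ) : Prop :=
  ∀ φ, IsSmooth φ → ∫ y, f y * pderiv j φ y ∂vol = - ∫ y, g y * φ y ∂vol

/-- The norm of `W^{1,4}(𝕋³)`; it is `∞` if `f` is not in the space. -/
def w14Norm (f : L2) : ℝ≥0∞ :=
  eLpNorm f 4 vol +
    ∑ j : Fin 3, ⨅ (g : Torus → ℝ) (_ : MemLp g 4 vol ∧ IsWeakPartial j f g),
      eLpNorm g 4 vol

/-- The space with (extended) norm `N₁` embeds continuously in the space with norm `N₂`. -/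
def Embeds (N₁ N₂ : L2 → ℝ≥0∞) : Prop := ∃ C : ℝ≥0, ∀ f, N₂ f ≤ C * N₁ f

/-! ### The magneto-geostrophic equation -/

/-- The common denominator `4Ω²k₃²|k|² + μ²k₂⁴` of the symbols. -/
def den (μ Ω : ℝ) (k : Fin 3 → ℤ) : ℝ :=
  4 * Ω ^ 2 * (k 2 : ℝ) ^ 2 * normSq k + μ ^ 2 * (k 1 : ℝ) ^ 4

/-- The symbols `M̂₁, M̂₂, M̂₃` of the operator `Θ ↦ U` (with `μ = β²/η`), extended by `0` to
`k₃ = 0`: the velocity has zero vertical mean. -/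
def symbolM (μ Ω : ℝ) (j : Fin 3) (k : Fin 3 → ℤ) : ℝ :=
  if k 2 = 0 then 0 else
    ![(2 * Ω * k 1 * k 2 * normSq k - μ * k 0 * (k 1 : ℝ) ^ 2 * k 2) / den μ Ω k,
      (-2 * Ω * k 0 * k 2 * normSq k - μ * (k 1 : ℝ) ^ 3 * k 2) / den μ Ω k,
      (μ * (k 1 : ℝ) ^ 2 * ((k 0 : ℝ) ^ 2 + (k 1 : ℝ) ^ 2)) / den μ Ω k] j

/-- `Θ` is a solution on `[0, T]`, of class `L^∞(0, T; H^{s,p})`, of the Cauchy problem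
`∂ₜΘ + U · ∇Θ + κ (-Δ)^γ Θ = S`, `U = M[Θ]`, `Θ(0) = Θ₀`: the equation is tested with smooth
functions `φ` (and `ψ = (-Δ)^γ φ`) and integrated from `0` to any time `t`. -/
structure IsSolution (κ μ Ω γ : ℝ) (S : L2) (s : ℝ) (p : ℝ≥0∞) (T : ℝ) (Θ₀ : L2)
    (Θ : ℝ → L2) : Prop where
  measurable : AEStronglyMeasurable Θ (volume.restrict (Icc 0 T))
  bounded : ∃ C : ℝ≥0, ∀ t ∈ Icc 0 T, sobolevNorm s p (Θ t) ≤ C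
  weak : ∃ U : ℝ → Fin 3 → L2,
    (∀ t ∈ Icc 0 T, ∀ j, IsMultiplier (symbolM μ Ω j) (Θ t) (U t j)) ∧
    ∀ (φ : Torus → ℝ) (ψ : L2), IsSmooth φ → IsMultiplier (fun k => normSq k ^ γ) φ ψ →
      ∀ t ∈ Icc 0 T,
        (∫ y, (Θ t y - Θ₀ y) * φ y ∂vol) + κ * (∫ τ in (0 : ℝ)..t, ∫ y, Θ τ y * ψ y ∂vol)
          - (∫ τ in (0 : ℝ)..t, ∫ y, Θ τ y * ∑ j, U τ j y * pderiv j φ y ∂vol)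
          = ∫ _τ in (0 : ℝ)..t, ∫ y, S y * φ y ∂vol

/-- The Cauchy problem with source `S` is locally Lipschitz `(X, Y)` well-posed, with
`X = H^{s,p}` and `Y = H^{r,q}`; the data have zero vertical mean. -/
def LipschitzWellPosed (κ μ Ω γ : ℝ) (S : L2) (s : ℝ) (p : ℝ≥0∞) (r : ℝ) (q : ℝ≥0∞) : Prop :=
  ∃ T K : ℝ≥0 × ℝ≥0 → ℝ, Continuous T ∧ Continuous K ∧ (∀ z, 0 < T z) ∧ (∀ z, 0 < K z) ∧
    ∀ f₁ f₂ : L2, HasZeroVerticalMean f₁ → HasZeroVerticalMean f₂ →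
      sobolevNorm r q f₁ < ∞ → sobolevNorm r q f₂ < ∞ →
      ∀ z, z = ((sobolevNorm r q f₁).toNNReal, (sobolevNorm r q f₂).toNNReal) →
        ∃ Θ₁ Θ₂ : ℝ → L2,
          IsSolution κ μ Ω γ S s p (T z) f₁ Θ₁ ∧
          (∀ Θ, IsSolution κ μ Ω γ S s p (T z) f₁ Θ → ∀ t ∈ Icc 0 (T z), Θ t = Θ₁ t) ∧
          IsSolution κ μ Ω γ S s p (T z) f₂ Θ₂ ∧
          (∀ Θ, IsSolution κ μ Ω γ S s p (T z) f₂ Θ → ∀ t ∈ Icc 0 (T z), Θ t = Θ₂ t) ∧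
          ∀ t ∈ Icc 0 (T z),
            sobolevNorm s p (Θ₁ t - Θ₂ t) ≤ ENNReal.ofReal (K z) * sobolevNorm r q (f₁ - f₂)

/-- The continuous function `a sin (m x₃)` on the torus. -/
def sinFun (a : ℝ) (m : ℕ) : C(Torus, ℝ) where
  toFun y := a * (fourier (T := 1) (m : ℤ) (y 2)).im
  continuous_toFun := by fun_prop

theorem sinFun_proj (a : ℝ) (m : ℕ) (x : Fin 3 → ℝ) :
    sinFun a m (proj x) = a * Real.sin (m * x 2) := by
  have hpi : (Real.pi : ℂ) ≠ 0 := by exact_mod_cast Real.pi_ne_zero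
  have h : 2 * (Real.pi : ℂ) * Complex.I * ((m : ℤ) : ℂ) * ((x 2 / (2 * Real.pi) : ℝ) : ℂ)
      / ((1 : ℝ) : ℂ) = ((m * x 2 : ℝ) : ℂ) * Complex.I := by
    push_cast
    field_simp
  show a * (fourier (T := 1) (m : ℤ) ((x 2 / (2 * Real.pi) : ℝ) : AddCircle (1 : ℝ))).im = _
  rw [fourier_coe_apply, h, Complex.exp_ofReal_mul_I_im]

/-- `a sin (m x₃)` as a square integrable function. -/
def sinL2 (a : ℝ) (m : ℕ) : L2 := ContinuousMap.toLp 2 vol ℝ (sinFun a m)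

end MG

end

/-! A profile depending on x₃ alone generates no velocity, so `a sin (m x₃)` is steady. Linearising
at it leaves one transport term, the vertical velocity of the perturbation times the slope of the
profile. Along horizontal frequencies with k₁ = k₂² and bounded k₃, the two summands of the
denominator are comparable and M̂₃ grows like k₂², that is, like |k|. This is exactly the order of
`κ (-Δ)^{1/2}`, so constants decide, and the largeness of `a` says that transport wins at k₃ = 2m.
The perturbation at (j², j) then grows at rate at least c j² (`exists_growth_rate`), and at any
fixed positive time exp (c j² T) beats every power of j lost between the two Sobolev norms.

These growing modes must come from true nonlinear solutions. For fixed j all frequencies stay on the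
plane lattice spanned by (k₁, k₂, 0) and (0, 0, m). On a fixed lattice the interaction kernel costs
one derivative (`exists_abs_ker_le`), which the Duhamel operator of a first order dissipation gives
back (`abs_duhamel_le`). In an exponentially weighted ℓ¹ space of functions of time the linearised
term is a bounded operator, made a contraction by factoring out exp (β t), and the quadratic term
carries the amplitude ε. So `exists_quadratic_fixedPoint` puts a nonlinear solution close to the
linear one. Nothing has to be uniform in j, because ε is chosen after j.

The growth of the linear solution is a positivity argument. The linearised evolution preserves an
alternating sign pattern in the vertical frequency (`linTerm_nonneg`), so all interactions may be
dropped except those between the modes (1, 1) and (1, 2), which feed each other (`linear_growth`).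
`isSolution_synth` returns from coefficients to the weak formulation, and the failure of Lipschitz
well-posedness follows from the continuity of its time and constant near the steady state. -/

noncomputable section

namespace MG

open UnitAddTorus Filter Topology
open scoped BoundedContinuousFunction

/-! ### Absolutely convergent trigonometric series -/

section Trig

variable {ι : Type*}

/-- The trigonometric series `∑ cᵢ exp (i eᵢ · x)`. -/
def trig (e : ι → Fin 3 → ℤ) (c : ι → ℂ) : C(Torus, ℂ) := ∑' i, c i • mFourier (e i)

theorem summable_trig (e : ι → Fin 3 → ℤ) {c : ι → ℂ} (hc : Summable fun i => ‖c i‖) :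
    Summable fun i => c i • mFourier (e i) :=
  Summable.of_norm (by simpa [norm_smul, mFourier_norm] using hc)

theorem hasSum_trig_apply (e : ι → Fin 3 → ℤ) {c : ι → ℂ} (hc : Summable fun i => ‖c i‖)
    (y : Torus) : HasSum (fun i => c i * mFourier (e i) y) (trig e c y) := by
  simpa [trig] using (ContinuousMap.evalCLM ℂ y).hasSum (summable_trig e hc).hasSum

theorem norm_trig_le (e : ι → Fin 3 → ℤ) {c : ι → ℂ} (hc : Summable fun i => ‖c i‖) :
    ‖trig e c‖ ≤ ∑' i, ‖c i‖ := by
  refine (norm_tsum_le_tsum_norm ?_).trans_eq ?_ <;> simp [norm_smul, mFourier_norm, hc]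

theorem norm_mFourier_apply (k : Fin 3 → ℤ) (y : Torus) : ‖mFourier k y‖ = 1 := by
  simp only [mFourier, ContinuousMap.coe_mk, norm_prod, fourier_apply, Circle.norm_coe,
    Finset.prod_const_one]

theorem continuous_trig (e : ι → Fin 3 → ℤ) {X : Type*} [TopologicalSpace X] {c : X → ι → ℂ}
    {G : ι → ℝ} (hG : Summable G) (hc : ∀ i, Continuous fun x => c x i)
    (hb : ∀ i x, ‖c x i‖ ≤ G i) : Continuous fun x => trig e (c x) := by
  refine continuous_tsum (fun i => (hc i).smul continuous_const) hG fun i x => ?_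
  simpa [norm_smul, mFourier_norm] using hb i x

theorem hasSum_integral_trig_mul [Countable ι] (e : ι → Fin 3 → ℤ) {c : ι → ℂ}
    (hc : Summable fun i => ‖c i‖) {φ : Torus → ℂ} (hφ : Integrable φ vol) :
    HasSum (fun i => c i * ∫ y, mFourier (e i) y * φ y ∂vol) (∫ y, trig e c y * φ y ∂vol) := by
  have hint : ∀ i, Integrable (fun y => c i * (mFourier (e i) y * φ y)) vol := fun i =>
    (hφ.bdd_mul (c := 1) (mFourier (e i)).continuous.aestronglyMeasurable
      (ae_of_all _ fun y => (norm_mFourier_apply _ y).le)).const_mul _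
  have h := hasSum_integral_of_summable_integral_norm hint (by
    have : ∀ i, ∫ y, ‖c i * (mFourier (e i) y * φ y)‖ ∂vol = ‖c i‖ * ∫ y, ‖φ y‖ ∂vol := fun i => by
      simp only [norm_mul, norm_mFourier_apply, one_mul, integral_const_mul]
    simp only [this]
    exact hc.mul_right _)
  simp only [integral_const_mul] at h
  convert! h using 1
  refine integral_congr_ae (ae_of_all _ fun y => ?_)
  simp only [← mul_assoc]
  rw [tsum_mul_right, (hasSum_trig_apply e hc y).tsum_eq]

theorem integral_mFourier (k : Fin 3 → ℤ) :
    ∫ y, mFourier k y ∂vol = if k = 0 then 1 else 0 := by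
  have h := orthonormal_iff_ite.1 (orthonormal_mFourier (d := Fin 3)) 0 k
  rw [ContinuousMap.inner_toLp] at h
  simp only [← mFourier_neg, ← mFourier_add, neg_zero, add_zero, eq_comm (a := (0 : Fin 3 → ℤ))] at h
  exact h

theorem integral_mFourier_mul_trig [Countable ι] {e : ι → Fin 3 → ℤ} {c : ι → ℂ}
    (hc : Summable fun i => ‖c i‖) (k : Fin 3 → ℤ) :
    HasSum (fun i => if e i = k then c i else 0) (∫ y, mFourier (-k) y * trig e c y ∂vol) := by
  have h := hasSum_integral_trig_mul e hc (φ := fun y => mFourier (-k) y)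
    ((mFourier (-k)).continuous.integrable_of_hasCompactSupport (HasCompactSupport.of_compactSpace _))
  simp only [← mFourier_add, integral_mFourier, add_neg_eq_zero, mul_ite, mul_one, mul_zero,
    mul_comm (trig e c _)] at h
  exact h

/-- The real part of a continuous function, as a square integrable function. -/
def realL2 : C(Torus, ℂ) →L[ℝ] L2 :=
  (ContinuousMap.toLp 2 vol ℝ).comp (Complex.reCLM.compLeftContinuous ℝ Torus)

theorem coeFn_realL2 (f : C(Torus, ℂ)) : ∀ᵐ y ∂vol, realL2 f y = (f y).re :=
  ContinuousMap.coeFn_toLp (p := 2) (𝕜 := ℝ) vol (Complex.reCLM.compLeftContinuous ℝ Torus f)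

/-- A continuous function with real values. -/
def IsRealFun (f : C(Torus, ℂ)) : Prop := ∀ y, (f y).im = 0

theorem IsRealFun.re_eq {f : C(Torus, ℂ)} (hf : IsRealFun f) (y : Torus) :
    (((f y).re : ℝ) : ℂ) = f y := Complex.ext rfl (by simp [hf y])

theorem IsRealFun.coeFn {f : C(Torus, ℂ)} (hf : IsRealFun f) :
    ∀ᵐ y ∂vol, ((realL2 f y : ℝ) : ℂ) = f y := by
  filter_upwards [coeFn_realL2 f] with y hy
  rw [hy, hf.re_eq]

theorem isRealFun_trig {ι : Type*} [AddGroup ι] {e : ι → Fin 3 → ℤ} (he : ∀ i, e (-i) = -e i)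
    {c : ι → ℂ} (hc : Summable fun i => ‖c i‖) (hr : ∀ i, c (-i) = (starRingEnd ℂ) (c i)) :
    IsRealFun (trig e c) := by
  intro y
  rw [← Complex.conj_eq_iff_im]
  have h := hasSum_trig_apply e hc y
  have h2 := Complex.hasSum_conj'.2 h
  have h3 := (Equiv.neg ι).hasSum_iff.2 h
  refine h2.unique ?_
  convert h3 using 2 with i
  simp [he, hr, mFourier_neg]

theorem fcoeff_congr {f g : Torus → ℝ} (h : f =ᵐ[vol] g) (k : Fin 3 → ℤ) :
    fcoeff f k = fcoeff g k := by
  refine integral_congr_ae ?_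
  filter_upwards [h] with y hy
  simp only [hy]

theorem fcoeff_eq (f : Torus → ℝ) (k : Fin 3 → ℤ) :
    fcoeff f k = ∫ y, mFourier (-k) y * (f y : ℂ) ∂vol := rfl

theorem hasSum_fcoeff_re_trig [Countable ι] {e : ι → Fin 3 → ℤ} {c : ι → ℂ}
    (hc : Summable fun i => ‖c i‖) (hr : IsRealFun (trig e c)) (k : Fin 3 → ℤ) :
    HasSum (fun i => if e i = k then c i else 0) (fcoeff (fun y => (trig e c y).re) k) := by
  simpa only [fcoeff_eq, hr.re_eq] using integral_mFourier_mul_trig (e := e) hc k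

theorem isMultiplier_trig [Countable ι] {e : ι → Fin 3 → ℤ} {c d : ι → ℂ}
    (hc : Summable fun i => ‖c i‖) (hr : IsRealFun (trig e c))
    (hd : Summable fun i => ‖d i‖) (hs : IsRealFun (trig e d)) {σ : (Fin 3 → ℤ) → ℝ}
    (h : ∀ i, d i = σ (e i) * c i) :
    IsMultiplier σ (fun y => (trig e c y).re) (fun y => (trig e d y).re) := by
  intro k
  refine (hasSum_fcoeff_re_trig hd hs k).unique ?_
  refine ((hasSum_fcoeff_re_trig hc hr k).mul_left ((σ k : ℝ) : ℂ)).congr_fun fun i => ?_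
  split_ifs with hi
  · rw [h i, hi]
  · simp

theorem fcoeff_re_trig [Countable ι] {e : ι → Fin 3 → ℤ} (he : Function.Injective e) {c : ι → ℂ}
    (hc : Summable fun i => ‖c i‖) (hr : IsRealFun (trig e c)) (i : ι) :
    fcoeff (fun y => (trig e c y).re) (e i) = c i := by
  refine (hasSum_fcoeff_re_trig hc hr (e i)).unique ?_
  classical
  refine (hasSum_ite_eq i (c i)).congr_fun fun j => ?_
  simp only [he.eq_iff]
  split_ifs with h <;> simp [h]

theorem IsMultiplier.congr {σ : (Fin 3 → ℤ) → ℝ} {f f' g g' : Torus → ℝ}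
    (h : IsMultiplier σ f g) (hf : f =ᵐ[vol] f') (hg : g =ᵐ[vol] g') : IsMultiplier σ f' g' := by
  intro k
  rw [← fcoeff_congr hf, ← fcoeff_congr hg, h k]

end Trig

/-! ### Sobolev norms -/

/-- The coefficient is bounded by the L¹ norm, and the measure has total mass one. -/
theorem norm_fcoeff_le {g : Torus → ℝ} {p : ℝ≥0∞} (hp : 1 ≤ p) (hg : MemLp g p vol)
    (k : Fin 3 → ℤ) : ENNReal.ofReal ‖fcoeff g k‖ ≤ eLpNorm g p vol := by
  refine le_trans ?_ (eLpNorm_le_eLpNorm_of_exponent_le hp hg.1)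
  rw [eLpNorm_one_eq_lintegral_enorm, fcoeff_eq, ofReal_norm]
  refine (enorm_integral_le_lintegral_enorm _).trans_eq ?_
  congr 1
  ext y
  rw [enorm_mul, ← ofReal_norm, norm_mFourier_apply]
  simp [← ofReal_norm]

theorem fcoeff_add {f g : Torus → ℝ} (hf : Integrable f vol) (hg : Integrable g vol)
    (k : Fin 3 → ℤ) : fcoeff (f + g) k = fcoeff f k + fcoeff g k := by
  have h : ∀ {f : Torus → ℝ}, Integrable f vol →
      Integrable (fun y => mFourier (-k) y * (f y : ℂ)) vol := fun hf =>
    hf.ofReal.bdd_mul (c := 1) (mFourier (-k)).continuous.aestronglyMeasurable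
      (ae_of_all _ fun y => (norm_mFourier_apply _ y).le)
  simp only [fcoeff_eq, Pi.add_apply, Complex.ofReal_add, mul_add]
  exact integral_add (h hf) (h hg)

theorem fcoeff_neg (f : Torus → ℝ) (k : Fin 3 → ℤ) : fcoeff (-f) k = -fcoeff f k := by
  simp [fcoeff_eq, integral_neg]

theorem L2_integrable (f : L2) : Integrable f vol :=
  (Lp.memLp f).integrable (by norm_num)

theorem sobolevNorm_add_le {s : ℝ} {p : ℝ≥0∞} (hp : 1 ≤ p) (f g : L2) :
    sobolevNorm s p (f + g) ≤ sobolevNorm s p f + sobolevNorm s p g := by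
  unfold sobolevNorm
  simp only [ENNReal.iInf_add, ENNReal.add_iInf]
  refine le_iInf fun ψ => le_iInf fun hψ => le_iInf fun φ => le_iInf fun hφ => ?_
  refine (iInf₂_le (φ + ψ) ⟨hφ.1.add hψ.1, fun k => ?_⟩).trans (eLpNorm_add_le hφ.1.1 hψ.1.1 hp)
  rw [fcoeff_add (hφ.1.integrable hp) (hψ.1.integrable hp), hφ.2 k, hψ.2 k,
    fcoeff_congr (Lp.coeFn_add f g), fcoeff_add (L2_integrable f) (L2_integrable g), mul_add]

theorem sobolevNorm_neg_le {s : ℝ} {p : ℝ≥0∞} (f : L2) :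
    sobolevNorm s p (-f) ≤ sobolevNorm s p f := by
  refine le_iInf fun φ => le_iInf fun hφ => ?_
  refine (iInf₂_le (-φ) ⟨hφ.1.neg, fun k => ?_⟩).trans_eq (eLpNorm_neg _ _ _)
  rw [fcoeff_neg, hφ.2 k, fcoeff_congr (Lp.coeFn_neg f), fcoeff_neg, mul_neg]

theorem sobolevNorm_sub_comm {s : ℝ} {p : ℝ≥0∞} (f g : L2) :
    sobolevNorm s p (f - g) = sobolevNorm s p (g - f) :=
  le_antisymm (by simpa using sobolevNorm_neg_le (s := s) (p := p) (g - f))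
    (by simpa using sobolevNorm_neg_le (s := s) (p := p) (f - g))

/-- The Sobolev norm dominates each weighted Fourier coefficient. -/
theorem fcoeff_le_sobolevNorm {s : ℝ} {p : ℝ≥0∞} (hp : 1 ≤ p) (f : L2) (k : Fin 3 → ℤ) :
    ENNReal.ofReal ((1 + normSq k) ^ (s / 2) * ‖fcoeff f k‖) ≤ sobolevNorm s p f := by
  refine le_iInf fun g => le_iInf fun hg => ?_
  refine le_trans (le_of_eq ?_) (norm_fcoeff_le hp hg.1 k)
  have h : 0 ≤ normSq k := Finset.sum_nonneg fun _ _ => sq_nonneg _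
  rw [hg.2 k, norm_mul, Complex.norm_real, Real.norm_of_nonneg (by positivity)]

/-- An absolutely convergent weighted series is bounded by its coefficient sum, and on a probability
space the sup bound dominates every L^p norm. One weighted ℓ¹ bound therefore serves all exponents.
-/
theorem sobolevNorm_trig_le {ι : Type*} [Countable ι] {e : ι → Fin 3 → ℤ} {c : ι → ℂ}
    (s : ℝ) (p : ℝ≥0∞) (hc : Summable fun i => ‖c i‖) (hr : IsRealFun (trig e c))
    (hd : Summable fun i => (1 + normSq (e i)) ^ (s / 2) * ‖c i‖)
    (hs : IsRealFun (trig e fun i => (((1 + normSq (e i)) ^ (s / 2) : ℝ) : ℂ) * c i)) :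
    sobolevNorm s p (realL2 (trig e c)) ≤
      ENNReal.ofReal (∑' i, (1 + normSq (e i)) ^ (s / 2) * ‖c i‖) := by
  set d : ι → ℂ := fun i => (((1 + normSq (e i)) ^ (s / 2) : ℝ) : ℂ) * c i with hdd
  have hn : ∀ i, ‖d i‖ = (1 + normSq (e i)) ^ (s / 2) * ‖c i‖ := fun i => by
    have h : 0 ≤ normSq (e i) := Finset.sum_nonneg fun _ _ => sq_nonneg _
    rw [hdd, norm_mul, Complex.norm_real, Real.norm_of_nonneg (by positivity)]
  have hd' : Summable fun i => ‖d i‖ := by simpa only [hn] using hd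
  have hb : ∀ᵐ y ∂vol, ‖(trig e d y).re‖ ≤ ∑' i, ‖d i‖ := ae_of_all _ fun y =>
    (Complex.abs_re_le_norm _).trans (((trig e d).norm_coe_le_norm y).trans (norm_trig_le e hd'))
  have hm : AEStronglyMeasurable (fun y => (trig e d y).re) vol :=
    (Complex.continuous_re.comp (trig e d).continuous).aestronglyMeasurable
  refine (iInf₂_le (fun y => (trig e d y).re) ⟨MemLp.of_bound hm _ hb,
    (isMultiplier_trig (σ := fun k => (1 + normSq k) ^ (s / 2)) hc hr hd' hs fun i => rfl).congr
      (by filter_upwards [coeFn_realL2 (trig e c)] with y hy using hy.symm) (ae_eq_refl _)⟩).trans ?_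
  refine (eLpNorm_le_of_ae_bound hb).trans ?_
  simp [hn]

/-! ### Smooth functions on the torus -/

theorem proj_add (x z : Fin 3 → ℝ) : proj (x + z) = proj x + proj z := by
  ext i
  simp [proj, add_div]

theorem proj_zero : proj 0 = 0 := by
  ext i
  simp [proj]

/-- Smoothness is defined on the periodic lift; the quotient map is what brings continuity back to
the torus. -/
theorem isOpenQuotientMap_proj : IsOpenQuotientMap proj := by
  refine IsOpenQuotientMap.piMap (f := fun _ (x : ℝ) => ((x / (2 * Real.pi) : ℝ) : UnitAddCircle))
    fun _ => ?_
  have h : IsOpenQuotientMap (fun x : ℝ => x / (2 * Real.pi)) := by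
    simpa only [div_eq_mul_inv] using!
      (Homeomorph.mulRight₀ (2 * Real.pi)⁻¹ (by positivity)).isOpenQuotientMap
  exact (QuotientAddGroup.isOpenQuotientMap_mk (N := AddSubgroup.zmultiples (1 : ℝ))).comp h

theorem IsSmooth.continuous {φ : Torus → ℝ} (hφ : IsSmooth φ) : Continuous φ :=
  isOpenQuotientMap_proj.isQuotientMap.continuous_iff.2 (ContDiff.continuous hφ)

theorem IsSmooth.hasDerivAt {φ : Torus → ℝ} (hφ : IsSmooth φ) (j : Fin 3) (x : Fin 3 → ℝ) :
    HasDerivAt (fun h : ℝ => φ (proj x + proj (Pi.single j h)))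
      (fderiv ℝ (fun x => φ (proj x)) x (Pi.single j 1)) 0 := by
  have h1 : HasFDerivAt (fun x => φ (proj x)) (fderiv ℝ (fun x => φ (proj x)) x)
      (x + Pi.single j 0) := by
    simpa using (hφ.differentiable (by simp) x).hasFDerivAt
  have h2 : HasDerivAt (fun h : ℝ => x + Pi.single (M := fun _ => ℝ) j h) (Pi.single j 1) 0 :=
    (hasDerivAt_single j (0 : ℝ)).const_add x
  simpa only [Function.comp_def, proj_add] using h1.comp_hasDerivAt (0 : ℝ) h2

theorem IsSmooth.pderiv_proj {φ : Torus → ℝ} (hφ : IsSmooth φ) (j : Fin 3) (x : Fin 3 → ℝ) :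
    pderiv j φ (proj x) = fderiv ℝ (fun x => φ (proj x)) x (Pi.single j 1) :=
  (hφ.hasDerivAt j x).deriv

theorem IsSmooth.continuous_pderiv {φ : Torus → ℝ} (hφ : IsSmooth φ) (j : Fin 3) :
    Continuous (pderiv j φ) := by
  refine isOpenQuotientMap_proj.isQuotientMap.continuous_iff.2 ?_
  have : pderiv j φ ∘ proj = fun x => fderiv ℝ (fun x => φ (proj x)) x (Pi.single j 1) :=
    funext fun x => hφ.pderiv_proj j x
  rw [this]
  exact (hφ.continuous_fderiv (by simp)).clm_apply continuous_const

theorem IsSmooth.hasDerivAt_pderiv {φ : Torus → ℝ} (hφ : IsSmooth φ) (j : Fin 3) (y : Torus)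
    (t : ℝ) : HasDerivAt (fun h : ℝ => φ (y + proj (Pi.single j h)))
      (pderiv j φ (y + proj (Pi.single j t))) t := by
  obtain ⟨x, rfl⟩ := isOpenQuotientMap_proj.surjective y
  have h := hφ.hasDerivAt j (x + Pi.single j t)
  rw [← hφ.pderiv_proj, ← sub_self t] at h
  have h2 := h.comp_sub_const t t
  rw [proj_add] at h2
  convert! h2 using 2 with s
  rw [← proj_add, ← proj_add, ← proj_add, add_assoc, ← Pi.single_add]
  simp

theorem mFourier_add_proj (k : Fin 3 → ℤ) (y : Torus) (j : Fin 3) (h : ℝ) :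
    mFourier k (y + proj (Pi.single j h)) =
      mFourier k y * Complex.exp ((k j * h : ℝ) * Complex.I) := by
  have hpi : (Real.pi : ℂ) ≠ 0 := by exact_mod_cast Real.pi_ne_zero
  have h1 : ∀ i, fourier (T := 1) (k i) (proj (Pi.single j h) i) =
      if i = j then Complex.exp ((k j * h : ℝ) * Complex.I) else 1 := by
    intro i
    rw [proj, fourier_coe_apply]
    split_ifs with hi
    · subst hi
      congr 1
      simp
      field_simp
    · simp [Pi.single_eq_of_ne hi]
  have h2 : ∀ i, fourier (T := 1) (k i) ((y + proj (Pi.single j h)) i) =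
      fourier (T := 1) (k i) (y i) * fourier (T := 1) (k i) (proj (Pi.single j h) i) := by
    intro i
    simp only [fourier_apply, Pi.add_apply, smul_add, AddCircle.toCircle_add, Circle.coe_mul]
  simp only [mFourier, ContinuousMap.coe_mk, h2, h1, Finset.prod_mul_distrib,
    Finset.prod_ite_eq', Finset.mem_univ, if_true]

/-- Integration by parts against an exponential. -/
theorem integral_mFourier_mul_pderiv {φ : Torus → ℝ} (hφ : IsSmooth φ) (j : Fin 3)
    (k : Fin 3 → ℤ) :
    ∫ y, mFourier k y * (pderiv j φ y : ℂ) ∂vol =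
      -Complex.I * k j * ∫ y, mFourier k y * (φ y : ℂ) ∂vol := by
  obtain ⟨C, hC⟩ := (isCompact_range (hφ.continuous_pderiv j)).isBounded.exists_norm_le
  have hcont : ∀ h : ℝ, Continuous fun y => mFourier k y * (φ (y + proj (Pi.single j h)) : ℂ) :=
    fun h => (mFourier k).continuous.mul (Complex.continuous_ofReal.comp
      (hφ.continuous.comp (continuous_id.add continuous_const)))
  have h1 := (hasDerivAt_integral_of_dominated_loc_of_deriv_le (μ := vol) (𝕜 := ℝ) (x₀ := (0 : ℝ))
    (F := fun h y => mFourier k y * (φ (y + proj (Pi.single j h)) : ℂ))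
    (F' := fun h y => mFourier k y * (pderiv j φ (y + proj (Pi.single j h)) : ℂ))
    (bound := fun _ => C) univ_mem
    (Eventually.of_forall fun h => (hcont h).aestronglyMeasurable)
    ((hcont 0).integrable_of_hasCompactSupport (HasCompactSupport.of_compactSpace _))
    (((mFourier k).continuous.mul (Complex.continuous_ofReal.comp
      ((hφ.continuous_pderiv j).comp (continuous_id.add continuous_const)))).aestronglyMeasurable)
    (ae_of_all _ fun y h _ => by
      rw [norm_mul, norm_mFourier_apply, one_mul, Complex.norm_real]
      exact hC _ ⟨_, rfl⟩)
    (integrable_const _)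
    (ae_of_all _ fun y h _ => ((hφ.hasDerivAt_pderiv j y h).ofReal_comp).const_mul _)).2
  -- Translation invariance moves the shift from φ to the exponential, so the same integral can be
  -- differentiated in a second way.
  have h2 : (fun h : ℝ => ∫ y, mFourier k y * (φ (y + proj (Pi.single j h)) : ℂ) ∂vol) =
      fun h : ℝ => Complex.exp ((k j * h : ℝ) * -Complex.I) * ∫ y, mFourier k y * (φ y : ℂ) ∂vol := by
    funext h
    rw [← integral_add_right_eq_self (μ := vol) (fun y => mFourier k y * (φ y : ℂ))
      (proj (Pi.single j h)), ← integral_const_mul]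
    refine integral_congr_ae (ae_of_all _ fun y => ?_)
    simp only [mFourier_add_proj]
    have : Complex.exp ((k j * h : ℝ) * -Complex.I) * Complex.exp ((k j * h : ℝ) * Complex.I) = 1 := by
      rw [← Complex.exp_add]; simp
    linear_combination (-(mFourier k y * (φ (y + proj (Pi.single j h)) : ℂ))) * this
  rw [h2] at h1
  have h3 : HasDerivAt (fun h : ℝ => Complex.exp ((k j * h : ℝ) * -Complex.I) *
      ∫ y, mFourier k y * (φ y : ℂ) ∂vol)
      (-Complex.I * k j * ∫ y, mFourier k y * (φ y : ℂ) ∂vol) 0 := by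
    have h4 : HasDerivAt (fun h : ℝ => ((k j * h : ℝ) : ℂ) * -Complex.I) (k j * -Complex.I) 0 := by
      simpa using! (((hasDerivAt_id (0 : ℝ)).const_mul (k j : ℝ)).ofReal_comp).mul_const (-Complex.I)
    simpa [mul_comm] using h4.cexp.mul_const (∫ y, mFourier k y * (φ y : ℂ) ∂vol)
  have h5 := h1.unique h3
  simpa [proj_zero] using h5

/-! ### Fixed points -/

theorem exists_fixedPoint_mem {Z : Type*} [MetricSpace Z] [CompleteSpace Z] {S : Set Z}
    (hS : IsClosed S) (hne : S.Nonempty) {f : Z → Z} (hf : MapsTo f S S) {K : ℝ≥0} (hK : K < 1)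
    (hL : ∀ x ∈ S, ∀ y ∈ S, dist (f x) (f y) ≤ K * dist x y) : ∃ y ∈ S, f y = y := by
  obtain ⟨x, hx⟩ := hne
  have hc : ContractingWith K (hf.restrict f S S) :=
    ⟨hK, LipschitzWith.of_dist_le_mul fun x y => hL x x.2 y y.2⟩
  obtain ⟨y, hy, hfy, -⟩ := hc.exists_fixedPoint' hS.isComplete hf hx (edist_ne_top _ _)
  exact ⟨y, hy, hfy⟩

/-- The invariant set is any closed set and not only a subspace, so that the fixed point can inherit
a sign pattern. -/
theorem exists_linear_fixedPoint {Z : Type*} [NormedAddCommGroup Z] [NormedSpace ℝ Z]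
    [CompleteSpace Z] {S : Set Z} (hS : IsClosed S) (hne : S.Nonempty) (P : Z →L[ℝ] Z)
    (hP : ‖P‖ ≤ 1 / 2) (v : Z) (hv : ∀ y ∈ S, v + P y ∈ S) : ∃ w ∈ S, v + P w = w := by
  refine exists_fixedPoint_mem hS hne hv (K := 1 / 2) (by norm_num) fun x _ y _ => ?_
  rw [dist_add_left, dist_eq_norm, dist_eq_norm, ← map_sub]
  refine (P.le_opNorm _).trans ?_
  simpa using mul_le_mul_of_nonneg_right hP (norm_nonneg (x - y))

/-- Small quadratic perturbations of a linear fixed point. -/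
theorem exists_quadratic_fixedPoint {Z : Type*} [NormedAddCommGroup Z] [NormedSpace ℝ Z]
    [CompleteSpace Z] (S : Submodule ℝ Z) (hS : IsClosed (S : Set Z)) (P : Z →L[ℝ] Z)
    (hP : ‖P‖ ≤ 1 / 2) (hPS : ∀ y ∈ S, P y ∈ S) (B : Z →L[ℝ] Z →L[ℝ] Z)
    (hBS : ∀ y ∈ S, B y y ∈ S) {v w : Z} (hw : w ∈ S) (hvw : v + P w = w) {η : ℝ} (hη : 0 < η) :
    ∃ ε₀ : ℝ, 0 < ε₀ ∧ ∀ ε : ℝ, 0 < ε → ε ≤ ε₀ → ∃ y ∈ S, v + P y + ε • B y y = y ∧ ‖y - w‖ ≤ η := by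
  set R := ‖w‖ + η with hR
  have hR0 : 0 < R := by positivity
  set b := ‖B‖ + 1 with hb
  have hb0 : 0 < b := by positivity
  have hB2 : ∀ x y : Z, ‖B x y‖ ≤ b * ‖x‖ * ‖y‖ := fun x y =>
    (B.le_opNorm₂ x y).trans (by gcongr; simp [hb])
  have hP2 : ∀ x : Z, ‖P x‖ ≤ 1 / 2 * ‖x‖ := fun x =>
    (P.le_opNorm x).trans (by gcongr)
  -- The first bound keeps the ball of radius η about w invariant: half of η goes to P, half to the
  -- quadratic term. The second adds at most 1/4 to the Lipschitz constant 1/2.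
  refine ⟨min (η / (2 * b * R ^ 2)) (1 / (8 * b * R)), by positivity, fun ε hε hε₀ => ?_⟩
  have h1 : ε * (b * R * R) ≤ η / 2 := by
    have := hε₀.trans (min_le_left _ _)
    rw [le_div_iff₀ (by positivity)] at this
    linarith
  have h2 : ε * (2 * b * R) ≤ 1 / 4 := by
    have := hε₀.trans (min_le_right _ _)
    rw [le_div_iff₀ (by positivity)] at this
    linarith
  have hball : ∀ y : Z, ‖y - w‖ ≤ η → ‖y‖ ≤ R := fun y hy => by
    calc ‖y‖ = ‖w + (y - w)‖ := by simp
      _ ≤ _ := (norm_add_le _ _).trans (by rw [hR]; gcongr)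
  have hcl : IsClosed ((S : Set Z) ∩ {y | ‖y - w‖ ≤ η}) :=
    hS.inter (isClosed_le (by fun_prop) continuous_const)
  have hmaps : MapsTo (fun y => v + P y + ε • B y y) ((S : Set Z) ∩ {y | ‖y - w‖ ≤ η})
      ((S : Set Z) ∩ {y | ‖y - w‖ ≤ η}) := by
    rintro y ⟨hyS, hy⟩
    -- Recentring at w removes v, leaving a contraction of the deviation and a term of size ε.
    have he : v + P y + ε • B y y = w + (P (y - w) + ε • B y y) := by
      have : v = w - P w := eq_sub_of_add_eq hvw
      rw [map_sub, this]
      abel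
    refine ⟨?_, ?_⟩
    · show v + P y + ε • B y y ∈ S
      rw [he]
      exact S.add_mem hw (S.add_mem (hPS _ (S.sub_mem hyS hw)) (S.smul_mem _ (hBS _ hyS)))
    · simp only [mem_ofPred_eq, he, add_sub_cancel_left] at hy ⊢
      have hyR := hball y hy
      calc ‖P (y - w) + ε • B y y‖ ≤ 1 / 2 * ‖y - w‖ + ε * (b * ‖y‖ * ‖y‖) := by
            refine (norm_add_le _ _).trans (add_le_add (hP2 _) ?_)
            rw [norm_smul, Real.norm_of_nonneg hε.le]
            gcongr
            exact hB2 _ _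
        _ ≤ 1 / 2 * η + ε * (b * R * R) := by gcongr
        _ ≤ η := by linarith
  obtain ⟨y, ⟨hyS, hy⟩, hfy⟩ := exists_fixedPoint_mem hcl ⟨w, hw, by simpa using hη.le⟩ hmaps
    (K := 3 / 4) (by rw [← NNReal.coe_lt_coe]; norm_num) (by
      rintro x ⟨-, hx⟩ y ⟨-, hy⟩
      rw [dist_eq_norm, dist_eq_norm]
      have he : v + P x + ε • B x x - (v + P y + ε • B y y) =
          P (x - y) + ε • (B (x - y) x + B y (x - y)) := by
        simp only [map_sub, sub_apply, smul_add, smul_sub]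
        abel
      rw [he]
      calc ‖P (x - y) + ε • (B (x - y) x + B y (x - y))‖
          ≤ 1 / 2 * ‖x - y‖ + ε * (b * ‖x - y‖ * ‖x‖ + b * ‖y‖ * ‖x - y‖) := by
            refine (norm_add_le _ _).trans (add_le_add (hP2 _) ?_)
            rw [norm_smul, Real.norm_of_nonneg hε.le]
            gcongr
            exact (norm_add_le _ _).trans (add_le_add (hB2 _ _) (hB2 _ _))
        _ ≤ 1 / 2 * ‖x - y‖ + ε * (b * ‖x - y‖ * R + b * R * ‖x - y‖) := by
            gcongr
            exacts [hball x hx, hball y hy]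
        _ = (1 / 2 + ε * (2 * b * R)) * ‖x - y‖ := by ring
        _ ≤ ((3 / 4 : ℝ≥0) : ℝ) * ‖x - y‖ := by
            gcongr
            push_cast
            linarith)
  exact ⟨y, hyS, hfy, hy⟩

/-! ### Convolutions on sequences -/

section Convolution

variable {ι : Type*} [AddCommGroup ι]

/-- The pairs `(i, i')` and the pairs `(i', i - i')`. -/
@[simps]
def convEquiv (ι : Type*) [AddCommGroup ι] : ι × ι ≃ ι × ι where
  toFun x := (x.2, x.1 - x.2)
  invFun x := (x.1 + x.2, x.1)
  left_inv x := by simp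
  right_inv x := by simp

theorem summable_conv {α β : ι → ℝ} (hα : Summable α) (hβ : Summable β) (hα0 : 0 ≤ α)
    (hβ0 : 0 ≤ β) : Summable fun x : ι × ι => α x.2 * β (x.1 - x.2) :=
  (convEquiv ι).summable_iff.2 (hα.mul_of_nonneg hβ hα0 hβ0)

theorem tsum_conv {α β : ι → ℝ} (hα : Summable α) (hβ : Summable β) (hα0 : 0 ≤ α)
    (hβ0 : 0 ≤ β) : ∑' i, ∑' i', α i' * β (i - i') = (∑' i, α i) * ∑' i, β i := by
  have h := summable_conv hα hβ hα0 hβ0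
  rw [← h.tsum_prod, hα.tsum_mul_tsum hβ (hα.mul_of_nonneg hβ hα0 hβ0)]
  exact (convEquiv ι).tsum_eq (fun x : ι × ι => α x.1 * β x.2)

/-- Absolutely summable sequences with values in `E`. -/
abbrev Seq (ι E : Type*) [NormedAddCommGroup E] : Type _ := lp (fun _ : ι => E) 1

theorem Seq.hasSum_norm {ι E : Type*} [NormedAddCommGroup E] (y : Seq ι E) :
    HasSum (fun i => ‖y i‖) ‖y‖ := by
  simpa using lp.hasSum_norm (p := 1) (by simp) y

theorem memℓp_one {ι E : Type*} [NormedAddCommGroup E] {f : ι → E} (hf : Summable fun i => ‖f i‖) :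
    Memℓp f 1 := memℓp_gen (by simpa using hf)

theorem norm_conv_term_le {ι E : Type*} [NormedCommRing E] [NormedAlgebra ℝ E]
    {T : ι → ι → E →L[ℝ] E} {C : ℝ} (hT : ∀ i j, ‖T i j‖ ≤ C)
    (y z : Seq ι E) (i j : ι) : ‖T i j (y i * z j)‖ ≤ C * (‖y i‖ * ‖z j‖) := by
  have hC : 0 ≤ C := (norm_nonneg _).trans (hT i j)
  exact ((T i j).le_opNorm _).trans (mul_le_mul (hT i j) (norm_mul_le _ _) (norm_nonneg _) hC)

variable {E : Type*} [NormedCommRing E] [NormedAlgebra ℝ E] [CompleteSpace E]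

theorem summable_conv_term {T : ι → ι → E →L[ℝ] E} {C : ℝ} (hT : ∀ i j, ‖T i j‖ ≤ C)
    (y z : Seq ι E) : Summable fun x : ι × ι => ‖T x.2 (x.1 - x.2) (y x.2 * z (x.1 - x.2))‖ :=
  Summable.of_nonneg_of_le (fun _ => norm_nonneg _) (fun _ => norm_conv_term_le hT y z _ _)
    ((summable_conv y.hasSum_norm.summable z.hasSum_norm.summable (fun _ => norm_nonneg _)
      fun _ => norm_nonneg _).mul_left C)

theorem summable_conv_fiber {T : ι → ι → E →L[ℝ] E} {C : ℝ} (hT : ∀ i j, ‖T i j‖ ≤ C)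
    (y z : Seq ι E) (i : ι) : Summable fun j => T j (i - j) (y j * z (i - j)) :=
  ((summable_conv_term hT y z).prod_factor i).of_norm

/-- Young's inequality ℓ¹ * ℓ¹ ⊂ ℓ¹, for a uniformly bounded family of operators applied to the
products. -/
theorem norm_conv_le {T : ι → ι → E →L[ℝ] E} {C : ℝ} (hT : ∀ i j, ‖T i j‖ ≤ C)
    (y z : Seq ι E) :
    (Summable fun i => ‖∑' j, T j (i - j) (y j * z (i - j))‖) ∧
      ∑' i, ‖∑' j, T j (i - j) (y j * z (i - j))‖ ≤ C * ‖y‖ * ‖z‖ := by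
  have hs := summable_conv y.hasSum_norm.summable z.hasSum_norm.summable (fun _ => norm_nonneg _)
    fun _ => norm_nonneg _
  have h1 : ∀ i, ‖∑' j, T j (i - j) (y j * z (i - j))‖ ≤ ∑' j, C * (‖y j‖ * ‖z (i - j)‖) :=
    fun i => tsum_of_norm_bounded ((hs.mul_left C).prod_factor i).hasSum
      fun j => norm_conv_term_le hT y z j (i - j)
  have h2 : Summable fun i => ∑' j, C * (‖y j‖ * ‖z (i - j)‖) := (hs.mul_left C).prod
  have h3 : Summable fun i => ‖∑' j, T j (i - j) (y j * z (i - j))‖ :=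
    h2.of_nonneg_of_le (fun _ => norm_nonneg _) h1
  refine ⟨h3, (h3.tsum_le_tsum h1 h2).trans_eq ?_⟩
  simp only [tsum_mul_left]
  rw [tsum_conv y.hasSum_norm.summable z.hasSum_norm.summable (fun _ => norm_nonneg _)
    fun _ => norm_nonneg _, y.hasSum_norm.tsum_eq, z.hasSum_norm.tsum_eq, mul_assoc]

/-- The convolution `(y, z) ↦ ∑ⱼ T j (i - j) (yⱼ z_{i - j})` on summable sequences. -/
def conv (T : ι → ι → E →L[ℝ] E) {C : ℝ} (hT : ∀ i j, ‖T i j‖ ≤ C) :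
    Seq ι E →L[ℝ] Seq ι E →L[ℝ] Seq ι E :=
  LinearMap.mkContinuous₂
    (LinearMap.mk₂ ℝ
      (fun y z => (⟨fun i => ∑' j, T j (i - j) (y j * z (i - j)),
        memℓp_one (norm_conv_le hT y z).1⟩ : Seq ι E))
      (fun y y' z => by
        ext1; funext i
        have h := (summable_conv_fiber hT y z i).tsum_add (summable_conv_fiber hT y' z i)
        simpa [add_mul] using! h)
      (fun c y z => by
        ext1; funext i
        have h := (summable_conv_fiber hT y z i).tsum_const_smul c
        simpa using h)
      (fun y z z' => by
        ext1; funext i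
        have h := (summable_conv_fiber hT y z i).tsum_add (summable_conv_fiber hT y z' i)
        simpa [mul_add] using! h)
      (fun c y z => by
        ext1; funext i
        have h := (summable_conv_fiber hT y z i).tsum_const_smul c
        simpa using h))
    C (fun y z => by
      rw [← (Seq.hasSum_norm _).tsum_eq]
      exact (norm_conv_le hT y z).2)

theorem conv_apply (T : ι → ι → E →L[ℝ] E) {C : ℝ} (hT : ∀ i j, ‖T i j‖ ≤ C) (y z : Seq ι E)
    (i : ι) : conv T hT y z i = ∑' j, T j (i - j) (y j * z (i - j)) := rfl

theorem norm_conv_apply_le (T : ι → ι → E →L[ℝ] E) {C : ℝ} (hT : ∀ i j, ‖T i j‖ ≤ C)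
    (y z : Seq ι E) : ‖conv T hT y z‖ ≤ C * ‖y‖ * ‖z‖ := by
  rw [← (Seq.hasSum_norm _).tsum_eq]
  exact (norm_conv_le hT y z).2

/-- The sequences that are odd under an involution of the indices. -/
def oddSeq (τ : ι → ι) : Submodule ℝ (Seq ι E) where
  carrier := {y | ∀ i, y (τ i) = -y i}
  add_mem' {y z} hy hz i := by
    simp only [lp.coeFn_add, Pi.add_apply, hy i, hz i]
    abel
  zero_mem' i := by simp
  smul_mem' c y hy i := by
    simp only [lp.coeFn_smul, Pi.smul_apply, hy i, smul_neg]

theorem isClosed_oddSeq (τ : ι → ι) : IsClosed (oddSeq (E := E) τ : Set (Seq ι E)) := by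
  have : (oddSeq (E := E) τ : Set (Seq ι E)) = ⋂ i, {y | y (τ i) = -y i} := by
    ext y
    simp only [mem_iInter]
    rfl
  rw [this]
  refine isClosed_iInter fun i => isClosed_eq ?_ ?_
  · exact (lp.evalCLM ℝ (fun _ : ι => E) 1 (τ i)).continuous
  · exact (lp.evalCLM ℝ (fun _ : ι => E) 1 i).continuous.neg

/-- The two odd factors cancel their signs in the product, and the odd kernel supplies the remaining
one. -/
theorem conv_mem_oddSeq (τ : ι ≃+ ι) (T : ι → ι → E →L[ℝ] E) {C : ℝ} (hT : ∀ i j, ‖T i j‖ ≤ C)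
    (hτ : ∀ i j, T (τ i) (τ j) = -T i j) {y z : Seq ι E} (hy : y ∈ oddSeq τ)
    (hz : z ∈ oddSeq τ) : conv T hT y z ∈ oddSeq τ := by
  intro i
  rw [conv_apply, conv_apply, ← τ.toEquiv.tsum_eq, ← tsum_neg]
  refine tsum_congr fun j => ?_
  have h1 : y (τ j) = -y j := hy j
  have h2 : z (τ (i - j)) = -z (i - j) := hz (i - j)
  show T (τ j) (τ i - τ j) (y (τ j) * z (τ i - τ j)) = _
  rw [← map_sub, hτ, h1, h2, neg_mul_neg, neg_apply]

end Convolution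

/-! ### The symbols on a plane lattice -/

/-- The frequency `(x k₁, x k₂, y m)`. -/
def lat (k₁ k₂ m : ℤ) (i : ℤ × ℤ) : Fin 3 → ℤ := ![i.1 * k₁, i.1 * k₂, i.2 * m]

theorem lat_add (k₁ k₂ m : ℤ) (i j : ℤ × ℤ) : lat k₁ k₂ m (i + j) = lat k₁ k₂ m i + lat k₁ k₂ m j := by
  ext l
  fin_cases l <;> simp [lat, add_mul]

theorem lat_neg (k₁ k₂ m : ℤ) (i : ℤ × ℤ) : lat k₁ k₂ m (-i) = -lat k₁ k₂ m i := by
  ext l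
  fin_cases l <;> simp [lat]

theorem lat_injective {k₁ k₂ m : ℤ} (hk : k₂ ≠ 0) (hm : m ≠ 0) :
    Function.Injective (lat k₁ k₂ m) := by
  rintro ⟨x, y⟩ ⟨x', y'⟩ h
  have h1 := congr_fun h 1
  have h2 := congr_fun h 2
  simp only [lat, Matrix.cons_val] at h1 h2
  rw [mul_right_cancel₀ hk h1, mul_right_cancel₀ hm h2]

theorem normSq_nonneg (k : Fin 3 → ℤ) : 0 ≤ normSq k := Finset.sum_nonneg fun _ _ => sq_nonneg _

theorem normSq_neg (k : Fin 3 → ℤ) : normSq (-k) = normSq k := by simp [normSq]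

theorem normSq_lat (k₁ k₂ m : ℤ) (i : ℤ × ℤ) :
    normSq (lat k₁ k₂ m i) = (i.1 : ℝ) ^ 2 * ((k₁ : ℝ) ^ 2 + (k₂ : ℝ) ^ 2) + (i.2 : ℝ) ^ 2 * (m : ℝ) ^ 2 := by
  simp [normSq, Fin.sum_univ_three, lat]
  ring

/-- The reflection `(x, y) ↦ (x, -y)`. -/
def flip : ℤ × ℤ ≃+ ℤ × ℤ := (AddEquiv.refl ℤ).prodCongr (AddEquiv.neg ℤ)

@[simp] theorem flip_apply (i : ℤ × ℤ) : flip i = (i.1, -i.2) := rfl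

/-- The size `1 + |x| + |y|`. -/
def sz (i : ℤ × ℤ) : ℝ := 1 + |(i.1 : ℝ)| + |(i.2 : ℝ)|

/-- The exponential weight `2 ^ (|x| + |y|)`. -/
def wt (i : ℤ × ℤ) : ℝ := 2 ^ (i.1.natAbs + i.2.natAbs)

theorem one_le_sz (i : ℤ × ℤ) : 1 ≤ sz i := by
  unfold sz; linarith [abs_nonneg (i.1 : ℝ), abs_nonneg (i.2 : ℝ)]

theorem one_le_wt (i : ℤ × ℤ) : 1 ≤ wt i := one_le_pow₀ (by norm_num)

theorem sz_eq (i : ℤ × ℤ) : sz i = ((1 + (i.1.natAbs + i.2.natAbs) : ℕ) : ℝ) := by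
  simp [sz, Nat.cast_natAbs, add_assoc]

theorem wt_add_le (i j : ℤ × ℤ) : wt (i + j) ≤ wt i * wt j := by
  unfold wt
  rw [← pow_add]
  refine pow_le_pow_right₀ (by norm_num) ?_
  have h1 := Int.natAbs_add_le i.1 j.1
  have h2 := Int.natAbs_add_le i.2 j.2
  simp only [Prod.fst_add, Prod.snd_add]
  omega

theorem sz_add_le (i j : ℤ × ℤ) : sz (i + j) ≤ sz i * sz j := by
  simp only [sz, Prod.fst_add, Prod.snd_add, Int.cast_add]
  have h1 := abs_add_le (i.1 : ℝ) j.1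
  have h2 := abs_add_le (i.2 : ℝ) j.2
  have h3 := mul_nonneg (add_nonneg (abs_nonneg (i.1 : ℝ)) (abs_nonneg (i.2 : ℝ)))
    (add_nonneg (abs_nonneg (j.1 : ℝ)) (abs_nonneg (j.2 : ℝ)))
  nlinarith

theorem sz_neg (i : ℤ × ℤ) : sz (-i) = sz i := by simp [sz]

theorem wt_neg (i : ℤ × ℤ) : wt (-i) = wt i := by simp [wt]

theorem sz_flip (i : ℤ × ℤ) : sz (flip i) = sz i := by simp [sz]

theorem wt_flip (i : ℤ × ℤ) : wt (flip i) = wt i := by simp [wt]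

/-- Polynomial weights are dominated by the exponential weight. -/
theorem exists_sz_pow_le (n : ℕ) : ∃ C : ℝ, 0 < C ∧ ∀ i, sz i ^ n ≤ C * wt i := by
  have h := (tendsto_pow_const_div_const_pow_of_one_lt n (by norm_num : (1 : ℝ) < 2)).comp
    (tendsto_add_atTop_nat 1)
  obtain ⟨C, hC⟩ := h.bddAbove_range
  refine ⟨2 * max C 1, by positivity, fun i => ?_⟩
  have h1 := hC ⟨i.1.natAbs + i.2.natAbs, rfl⟩
  simp only [Function.comp_apply] at h1
  rw [div_le_iff₀ (by positivity), pow_succ] at h1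
  rw [sz_eq, add_comm, wt]
  refine h1.trans ?_
  have : C ≤ max C 1 := le_max_left _ _
  calc C * (2 ^ (i.1.natAbs + i.2.natAbs) * 2) ≤ max C 1 * (2 ^ (i.1.natAbs + i.2.natAbs) * 2) := by
        gcongr
    _ = _ := by ring

section Symbols

variable {μ Ω : ℝ} {k₁ k₂ m : ℤ}

theorem symbolM_neg (μ Ω : ℝ) (l : Fin 3) (k : Fin 3 → ℤ) :
    symbolM μ Ω l (-k) = symbolM μ Ω l k := by
  have h : den μ Ω (-k) = den μ Ω k := by
    simp [den, normSq_neg, Even.neg_pow (show Even 4 by decide)]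
  fin_cases l <;> simp [symbolM, normSq_neg, h] <;> split_ifs <;> ring

/-- The denominator at a point of the lattice. -/
theorem den_lat (μ Ω : ℝ) (k₁ k₂ m : ℤ) (i : ℤ × ℤ) :
    den μ Ω (lat k₁ k₂ m i) = 4 * Ω ^ 2 * (i.2 * m : ℝ) ^ 2 *
      ((i.1 : ℝ) ^ 2 * ((k₁ : ℝ) ^ 2 + (k₂ : ℝ) ^ 2) + (i.2 : ℝ) ^ 2 * (m : ℝ) ^ 2) +
      μ ^ 2 * (i.1 * k₂ : ℝ) ^ 4 := by
  rw [den, normSq_lat]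
  simp [lat]

theorem den_lat_pos (hΩ : 0 < Ω) (hm : m ≠ 0) {i : ℤ × ℤ} (hi : i.2 ≠ 0) :
    0 < den μ Ω (lat k₁ k₂ m i) := by
  rw [den_lat]
  have h1 : (m : ℝ) ≠ 0 := by exact_mod_cast hm
  have h2 : (i.2 : ℝ) ≠ 0 := by exact_mod_cast hi
  positivity

/-- The kernel of the quadratic term of the equation on the lattice. -/
def ker (μ Ω : ℝ) (k₁ k₂ m : ℤ) (i j : ℤ × ℤ) : ℝ :=
  ∑ l, symbolM μ Ω l (lat k₁ k₂ m i) * lat k₁ k₂ m j l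

theorem ker_of_eq_zero {i : ℤ × ℤ} (hi : i.2 = 0) (j : ℤ × ℤ) : ker μ Ω k₁ k₂ m i j = 0 := by
  simp [ker, symbolM, lat, hi]

/-- The terms in 2Ω form a vector along (k₂, -k₁, 0), orthogonal to the plane of the lattice, so
they disappear. What is left is proportional to the determinant of i and j. -/
theorem ker_eq (hm : m ≠ 0) {i : ℤ × ℤ} (hi : i.2 ≠ 0) (j : ℤ × ℤ) :
    ker μ Ω k₁ k₂ m i j = μ * (k₂ : ℝ) ^ 2 * ((k₁ : ℝ) ^ 2 + (k₂ : ℝ) ^ 2) * m *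
      ((i.1 : ℝ) ^ 3 * (i.1 * j.2 - i.2 * j.1)) / den μ Ω (lat k₁ k₂ m i) := by
  have h : lat k₁ k₂ m i 2 ≠ 0 := by simp [lat, hi, hm]
  simp only [ker, symbolM, h, if_false, Fin.sum_univ_three, Matrix.cons_val]
  simp only [lat, Matrix.cons_val, div_mul_eq_mul_div, ← add_div, Int.cast_mul]
  congr 1
  ring

/-- Incompressibility of the velocity. -/
theorem ker_self (hm : m ≠ 0) (i : ℤ × ℤ) : ker μ Ω k₁ k₂ m i i = 0 := by
  by_cases hi : i.2 = 0
  · exact ker_of_eq_zero hi _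
  · rw [ker_eq hm hi]
    simp [mul_comm]

/-- Purely vertical profiles create no motion in the plane of the lattice. This makes the base state
steady and removes its velocity from the linearisation. -/
theorem ker_of_fst_eq_zero (hm : m ≠ 0) {i : ℤ × ℤ} (hi : i.1 = 0) (j : ℤ × ℤ) :
    ker μ Ω k₁ k₂ m i j = 0 := by
  by_cases hi2 : i.2 = 0
  · exact ker_of_eq_zero hi2 _
  · rw [ker_eq hm hi2]
    simp [hi]

theorem ker_add (i j j' : ℤ × ℤ) :
    ker μ Ω k₁ k₂ m i (j + j') = ker μ Ω k₁ k₂ m i j + ker μ Ω k₁ k₂ m i j' := by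
  simp [ker, lat_add, mul_add, Finset.sum_add_distrib]

theorem ker_neg (i j : ℤ × ℤ) : ker μ Ω k₁ k₂ m (-i) (-j) = -ker μ Ω k₁ k₂ m i j := by
  simp [ker, lat_neg, symbolM_neg, Finset.sum_neg_distrib]

theorem ker_flip (hm : m ≠ 0) (i j : ℤ × ℤ) :
    ker μ Ω k₁ k₂ m (flip i) (flip j) = -ker μ Ω k₁ k₂ m i j := by
  by_cases hi : i.2 = 0
  · rw [ker_of_eq_zero hi, ker_of_eq_zero (by simp [hi]), neg_zero]
  · have hd : den μ Ω (lat k₁ k₂ m (flip i)) = den μ Ω (lat k₁ k₂ m i) := by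
      rw [den_lat, den_lat]
      simp
    rw [ker_eq hm hi, ker_eq hm (by simpa using hi), hd, ← neg_div]
    congr 1
    simp
    ring

/-- The summand μ²k₂⁴ of the denominator controls x⁴, the other one controls x²y², and |x³y| lies
below the sum of the two. The constant depends on the lattice, which is unavoidable: the symbol is
unbounded as the lattice varies along k₁ = k₂². -/
theorem exists_abs_cube_le (hμ : 0 < μ) (hΩ : 0 < Ω) (hk : k₂ ≠ 0) (hm : m ≠ 0) :
    ∃ C : ℝ, 0 < C ∧ ∀ i : ℤ × ℤ, |(i.1 : ℝ) ^ 4| ≤ C * den μ Ω (lat k₁ k₂ m i) ∧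
      |(i.1 : ℝ) ^ 3 * i.2| ≤ C * den μ Ω (lat k₁ k₂ m i) := by
  have hk' : (k₂ : ℝ) ≠ 0 := by exact_mod_cast hk
  have hm' : (m : ℝ) ≠ 0 := by exact_mod_cast hm
  set c₁ := μ ^ 2 * (k₂ : ℝ) ^ 4 with hc₁
  set c₂ := 4 * Ω ^ 2 * (m : ℝ) ^ 2 * ((k₁ : ℝ) ^ 2 + (k₂ : ℝ) ^ 2) with hc₂
  have h1 : 0 < c₁ := by positivity
  have h2 : 0 < c₂ := by positivity
  refine ⟨c₁⁻¹ + c₂⁻¹, by positivity, fun i => ?_⟩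
  set D := den μ Ω (lat k₁ k₂ m i) with hD
  have hA : (i.1 : ℝ) ^ 4 ≤ c₁⁻¹ * D := by
    rw [inv_mul_eq_div, le_div_iff₀ h1, hD, den_lat, hc₁]
    have : 0 ≤ 4 * Ω ^ 2 * (i.2 * m : ℝ) ^ 2 *
      ((i.1 : ℝ) ^ 2 * ((k₁ : ℝ) ^ 2 + (k₂ : ℝ) ^ 2) + (i.2 : ℝ) ^ 2 * (m : ℝ) ^ 2) := by positivity
    linarith [mul_pow (i.1 : ℝ) k₂ 4]
  have hB : (i.1 : ℝ) ^ 2 * (i.2 : ℝ) ^ 2 ≤ c₂⁻¹ * D := by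
    rw [inv_mul_eq_div, le_div_iff₀ h2, hD, den_lat, hc₂]
    have : 0 ≤ 4 * Ω ^ 2 * (i.2 * m : ℝ) ^ 2 * ((i.2 : ℝ) ^ 2 * (m : ℝ) ^ 2) +
      μ ^ 2 * (i.1 * k₂ : ℝ) ^ 4 := by positivity
    linarith
  have hA0 : 0 ≤ (i.1 : ℝ) ^ 4 := by positivity
  have hB0 : 0 ≤ (i.1 : ℝ) ^ 2 * (i.2 : ℝ) ^ 2 := by positivity
  rw [add_mul, abs_of_nonneg hA0]
  refine ⟨by linarith, ?_⟩
  have h3 : |(i.1 : ℝ) ^ 3 * i.2| ≤ (i.1 : ℝ) ^ 4 + (i.1 : ℝ) ^ 2 * (i.2 : ℝ) ^ 2 := by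
    rw [abs_le]
    constructor <;>
      nlinarith [mul_nonneg (sq_nonneg (i.1 : ℝ)) (sq_nonneg ((i.1 : ℝ) + i.2)),
        mul_nonneg (sq_nonneg (i.1 : ℝ)) (sq_nonneg ((i.1 : ℝ) - i.2))]
  linarith

/-- On a fixed lattice the components of the velocity that matter are of order zero, so the only
derivative lost is the gradient falling on the transported factor j. -/
theorem exists_abs_ker_le (hμ : 0 < μ) (hΩ : 0 < Ω) (hk : k₂ ≠ 0) (hm : m ≠ 0) :
    ∃ C : ℝ, 0 < C ∧ ∀ i j, |ker μ Ω k₁ k₂ m i j| ≤ C * sz j := by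
  obtain ⟨C, hC, h⟩ := exists_abs_cube_le (k₁ := k₁) hμ hΩ hk hm
  refine ⟨|μ * (k₂ : ℝ) ^ 2 * ((k₁ : ℝ) ^ 2 + (k₂ : ℝ) ^ 2) * m| * C + 1, by positivity, fun i j => ?_⟩
  have hj := one_le_sz j
  by_cases hi : i.2 = 0
  · rw [ker_of_eq_zero hi, abs_zero]
    positivity
  · have hD := den_lat_pos (μ := μ) (k₁ := k₁) (k₂ := k₂) hΩ hm hi
    rw [ker_eq hm hi, abs_div, abs_mul, abs_of_pos hD, div_le_iff₀ hD]
    obtain ⟨h1, h2⟩ := h i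
    have h3 : |(i.1 : ℝ) ^ 3 * (i.1 * j.2 - i.2 * j.1)| ≤
        C * den μ Ω (lat k₁ k₂ m i) * sz j := by
      calc |(i.1 : ℝ) ^ 3 * (i.1 * j.2 - i.2 * j.1)|
          = |(i.1 : ℝ) ^ 4 * j.2 - (i.1 : ℝ) ^ 3 * i.2 * j.1| := by congr 1; ring
        _ ≤ |(i.1 : ℝ) ^ 4| * |(j.2 : ℝ)| + |(i.1 : ℝ) ^ 3 * i.2| * |(j.1 : ℝ)| := by
            rw [← abs_mul, ← abs_mul]; exact abs_sub _ _
        _ ≤ C * den μ Ω (lat k₁ k₂ m i) * |(j.2 : ℝ)| +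
            C * den μ Ω (lat k₁ k₂ m i) * |(j.1 : ℝ)| := by gcongr
        _ = C * den μ Ω (lat k₁ k₂ m i) * (|(j.1 : ℝ)| + |(j.2 : ℝ)|) := by ring
        _ ≤ _ := by
            gcongr
            unfold sz
            linarith
    calc _ ≤ |μ * (k₂ : ℝ) ^ 2 * ((k₁ : ℝ) ^ 2 + (k₂ : ℝ) ^ 2) * m| *
          (C * den μ Ω (lat k₁ k₂ m i) * sz j) := by gcongr
      _ ≤ |μ * (k₂ : ℝ) ^ 2 * ((k₁ : ℝ) ^ 2 + (k₂ : ℝ) ^ 2) * m| *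
          (C * den μ Ω (lat k₁ k₂ m i) * sz j) + den μ Ω (lat k₁ k₂ m i) * sz j := by
          have : 0 ≤ den μ Ω (lat k₁ k₂ m i) * sz j := by positivity
          linarith
      _ = _ := by ring

/-- The terms in 2Ω, which cancel in the kernel, can cost one power of x here. This cruder bound
only has to make the series of the velocity converge. -/
theorem exists_abs_symbolM_le (hμ : 0 < μ) (hΩ : 0 < Ω) (hk : k₂ ≠ 0) (hm : m ≠ 0) :
    ∃ C : ℝ, 0 < C ∧ ∀ l i, |symbolM μ Ω l (lat k₁ k₂ m i)| ≤ C * sz i := by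
  obtain ⟨C, hC, h⟩ := exists_abs_cube_le (k₁ := k₁) hμ hΩ hk hm
  have hm' : (m : ℝ) ≠ 0 := by exact_mod_cast hm
  have hm1 : 1 ≤ |(m : ℝ)| := by exact_mod_cast Int.one_le_abs hm
  set A := |(k₁ : ℝ)| + |(k₂ : ℝ)| with hA
  have hA0 : 0 ≤ A := by positivity
  set B := μ * (k₂ : ℝ) ^ 2 * ((|(k₁ : ℝ)| + |(k₂ : ℝ)|) * |(m : ℝ)| + ((k₁ : ℝ) ^ 2 + (k₂ : ℝ) ^ 2)) with hB
  have hB0 : 0 ≤ B := by positivity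
  refine ⟨A / (2 * Ω) + B * C + 1, by positivity, fun l i => ?_⟩
  have hs := one_le_sz i
  by_cases hi : i.2 = 0
  · have : symbolM μ Ω l (lat k₁ k₂ m i) = 0 := by simp [symbolM, lat, hi]
    rw [this, abs_zero]
    positivity
  set D := den μ Ω (lat k₁ k₂ m i) with hDdef
  have hD : 0 < D := den_lat_pos hΩ hm hi
  obtain ⟨h1, h2⟩ := h i
  rw [← hDdef] at h1 h2
  set N := normSq (lat k₁ k₂ m i) with hN
  have hN0 : 0 ≤ N := normSq_nonneg _
  have hy1 : 1 ≤ |(i.2 : ℝ)| := by exact_mod_cast Int.one_le_abs hi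
  have hx : |(i.1 : ℝ)| ≤ sz i := by
    unfold sz; linarith [abs_nonneg (i.2 : ℝ)]
  have hDN : 4 * Ω ^ 2 * (i.2 * m : ℝ) ^ 2 * N ≤ D := by
    rw [hDdef, den_lat, hN, normSq_lat]
    have : 0 ≤ μ ^ 2 * (i.1 * k₂ : ℝ) ^ 4 := by positivity
    linarith
  have hfirst : ∀ k : ℤ, |2 * Ω * (i.1 * k) * (i.2 * m) * N| ≤ |(k : ℝ)| / (2 * Ω) * sz i * D := by
    intro k
    have h5 : |(i.2 : ℝ) * m| ≤ (i.2 * m : ℝ) ^ 2 := by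
      rw [← sq_abs ((i.2 : ℝ) * m), abs_mul]
      have : 1 ≤ |(i.2 : ℝ)| * |(m : ℝ)| := one_le_mul_of_one_le_of_one_le hy1 hm1
      nlinarith
    calc |2 * Ω * (i.1 * k) * (i.2 * m) * N|
        = |(k : ℝ)| / (2 * Ω) * |(i.1 : ℝ)| * (4 * Ω ^ 2 * |(i.2 : ℝ) * m| * N) := by
          rw [abs_mul, abs_mul, abs_mul (2 * Ω), abs_mul (i.1 : ℝ), abs_of_nonneg hN0,
            abs_of_pos (by positivity : 0 < 2 * Ω)]
          field_simp
          ring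
      _ ≤ |(k : ℝ)| / (2 * Ω) * sz i * (4 * Ω ^ 2 * (i.2 * m : ℝ) ^ 2 * N) := by gcongr
      _ ≤ _ := by gcongr
  have hsecond : ∀ c : ℝ, |c * ((i.1 : ℝ) ^ 3 * i.2)| ≤ |c| * C * sz i * D := by
    intro c
    rw [abs_mul]
    calc |c| * |(i.1 : ℝ) ^ 3 * i.2| ≤ |c| * (C * D) := by gcongr
      _ ≤ |c| * (C * D) * sz i := le_mul_of_one_le_right (by positivity) hs
      _ = _ := by ring
  have hnum : ∀ (k : ℤ) (c : ℝ), |(k : ℝ)| ≤ A → |c| ≤ B → ∀ t : ℝ,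
      |t| ≤ |(k : ℝ)| / (2 * Ω) * sz i * D + |c| * C * sz i * D →
      |t / D| ≤ (A / (2 * Ω) + B * C + 1) * sz i := by
    intro k c hk hc t ht
    rw [abs_div, abs_of_pos hD, div_le_iff₀ hD]
    refine ht.trans ?_
    calc _ ≤ A / (2 * Ω) * sz i * D + B * C * sz i * D := by gcongr
      _ ≤ A / (2 * Ω) * sz i * D + B * C * sz i * D + sz i * D := by
          have : 0 ≤ sz i * D := by positivity
          linarith
      _ = _ := by ring
  have hz : lat k₁ k₂ m i 2 ≠ 0 := by simp [lat, hi, hm]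
  have hcB : ∀ k : ℤ, |(k : ℝ)| ≤ A → |μ * k * (k₂ : ℝ) ^ 2 * m| ≤ B := by
    intro k hk
    rw [abs_mul, abs_mul, abs_mul, abs_of_pos hμ, abs_of_nonneg (sq_nonneg (k₂ : ℝ)), hB]
    calc μ * |(k : ℝ)| * (k₂ : ℝ) ^ 2 * |(m : ℝ)| ≤ μ * A * (k₂ : ℝ) ^ 2 * |(m : ℝ)| := by gcongr
      _ ≤ μ * A * (k₂ : ℝ) ^ 2 * |(m : ℝ)| + μ * (k₂ : ℝ) ^ 2 * ((k₁ : ℝ) ^ 2 + (k₂ : ℝ) ^ 2) :=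
          le_add_of_nonneg_right (by positivity)
      _ = _ := by rw [hA]; ring
  have hk1A : |(k₁ : ℝ)| ≤ A := le_add_of_nonneg_right (abs_nonneg _)
  have hk2A : |(k₂ : ℝ)| ≤ A := le_add_of_nonneg_left (abs_nonneg _)
  simp only [symbolM, hz, if_false, ← hDdef, ← hN]
  fin_cases l <;> simp only [lat, Fin.zero_eta, Fin.mk_one, Fin.reduceFinMk, Matrix.cons_val, Int.cast_mul]
  · refine hnum k₂ _ hk2A (hcB k₁ hk1A) _ ?_
    refine le_trans (le_of_eq ?_) ((abs_sub _ _).trans (add_le_add (hfirst k₂) (hsecond _)))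
    congr 1; ring
  · refine hnum k₁ _ hk1A (hcB k₂ hk2A) _ ?_
    refine le_trans (le_of_eq ?_) ((abs_add_le _ _).trans (add_le_add (hfirst k₁) (hsecond _)))
    rw [← abs_neg]
    congr 1; ring
  · refine hnum 0 (μ * (k₂ : ℝ) ^ 2 * ((k₁ : ℝ) ^ 2 + (k₂ : ℝ) ^ 2)) (by simpa using hA0) ?_ _ ?_
    · rw [abs_of_nonneg (by positivity), hB]
      have : 0 ≤ μ * (k₂ : ℝ) ^ 2 * ((|(k₁ : ℝ)| + |(k₂ : ℝ)|) * |(m : ℝ)|) := by positivity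
      linarith
    · set c := μ * (k₂ : ℝ) ^ 2 * ((k₁ : ℝ) ^ 2 + (k₂ : ℝ) ^ 2)
      calc _ = |c| * |(i.1 : ℝ) ^ 4| := by rw [← abs_mul]; congr 1; ring
        _ ≤ |c| * (C * D) := by gcongr
        _ ≤ |c| * (C * D) * sz i := le_mul_of_one_le_right (by positivity) hs
        _ = _ := by simp; ring

/-- The dissipation rate κ|k| controls one full derivative on the lattice, as needed to absorb the
loss in the quadratic term. -/
theorem sz_le_sqrt_normSq_lat (hk : k₂ ≠ 0) (hm : m ≠ 0) (i : ℤ × ℤ) :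
    sz i - 1 ≤ 2 * √(normSq (lat k₁ k₂ m i)) := by
  have h1 : (1 : ℝ) ≤ (k₂ : ℝ) ^ 2 := by exact_mod_cast (by positivity : 0 < k₂ ^ 2)
  have h2 : (1 : ℝ) ≤ (m : ℝ) ^ 2 := by exact_mod_cast (by positivity : 0 < m ^ 2)
  have h3 : |(i.1 : ℝ)| ≤ √(normSq (lat k₁ k₂ m i)) := by
    rw [normSq_lat]
    refine Real.abs_le_sqrt ?_
    nlinarith [sq_nonneg (i.1 : ℝ), sq_nonneg (i.2 : ℝ), sq_nonneg (k₁ : ℝ),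
      mul_nonneg (sq_nonneg (i.1 : ℝ)) (sq_nonneg (k₁ : ℝ)), mul_nonneg (sq_nonneg (i.2 : ℝ)) (sq_nonneg (m : ℝ))]
  have h4 : |(i.2 : ℝ)| ≤ √(normSq (lat k₁ k₂ m i)) := by
    rw [normSq_lat]
    refine Real.abs_le_sqrt ?_
    have : 0 ≤ (i.1 : ℝ) ^ 2 * ((k₁ : ℝ) ^ 2 + (k₂ : ℝ) ^ 2) := by positivity
    nlinarith [sq_nonneg (i.2 : ℝ)]
  unfold sz
  linarith

theorem exists_normSq_lat_le (k₁ k₂ m : ℤ) :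
    ∃ C : ℝ, 1 ≤ C ∧ ∀ i, 1 + normSq (lat k₁ k₂ m i) ≤ C * sz i ^ 2 := by
  refine ⟨1 + ((k₁ : ℝ) ^ 2 + (k₂ : ℝ) ^ 2) + (m : ℝ) ^ 2, by
    have := sq_nonneg (k₁ : ℝ); have := sq_nonneg (k₂ : ℝ); have := sq_nonneg (m : ℝ); linarith,
    fun i => ?_⟩
  rw [normSq_lat]
  have hs := one_le_sz i
  have h1 : (i.1 : ℝ) ^ 2 ≤ sz i ^ 2 := by
    rw [← sq_abs]
    gcongr
    unfold sz; linarith [abs_nonneg (i.2 : ℝ)]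
  have h2 : (i.2 : ℝ) ^ 2 ≤ sz i ^ 2 := by
    rw [← sq_abs]
    gcongr
    unfold sz; linarith [abs_nonneg (i.1 : ℝ)]
  have h3 : 1 ≤ sz i ^ 2 := one_le_pow₀ hs
  calc _ ≤ sz i ^ 2 + (sz i ^ 2 * ((k₁ : ℝ) ^ 2 + (k₂ : ℝ) ^ 2) + sz i ^ 2 * (m : ℝ) ^ 2) := by
        gcongr
    _ = _ := by ring

/-- Sobolev weights are dominated by the exponential weight. -/
theorem exists_sobolev_weight_le (k₁ k₂ m : ℤ) (s : ℝ) :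
    ∃ C : ℝ, 0 < C ∧ ∀ i, (1 + normSq (lat k₁ k₂ m i)) ^ (s / 2) ≤ C * wt i := by
  obtain ⟨A, hA, h⟩ := exists_normSq_lat_le k₁ k₂ m
  obtain ⟨n, hn⟩ := exists_nat_ge (s / 2)
  obtain ⟨B, hB, h'⟩ := exists_sz_pow_le (2 * n)
  refine ⟨A ^ n * B, by positivity, fun i => ?_⟩
  have h0 := normSq_nonneg (lat k₁ k₂ m i)
  calc (1 + normSq (lat k₁ k₂ m i)) ^ (s / 2) ≤ (1 + normSq (lat k₁ k₂ m i)) ^ (n : ℝ) :=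
        Real.rpow_le_rpow_of_exponent_le (by linarith) hn
    _ = (1 + normSq (lat k₁ k₂ m i)) ^ n := Real.rpow_natCast _ _
    _ ≤ (A * sz i ^ 2) ^ n := by gcongr; exact h i
    _ = A ^ n * sz i ^ (2 * n) := by rw [mul_pow, pow_mul]
    _ ≤ A ^ n * (B * wt i) := by gcongr; exact h' i
    _ = _ := by ring

end Symbols

/-! ### Functions with frequencies on a plane lattice -/

theorem trig_mul_trig {ι : Type*} (e : ι → Fin 3 → ℤ) {c d : ι → ℂ}
    (hc : Summable fun i => ‖c i‖) (hd : Summable fun i => ‖d i‖) (y : Torus) :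
    trig e c y * trig e d y =
      trig (fun x : ι × ι => e x.1 + e x.2) (fun x => c x.1 * d x.2) y := by
  have hs : Summable fun x : ι × ι => ‖c x.1 * d x.2‖ := hc.mul_norm hd
  have h0 := hasSum_trig_apply (fun x : ι × ι => e x.1 + e x.2) hs y
  have h1 : ∀ {c : ι → ℂ}, (Summable fun i => ‖c i‖) →
      Summable fun i => ‖c i * mFourier (e i) y‖ := fun hc => by
    simpa [norm_mFourier_apply] using hc
  rw [← (hasSum_trig_apply e hc y).tsum_eq, ← (hasSum_trig_apply e hd y).tsum_eq,
    tsum_mul_tsum_of_summable_norm (h1 hc) (h1 hd), ← h0.tsum_eq]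
  refine tsum_congr fun x => ?_
  rw [mFourier_add]
  ring

theorem hasSum_integral_trig_mul_trig_mul {ι : Type*} [Countable ι] (e : ι → Fin 3 → ℤ)
    {c d : ι → ℂ} (hc : Summable fun i => ‖c i‖) (hd : Summable fun i => ‖d i‖) {φ : Torus → ℂ}
    (hφ : Integrable φ vol) :
    HasSum (fun x : ι × ι => c x.1 * d x.2 * ∫ y, mFourier (e x.1 + e x.2) y * φ y ∂vol)
      (∫ y, trig e c y * trig e d y * φ y ∂vol) := by
  have hs : Summable fun x : ι × ι => ‖c x.1 * d x.2‖ := hc.mul_norm hd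
  have h := hasSum_integral_trig_mul (fun x : ι × ι => e x.1 + e x.2) hs hφ
  simpa only [trig_mul_trig e hc hd] using h

/-- The function with Fourier coefficients `i gⱼ` at the frequencies of the lattice. -/
def synthFun (k₁ k₂ m : ℤ) (g : ℤ × ℤ → ℝ) : C(Torus, ℂ) :=
  trig (lat k₁ k₂ m) fun i => Complex.I * g i

/-- The square integrable function with Fourier coefficients `i gⱼ`. -/
def synth (k₁ k₂ m : ℤ) (g : ℤ × ℤ → ℝ) : L2 := realL2 (synthFun k₁ k₂ m g)

section Synth

variable {k₁ k₂ m : ℤ} {g h : ℤ × ℤ → ℝ}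

theorem summable_coeff (hg : Summable g) :
    Summable fun i => ‖(Complex.I * g i : ℂ)‖ := by
  simpa using hg.abs

theorem isRealFun_synthFun (hg : Summable g) (ho : ∀ i, g (-i) = -g i) :
    IsRealFun (synthFun k₁ k₂ m g) :=
  isRealFun_trig (lat_neg k₁ k₂ m) (summable_coeff hg) fun i => by simp [ho]

theorem fcoeff_synth (hk : k₂ ≠ 0) (hm : m ≠ 0) (hg : Summable g) (ho : ∀ i, g (-i) = -g i)
    (i : ℤ × ℤ) : fcoeff (synth k₁ k₂ m g) (lat k₁ k₂ m i) = Complex.I * g i := by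
  rw [synth, fcoeff_congr (coeFn_realL2 _)]
  exact fcoeff_re_trig (lat_injective hk hm) (summable_coeff hg) (isRealFun_synthFun hg ho) i

/-- The reflection fixes the indices with y = 0, so coefficients odd under it vanish there. -/
theorem hasZeroVerticalMean_synth (hm : m ≠ 0) (hg : Summable g) (ho : ∀ i, g (-i) = -g i)
    (hf : ∀ i, g (flip i) = -g i) : HasZeroVerticalMean (synth k₁ k₂ m g) := by
  intro k hk
  rw [synth, fcoeff_congr (coeFn_realL2 _)]
  refine (hasSum_fcoeff_re_trig (summable_coeff hg) (isRealFun_synthFun hg ho) k).unique ?_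
  refine hasSum_zero.congr_fun fun i => ?_
  split_ifs with hi
  · have h2 : i.2 = 0 := by
      have := congr_fun hi 2
      simpa [lat, hk, hm] using this
    have h3 : flip i = i := by ext <;> simp [h2]
    have h4 := hf i
    rw [h3] at h4
    have : g i = 0 := by linarith
    simp [this]
  · rfl

theorem synth_sub (hg : Summable g) (hh : Summable h) :
    synth k₁ k₂ m g - synth k₁ k₂ m h = synth k₁ k₂ m (g - h) := by
  rw [synth, synth, synth, ← map_sub]
  congr 1
  ext y
  refine HasSum.unique ?_ (hasSum_trig_apply _ (summable_coeff (hg.sub hh)) y)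
  refine ((hasSum_trig_apply _ (summable_coeff hg) y).sub
    (hasSum_trig_apply _ (summable_coeff hh) y)).congr_fun fun i => ?_
  simp
  ring

theorem isMultiplier_synth {σ : (Fin 3 → ℤ) → ℝ} (hσ : ∀ k, σ (-k) = σ k) (hg : Summable g)
    (ho : ∀ i, g (-i) = -g i) (hs : Summable fun i => σ (lat k₁ k₂ m i) * g i) :
    IsMultiplier σ (synth k₁ k₂ m g) (synth k₁ k₂ m fun i => σ (lat k₁ k₂ m i) * g i) := by
  have h := isMultiplier_trig (σ := σ) (summable_coeff hg) (isRealFun_synthFun hg ho)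
    (summable_coeff hs) (isRealFun_synthFun (k₁ := k₁) (k₂ := k₂) (m := m) hs fun i => by
      rw [lat_neg, hσ, ho, mul_neg]) fun i => by
        push_cast
        ring
  exact h.congr (by filter_upwards [coeFn_realL2 (synthFun k₁ k₂ m g)] with y hy using hy.symm)
    (by filter_upwards [coeFn_realL2 (synthFun k₁ k₂ m
      fun i => σ (lat k₁ k₂ m i) * g i)] with y hy using hy.symm)

theorem sobolevNorm_synth_le (s : ℝ) (p : ℝ≥0∞) (hg : Summable g) (ho : ∀ i, g (-i) = -g i)
    (hs : Summable fun i => (1 + normSq (lat k₁ k₂ m i)) ^ (s / 2) * |g i|) :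
    sobolevNorm s p (synth k₁ k₂ m g) ≤
      ENNReal.ofReal (∑' i, (1 + normSq (lat k₁ k₂ m i)) ^ (s / 2) * |g i|) := by
  have hn : ∀ i, ‖(Complex.I * g i : ℂ)‖ = |g i| := fun i => by simp
  have hs' : Summable fun i => (1 + normSq (lat k₁ k₂ m i)) ^ (s / 2) * g i := by
    refine Summable.of_norm (hs.congr fun i => ?_)
    have := normSq_nonneg (lat k₁ k₂ m i)
    rw [norm_mul, Real.norm_eq_abs (g i), Real.norm_of_nonneg (by positivity)]
  have h := sobolevNorm_trig_le s p (summable_coeff hg) (isRealFun_synthFun (k₁ := k₁) (k₂ := k₂)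
    (m := m) hg ho) (by simpa only [hn] using hs) (by
      have := isRealFun_synthFun (k₁ := k₁) (k₂ := k₂) (m := m) hs' fun i => by
        rw [lat_neg, normSq_neg, ho, mul_neg]
      convert this using 2
      rw [synthFun]
      congr 1
      ext i
      push_cast
      ring)
  simpa only [hn, synth, synthFun] using h

theorem coeff_le_sobolevNorm_synth {s : ℝ} {p : ℝ≥0∞} (hp : 1 ≤ p) (hk : k₂ ≠ 0) (hm : m ≠ 0)
    (hg : Summable g) (ho : ∀ i, g (-i) = -g i) (i : ℤ × ℤ) :
    ENNReal.ofReal ((1 + normSq (lat k₁ k₂ m i)) ^ (s / 2) * |g i|) ≤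
      sobolevNorm s p (synth k₁ k₂ m g) := by
  have h := fcoeff_le_sobolevNorm (s := s) hp (synth k₁ k₂ m g) (lat k₁ k₂ m i)
  rw [fcoeff_synth hk hm hg ho] at h
  simpa using h

theorem hasSum_integral_synth_mul {φ : Torus → ℝ} (hφ : Integrable φ vol) (hg : Summable g)
    (ho : ∀ i, g (-i) = -g i) :
    HasSum (fun i => Complex.I * g i * ∫ y, mFourier (lat k₁ k₂ m i) y * (φ y : ℂ) ∂vol)
      ((∫ y, synth k₁ k₂ m g y * φ y ∂vol : ℝ) : ℂ) := by
  have h := hasSum_integral_trig_mul (lat k₁ k₂ m) (summable_coeff hg) hφ.ofReal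
  convert! h using 1
  rw [← integral_complex_ofReal]
  refine integral_congr_ae ?_
  filter_upwards [(isRealFun_synthFun (k₁ := k₁) (k₂ := k₂) (m := m) hg ho).coeFn] with y hy
  rw [← show ((synth k₁ k₂ m g y : ℝ) : ℂ) = trig (lat k₁ k₂ m) _ y from hy]
  push_cast
  rfl

theorem norm_integral_mFourier_mul_le {φ : Torus → ℝ} (k : Fin 3 → ℤ) :
    ‖∫ y, mFourier k y * (φ y : ℂ) ∂vol‖ ≤ ∫ y, |φ y| ∂vol := by
  refine (norm_integral_le_integral_norm _).trans_eq ?_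
  simp [norm_mFourier_apply]

theorem L2_mul_continuous_integrable (f : L2) {φ : Torus → ℝ} (hφ : Continuous φ) :
    Integrable (fun y => f y * φ y) vol := by
  obtain ⟨C, hC⟩ := (isCompact_range hφ).isBounded.exists_norm_le
  exact (L2_integrable f).mul_bdd hφ.aestronglyMeasurable (ae_of_all _ fun y => hC _ ⟨y, rfl⟩)

/-- The quadratic term of the weak formulation in terms of the coefficients. -/
theorem hasSum_integral_transport {μ Ω : ℝ} {φ : Torus → ℝ} (hm : m ≠ 0) (hφ : IsSmooth φ)
    (hg : Summable g) (ho : ∀ i, g (-i) = -g i)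
    (hs : ∀ l, Summable fun i => symbolM μ Ω l (lat k₁ k₂ m i) * g i) :
    HasSum (fun x : (ℤ × ℤ) × (ℤ × ℤ) => Complex.I *
        ((ker μ Ω k₁ k₂ m x.1 x.2 * (g x.1 * g x.2) : ℝ) : ℂ) *
        ∫ y, mFourier (lat k₁ k₂ m (x.1 + x.2)) y * (φ y : ℂ) ∂vol)
      ((∫ y, synth k₁ k₂ m g y * ∑ l, synth k₁ k₂ m
        (fun i => symbolM μ Ω l (lat k₁ k₂ m i) * g i) y * pderiv l φ y ∂vol : ℝ) : ℂ) := by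
  set u : Fin 3 → ℤ × ℤ → ℝ := fun l i => symbolM μ Ω l (lat k₁ k₂ m i) * g i with hu
  have huo : ∀ l i, u l (-i) = -u l i := fun l i => by
    simp only [hu, lat_neg, symbolM_neg, ho, mul_neg]
  have hl : ∀ l, HasSum (fun x : (ℤ × ℤ) × (ℤ × ℤ) => Complex.I * u l x.1 * (Complex.I * g x.2) *
      (-Complex.I * (lat k₁ k₂ m (x.1 + x.2)) l *
        ∫ y, mFourier (lat k₁ k₂ m (x.1 + x.2)) y * (φ y : ℂ) ∂vol))
      (∫ y, synthFun k₁ k₂ m (u l) y * synthFun k₁ k₂ m g y * (pderiv l φ y : ℂ) ∂vol) := by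
    intro l
    have hint : Integrable (pderiv l φ) vol :=
      (hφ.continuous_pderiv l).integrable_of_hasCompactSupport (HasCompactSupport.of_compactSpace _)
    have h := hasSum_integral_trig_mul_trig_mul (lat k₁ k₂ m) (summable_coeff (hs l))
      (summable_coeff hg) hint.ofReal
    refine h.congr_fun fun x => ?_
    rw [← lat_add, ← integral_mFourier_mul_pderiv hφ l]
    rfl
  have h := hasSum_sum (s := Finset.univ) fun l _ => hl l
  have hcf : ∀ l, Continuous fun y => synthFun k₁ k₂ m (u l) y * synthFun k₁ k₂ m g y *
      (pderiv l φ y : ℂ) := fun l =>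
    ((ContinuousMap.continuous _).mul (ContinuousMap.continuous _)).mul
      (Complex.continuous_ofReal.comp (hφ.continuous_pderiv l))
  rw [← integral_finsetSum _ fun l _ =>
    (hcf l).integrable_of_hasCompactSupport (HasCompactSupport.of_compactSpace _)] at h
  convert! h using 1
  · ext x
    -- Integration by parts puts the total frequency i + j next to the symbol; by incompressibility
    -- the part along i contributes nothing.
    have hker : ker μ Ω k₁ k₂ m x.1 x.2 = ∑ l, symbolM μ Ω l (lat k₁ k₂ m x.1) *
        lat k₁ k₂ m (x.1 + x.2) l := by
      have : ker μ Ω k₁ k₂ m x.1 (x.1 + x.2) = ker μ Ω k₁ k₂ m x.1 x.2 := by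
        rw [ker_add, ker_self hm, zero_add]
      rw [← this, ker]
    rw [hker]
    simp only [hu, Fin.sum_univ_three]
    push_cast
    linear_combination (-(Complex.I * (symbolM μ Ω 0 (lat k₁ k₂ m x.1) * lat k₁ k₂ m (x.1 + x.2) 0 +
      symbolM μ Ω 1 (lat k₁ k₂ m x.1) * lat k₁ k₂ m (x.1 + x.2) 1 +
      symbolM μ Ω 2 (lat k₁ k₂ m x.1) * lat k₁ k₂ m (x.1 + x.2) 2) * (g x.1 * g x.2) *
      ∫ y, mFourier (lat k₁ k₂ m (x.1 + x.2)) y * (φ y : ℂ) ∂vol)) * (-Complex.I_sq)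
  · rw [← integral_complex_ofReal]
    refine integral_congr_ae ?_
    have hU : ∀ᵐ y ∂vol, ∀ l, ((synth k₁ k₂ m (u l) y : ℝ) : ℂ) = synthFun k₁ k₂ m (u l) y :=
      ae_all_iff.2 fun l => (isRealFun_synthFun (hs l) (huo l)).coeFn
    filter_upwards [(isRealFun_synthFun (k₁ := k₁) (k₂ := k₂) (m := m) hg ho).coeFn, hU] with y hy hUy
    push_cast
    rw [Finset.mul_sum]
    refine Finset.sum_congr rfl fun l _ => ?_
    rw [← hUy, ← hy, synth]
    ring

/-- Summation and integration in time commute. -/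
theorem hasSum_intervalIntegral {F : ℤ × ℤ → ℝ → ℝ} {b : ℤ × ℤ → ℝ} {A : ℤ × ℤ → ℂ} {a : ℝ}
    {X : ℝ → ℝ} (hF : ∀ i, Continuous (F i)) (hb : Summable b) (hFb : ∀ i τ, |F i τ| ≤ b i)
    (hA : ∀ i, ‖A i‖ ≤ a) (hX : ∀ τ, HasSum (fun i => Complex.I * F i τ * A i) (X τ : ℂ)) (t : ℝ) :
    HasSum (fun i => Complex.I * ((∫ τ in (0 : ℝ)..t, F i τ : ℝ) : ℂ) * A i)
      ((∫ τ in (0 : ℝ)..t, X τ : ℝ) : ℂ) := by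
  have h := intervalIntegral.hasSum_integral_of_dominated_convergence (μ := volume) (a := 0) (b := t)
    (F := fun i τ => Complex.I * (F i τ : ℂ) * A i) (f := fun τ => (X τ : ℂ))
    (bound := fun i _ => b i * a)
    (fun i => ((continuous_const.mul (Complex.continuous_ofReal.comp (hF i))).mul
      continuous_const).aestronglyMeasurable)
    (fun i => ae_of_all _ fun τ _ => by
      simp only [norm_mul, Complex.norm_I, one_mul, Complex.norm_real, Real.norm_eq_abs]
      exact mul_le_mul (hFb i τ) (hA i) (norm_nonneg _) ((abs_nonneg _).trans (hFb i τ)))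
    (ae_of_all _ fun τ _ => hb.mul_right a)
    intervalIntegrable_const
    (ae_of_all _ fun τ _ => hX τ)
  rw [intervalIntegral.integral_ofReal] at h
  refine h.congr_fun fun i => ?_
  rw [intervalIntegral.integral_mul_const, intervalIntegral.integral_const_mul,
    intervalIntegral.integral_ofReal]

end Synth

/-! ### From the equations of the coefficients to the equation -/

/-- A time-independent majorant with exponential weight is summable against every polynomial. It
bounds all Sobolev norms, makes the velocity and the convolutions converge absolutely, and justifies
testing the equation mode by mode. -/
theorem isSolution_synth {κ μ Ω : ℝ} {k₁ k₂ m : ℤ} (hμ : 0 < μ) (hΩ : 0 < Ω) (hk : k₂ ≠ 0)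
    (hm : m ≠ 0) {T s : ℝ} {p : ℝ≥0∞} {g : ℝ → ℤ × ℤ → ℝ} {G f : ℤ × ℤ → ℝ}
    (hG : Summable fun i => wt i * G i) (hgG : ∀ t i, |g t i| ≤ G i)
    (hgc : ∀ i, Continuous fun t => g t i) (ho : ∀ t i, g t (-i) = -g t i)
    (hf : Summable f) (hfo : ∀ i, f (-i) = -f i)
    (hmode : ∀ t ∈ Icc 0 T, ∀ i, g t i - g 0 i = ∫ τ in (0 : ℝ)..t,
      (-(κ * √(normSq (lat k₁ k₂ m i)) * g τ i) +
        ∑' j, ker μ Ω k₁ k₂ m j (i - j) * (g τ j * g τ (i - j)) + f i)) :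
    IsSolution κ μ Ω (1 / 2) (synth k₁ k₂ m f) s p T (synth k₁ k₂ m (g 0))
      (fun t => synth k₁ k₂ m (g t)) := by
  have hG0 : ∀ i, 0 ≤ G i := fun i => (abs_nonneg _).trans (hgG 0 i)
  have hGs : Summable G := hG.of_nonneg_of_le hG0 fun i =>
    le_mul_of_one_le_left (hG0 i) (one_le_wt i)
  obtain ⟨B, hB, hBw⟩ := exists_sz_pow_le 1
  have hHs : Summable fun i => sz i * G i :=
    (hG.mul_left B).of_nonneg_of_le (fun i => mul_nonneg (by linarith [one_le_sz i]) (hG0 i))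
      fun i => by
        rw [← mul_assoc]
        exact mul_le_mul_of_nonneg_right (by simpa using hBw i) (hG0 i)
  have hgs : ∀ t, Summable (g t) := fun t =>
    Summable.of_norm_bounded hGs fun i => hgG t i
  obtain ⟨C, hC, hCM⟩ := exists_abs_symbolM_le (k₁ := k₁) hμ hΩ hk hm
  have hus : ∀ t l, Summable fun i => symbolM μ Ω l (lat k₁ k₂ m i) * g t i := fun t l =>
    Summable.of_norm_bounded (hHs.mul_left C) fun i => by
      rw [norm_mul, ← mul_assoc]
      exact mul_le_mul (hCM l i) (hgG t i) (norm_nonneg _)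
        (mul_nonneg hC.le (by linarith [one_le_sz i]))
  refine ⟨?_, ?_, fun t l => synth k₁ k₂ m fun i => symbolM μ Ω l (lat k₁ k₂ m i) * g t i,
    fun t _ l => isMultiplier_synth (symbolM_neg μ Ω l) (hgs t) (ho t) (hus t l), ?_⟩
  · refine (realL2.continuous.comp (continuous_trig _ hGs
      (fun i => continuous_const.mul (Complex.continuous_ofReal.comp (hgc i)))
      fun i t => ?_)).aestronglyMeasurable
    simpa using hgG t i
  · obtain ⟨D, hD, hDw⟩ := exists_sobolev_weight_le k₁ k₂ m s
    refine ⟨(∑' i, D * (wt i * G i)).toNNReal, fun t _ => ?_⟩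
    have hle : ∀ i, (1 + normSq (lat k₁ k₂ m i)) ^ (s / 2) * |g t i| ≤ D * (wt i * G i) := fun i => by
      rw [← mul_assoc]
      exact mul_le_mul (hDw i) (hgG t i) (abs_nonneg _)
        (mul_nonneg hD.le (by linarith [one_le_wt i]))
    have hsum : Summable fun i => (1 + normSq (lat k₁ k₂ m i)) ^ (s / 2) * |g t i| :=
      (hG.mul_left D).of_nonneg_of_le (fun i => by
        have := normSq_nonneg (lat k₁ k₂ m i); positivity) hle
    refine (sobolevNorm_synth_le s p (hgs t) (ho t) hsum).trans ?_
    exact ENNReal.ofReal_le_ofReal (hsum.tsum_le_tsum hle (hG.mul_left D))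
  · intro φ ψ hφ hψ t ht
    set A : ℤ × ℤ → ℂ := fun i => ∫ y, mFourier (lat k₁ k₂ m i) y * (φ y : ℂ) ∂vol with hA
    set Q : ℤ × ℤ → ℝ → ℝ := fun i τ =>
      ∑' j, ker μ Ω k₁ k₂ m j (i - j) * (g τ j * g τ (i - j)) with hQ
    have hφi : Integrable φ vol :=
      hφ.continuous.integrable_of_hasCompactSupport (HasCompactSupport.of_compactSpace _)
    have hAb : ∀ i, ‖A i‖ ≤ ∫ y, |φ y| ∂vol := fun i => norm_integral_mFourier_mul_le _
    -- The multiplier identity is read at the opposite frequency, where the symbol has the same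
    -- value.
    have hψA : ∀ i, ∫ y, mFourier (lat k₁ k₂ m i) y * (ψ y : ℂ) ∂vol =
        √(normSq (lat k₁ k₂ m i)) * A i := fun i => by
      have := hψ (-lat k₁ k₂ m i)
      simp only [fcoeff_eq, neg_neg, normSq_neg, ← Real.sqrt_eq_rpow] at this
      exact this
    obtain ⟨K, hK, hKk⟩ := exists_abs_ker_le (k₁ := k₁) hμ hΩ hk hm
    have hconv : Summable fun x : (ℤ × ℤ) × (ℤ × ℤ) =>
        K * (G x.2 * (sz (x.1 - x.2) * G (x.1 - x.2))) :=
      (summable_conv hGs hHs hG0 fun i =>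
        mul_nonneg (by linarith [one_le_sz i]) (hG0 i)).mul_left K
    have hterm : ∀ i j τ, |ker μ Ω k₁ k₂ m j (i - j) * (g τ j * g τ (i - j))| ≤
        K * (G j * (sz (i - j) * G (i - j))) := fun i j τ => by
      rw [abs_mul, abs_mul]
      calc _ ≤ K * sz (i - j) * (G j * G (i - j)) := by
            gcongr
            · exact mul_nonneg hK.le (by linarith [one_le_sz (i - j)])
            · exact hKk _ _
            · exact hG0 _
            · exact hgG _ _
            · exact hgG _ _
        _ = _ := by ring
    have hQb : ∀ i τ, |Q i τ| ≤ ∑' j, K * (G j * (sz (i - j) * G (i - j))) := fun i τ => by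
      rw [← Real.norm_eq_abs]
      exact tsum_of_norm_bounded (hconv.prod_factor i).hasSum fun j => hterm i j τ
    have hQc : ∀ i, Continuous (Q i) := fun i =>
      continuous_tsum (fun j => continuous_const.mul ((hgc j).mul (hgc (i - j))))
        (hconv.prod_factor i) fun j τ => hterm i j τ
    have h1 : HasSum (fun i => Complex.I * ((g t i - g 0 i : ℝ) : ℂ) * A i)
        ((∫ y, (synth k₁ k₂ m (g t) y - synth k₁ k₂ m (g 0) y) * φ y ∂vol : ℝ) : ℂ) := by
      have := (hasSum_integral_synth_mul (k₁ := k₁) (k₂ := k₂) (m := m) hφi (hgs t) (ho t)).sub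
        (hasSum_integral_synth_mul (k₁ := k₁) (k₂ := k₂) (m := m) hφi (hgs 0) (ho 0))
      rw [← Complex.ofReal_sub, ← integral_sub (L2_mul_continuous_integrable _ hφ.continuous)
        (L2_mul_continuous_integrable _ hφ.continuous)] at this
      simp only [← sub_mul] at this
      refine this.congr_fun fun i => ?_
      push_cast
      ring
    have h2 := hasSum_intervalIntegral hgc hGs (fun i τ => hgG τ i)
      (fun i => norm_integral_mFourier_mul_le (φ := ψ) (lat k₁ k₂ m i))
      (fun τ => hasSum_integral_synth_mul (L2_integrable ψ) (hgs τ) (ho τ)) t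
    -- The double sum over interacting pairs is regrouped by total frequency before it is integrated
    -- in time.
    have h3 := hasSum_intervalIntegral hQc hconv.prod hQb hAb (fun τ => by
      have h := (convEquiv (ℤ × ℤ)).hasSum_iff.2
        (hasSum_integral_transport (μ := μ) (Ω := Ω) hm hφ (hgs τ) (ho τ) (hus τ))
      refine h.prod_fiberwise fun i => ?_
      have h4 : Summable fun j => ker μ Ω k₁ k₂ m j (i - j) * (g τ j * g τ (i - j)) :=
        Summable.of_norm_bounded (hconv.prod_factor i) fun j => hterm i j τ
      have h5 := ((Complex.hasSum_ofReal.2 h4.hasSum).mul_left Complex.I).mul_right (A i)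
      refine h5.congr_fun fun j => ?_
      simp [hA]) t
    have h4 := hasSum_intervalIntegral (fun i => continuous_const (y := f i)) hf.abs
      (fun i _ => le_rfl) hAb (fun _ => hasSum_integral_synth_mul hφi hf hfo) t
    have h5 := ((h1.add (h2.mul_left (κ : ℂ))).sub h3).sub h4
    -- The equation of the coefficients makes every term of the combined series vanish.
    have h6 : ∀ i, Complex.I * ((g t i - g 0 i : ℝ) : ℂ) * A i +
        (κ : ℂ) * (Complex.I * ((∫ τ in (0 : ℝ)..t, g τ i : ℝ) : ℂ) *
          ∫ y, mFourier (lat k₁ k₂ m i) y * (ψ y : ℂ) ∂vol) -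
        Complex.I * ((∫ τ in (0 : ℝ)..t, Q i τ : ℝ) : ℂ) * A i -
        Complex.I * ((∫ _τ in (0 : ℝ)..t, f i : ℝ) : ℂ) * A i = 0 := fun i => by
      have e1 : g t i - g 0 i = ∫ τ in (0 : ℝ)..t,
          (-(κ * √(normSq (lat k₁ k₂ m i)) * g τ i) + Q i τ + f i) := hmode t ht i
      have hL : Continuous fun τ => -(κ * √(normSq (lat k₁ k₂ m i)) * g τ i) :=
        (continuous_const.mul (hgc i)).neg
      have hLQ : Continuous fun τ => -(κ * √(normSq (lat k₁ k₂ m i)) * g τ i) + Q i τ :=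
        hL.add (hQc i)
      rw [intervalIntegral.integral_add (hLQ.intervalIntegrable _ _)
        intervalIntegrable_const,
        intervalIntegral.integral_add (hL.intervalIntegrable _ _) ((hQc i).intervalIntegrable _ _),
        intervalIntegral.integral_neg, intervalIntegral.integral_const_mul] at e1
      rw [hψA, e1]
      push_cast
      ring
    have h7 := h5.unique (hasSum_zero.congr_fun fun i => (h6 i))
    have h8 : ((∫ y, (synth k₁ k₂ m (g t) y - synth k₁ k₂ m (g 0) y) * φ y ∂vol) +
        κ * (∫ τ in (0 : ℝ)..t, ∫ y, synth k₁ k₂ m (g τ) y * ψ y ∂vol) -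
        (∫ τ in (0 : ℝ)..t, ∫ y, synth k₁ k₂ m (g τ) y * ∑ l, synth k₁ k₂ m
          (fun i => symbolM μ Ω l (lat k₁ k₂ m i) * g τ i) y * pderiv l φ y ∂vol) -
        ∫ _τ in (0 : ℝ)..t, ∫ y, synth k₁ k₂ m f y * φ y ∂vol) = 0 := by
      exact_mod_cast h7
    exact sub_eq_zero.1 h8

/-! ### The Duhamel operators -/

theorem continuous_duhamel (ρ : ℝ) {f : ℝ → ℝ} (hf : Continuous f) :
    Continuous fun t : ℝ => Real.exp (-(ρ * t)) * ∫ τ in (0 : ℝ)..t, Real.exp (ρ * τ) * f τ := by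
  have h : Continuous fun τ => Real.exp (ρ * τ) * f τ := by fun_prop
  exact (by fun_prop : Continuous fun t : ℝ => Real.exp (-(ρ * t))).mul
    (intervalIntegral.continuous_primitive (fun _ _ => h.intervalIntegrable _ _) 0)

/-- Smoothing by the dissipation: a bounded forcing gains the factor 1/ρ uniformly in time. With ρ
of the size of |k| this is one derivative. -/
theorem abs_duhamel_le {ρ : ℝ} (hρ : 0 < ρ) {f : ℝ → ℝ} {M : ℝ}
    (hM : ∀ t, |f t| ≤ M) {t : ℝ} (ht : 0 ≤ t) :
    |Real.exp (-(ρ * t)) * ∫ τ in (0 : ℝ)..t, Real.exp (ρ * τ) * f τ| ≤ ρ⁻¹ * M := by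
  have hM0 : 0 ≤ M := (abs_nonneg _).trans (hM 0)
  have h1 : ‖∫ τ in (0 : ℝ)..t, Real.exp (ρ * τ) * f τ‖ ≤
      ∫ τ in (0 : ℝ)..t, Real.exp (ρ * τ) * M :=
    intervalIntegral.norm_integral_le_of_norm_le ht (ae_of_all _ fun τ _ => by
      rw [norm_mul, Real.norm_of_nonneg (Real.exp_pos _).le]
      exact mul_le_mul_of_nonneg_left (hM τ) (Real.exp_pos _).le)
      (Continuous.intervalIntegrable (by fun_prop) _ _)
  have h2 : ∫ τ in (0 : ℝ)..t, Real.exp (ρ * τ) * M = ρ⁻¹ * (Real.exp (ρ * t) - 1) * M := by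
    rw [intervalIntegral.integral_mul_const, intervalIntegral.integral_comp_mul_left _ hρ.ne',
      integral_exp]
    simp
  rw [abs_mul, abs_of_pos (Real.exp_pos _)]
  calc _ ≤ Real.exp (-(ρ * t)) * (ρ⁻¹ * (Real.exp (ρ * t) - 1) * M) := by
        rw [← h2]
        exact mul_le_mul_of_nonneg_left h1 (Real.exp_pos _).le
    _ = ρ⁻¹ * M * (Real.exp (-(ρ * t)) * Real.exp (ρ * t) - Real.exp (-(ρ * t))) := by ring
    _ = ρ⁻¹ * M * (1 - Real.exp (-(ρ * t))) := by rw [← Real.exp_add]; simp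
    _ ≤ ρ⁻¹ * M * 1 := by
        have := Real.exp_pos (-(ρ * t))
        gcongr
        linarith
    _ = _ := mul_one _

/-- The operator `f ↦ ∫₀ᵗ exp (-ρ (t - τ)) f(τ) dτ`, extended constantly to negative times. -/
def duhamel (ρ : ℝ) (hρ : 0 < ρ) : (ℝ →ᵇ ℝ) →L[ℝ] (ℝ →ᵇ ℝ) :=
  LinearMap.mkContinuous
    { toFun f := BoundedContinuousFunction.ofNormedAddCommGroup
        (fun t => Real.exp (-(ρ * max t 0)) * ∫ τ in (0 : ℝ)..max t 0, Real.exp (ρ * τ) * f τ)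
        ((continuous_duhamel ρ f.continuous).comp (by fun_prop : Continuous fun t : ℝ => max t 0))
        (ρ⁻¹ * ‖f‖) fun _ => abs_duhamel_le hρ f.norm_coe_le_norm (le_max_right _ _)
      map_add' f g := by
        ext t
        have hc : ∀ f : ℝ →ᵇ ℝ, IntervalIntegrable (fun τ => Real.exp (ρ * τ) * f τ) volume 0 (max t 0) :=
          fun f => Continuous.intervalIntegrable (by fun_prop) _ _
        simp only [BoundedContinuousFunction.coe_ofNormedAddCommGroup,
          BoundedContinuousFunction.coe_add, Pi.add_apply, mul_add]
        rw [intervalIntegral.integral_add (hc f) (hc g), mul_add]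
      map_smul' c f := by
        ext t
        simp only [BoundedContinuousFunction.coe_ofNormedAddCommGroup, RingHom.id_apply,
          BoundedContinuousFunction.coe_smul, smul_eq_mul, mul_left_comm _ c,
          intervalIntegral.integral_const_mul] }
    ρ⁻¹ fun f => BoundedContinuousFunction.norm_ofNormedAddCommGroup_le _ (by positivity)
      fun _ => abs_duhamel_le hρ f.norm_coe_le_norm (le_max_right _ _)

theorem duhamel_apply {ρ : ℝ} (hρ : 0 < ρ) (f : ℝ →ᵇ ℝ) {t : ℝ} (ht : 0 ≤ t) :
    duhamel ρ hρ f t = Real.exp (-(ρ * t)) * ∫ τ in (0 : ℝ)..t, Real.exp (ρ * τ) * f τ := by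
  show Real.exp (-(ρ * max t 0)) * ∫ τ in (0 : ℝ)..max t 0, Real.exp (ρ * τ) * f τ = _
  rw [max_eq_left ht]

theorem duhamel_nonneg {ρ : ℝ} (hρ : 0 < ρ) {f : ℝ →ᵇ ℝ} (hf : ∀ t, 0 ≤ f t) (t : ℝ) :
    0 ≤ duhamel ρ hρ f t :=
  mul_nonneg (Real.exp_pos _).le (intervalIntegral.integral_nonneg (le_max_right _ _)
    fun τ _ => mul_nonneg (Real.exp_pos _).le (hf τ))

theorem norm_duhamel_le {ρ : ℝ} (hρ : 0 < ρ) : ‖duhamel ρ hρ‖ ≤ ρ⁻¹ :=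
  LinearMap.mkContinuous_norm_le _ (by positivity) _

theorem duhamel_anti {ρ ρ' : ℝ} (hρ : 0 < ρ) (hρ' : 0 < ρ') (h : ρ ≤ ρ') {f : ℝ →ᵇ ℝ}
    (hf : ∀ t, 0 ≤ f t) {t : ℝ} (ht : 0 ≤ t) : duhamel ρ' hρ' f t ≤ duhamel ρ hρ f t := by
  rw [duhamel_apply _ _ ht, duhamel_apply _ _ ht, ← intervalIntegral.integral_const_mul,
    ← intervalIntegral.integral_const_mul]
  refine intervalIntegral.integral_mono_on ht (Continuous.intervalIntegrable (by fun_prop) _ _)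
    (Continuous.intervalIntegrable (by fun_prop) _ _) fun τ hτ => ?_
  rw [← mul_assoc, ← mul_assoc, ← Real.exp_add, ← Real.exp_add]
  refine mul_le_mul_of_nonneg_right (Real.exp_le_exp.2 ?_) (hf τ)
  nlinarith [hτ.2]

/-- The function `exp (-ρ t)`, extended constantly to negative times. -/
def decay (ρ : ℝ) (hρ : 0 < ρ) : ℝ →ᵇ ℝ :=
  BoundedContinuousFunction.ofNormedAddCommGroup (fun t => Real.exp (-(ρ * max t 0)))
    (by fun_prop) 1 fun t => by
      rw [Real.norm_of_nonneg (Real.exp_pos _).le, Real.exp_le_one_iff]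
      have := mul_nonneg hρ.le (le_max_right t 0)
      linarith

theorem decay_apply {ρ : ℝ} (hρ : 0 < ρ) {t : ℝ} (ht : 0 ≤ t) :
    decay ρ hρ t = Real.exp (-(ρ * t)) := by
  show Real.exp (-(ρ * max t 0)) = _
  rw [max_eq_left ht]

theorem decay_nonneg {ρ : ℝ} (hρ : 0 < ρ) (t : ℝ) : 0 ≤ decay ρ hρ t := (Real.exp_pos _).le

/-- The function `exp (β t)` on `[0, T]`, extended constantly. -/
def growth (β T : ℝ) : ℝ →ᵇ ℝ :=
  BoundedContinuousFunction.ofNormedAddCommGroup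
    (fun t => Real.exp (β * min (max t 0) (max T 0))) (by fun_prop) (Real.exp (|β| * max T 0))
    fun t => by
      rw [Real.norm_of_nonneg (Real.exp_pos _).le, Real.exp_le_exp]
      have h0 : 0 ≤ min (max t 0) (max T 0) := le_min (le_max_right _ _) (le_max_right _ _)
      exact (mul_le_mul_of_nonneg_right (le_abs_self β) h0).trans
        (mul_le_mul_of_nonneg_left (min_le_right _ _) (abs_nonneg β))

theorem growth_apply {β T t : ℝ} (ht : t ∈ Icc 0 T) : growth β T t = Real.exp (β * t) := by
  show Real.exp (β * min (max t 0) (max T 0)) = _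
  rw [max_eq_left ht.1, max_eq_left (ht.1.trans ht.2), min_eq_left ht.2]

/-- The differential equation solved by the Duhamel formula, in integrated form. -/
theorem duhamel_equation (ρ β c : ℝ) {f y : ℝ → ℝ} (hf : Continuous f) {t : ℝ} (ht : 0 ≤ t)
    (hy : ∀ τ, 0 ≤ τ → y τ = Real.exp (-((ρ + β) * τ)) *
      (c + ∫ r in (0 : ℝ)..τ, Real.exp ((ρ + β) * r) * f r)) :
    Real.exp (β * t) * y t - c =
      ∫ τ in (0 : ℝ)..t, (-(ρ * (Real.exp (β * τ) * y τ)) + Real.exp (β * τ) * f τ) := by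
  -- Restoring the factor exp (β t) lowers the decay rate from ρ + β to ρ.
  set z : ℝ → ℝ := fun t => Real.exp (-(ρ * t)) *
    (c + ∫ r in (0 : ℝ)..t, Real.exp ((ρ + β) * r) * f r) with hz
  have hyz : ∀ τ, 0 ≤ τ → Real.exp (β * τ) * y τ = z τ := fun τ hτ => by
    rw [hy τ hτ, hz, ← mul_assoc, ← Real.exp_add]
    congr 2
    ring
  have hfc : Continuous fun r => Real.exp ((ρ + β) * r) * f r := by fun_prop
  have hd : ∀ τ, HasDerivAt z (-(ρ * z τ) + Real.exp (β * τ) * f τ) τ := fun τ => by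
    have h1 : HasDerivAt (fun t => c + ∫ r in (0 : ℝ)..t, Real.exp ((ρ + β) * r) * f r)
        (Real.exp ((ρ + β) * τ) * f τ) τ := (hfc.integral_hasStrictDerivAt 0 τ).hasDerivAt.const_add c
    have h2 : HasDerivAt (fun t => Real.exp (-(ρ * t))) (Real.exp (-(ρ * τ)) * -(ρ * 1)) τ :=
      (((hasDerivAt_id τ).const_mul ρ).neg).exp
    convert! h2.mul h1 using 1
    have h3 : Real.exp (β * τ) = Real.exp (-(ρ * τ)) * Real.exp ((ρ + β) * τ) := by
      rw [← Real.exp_add]; congr 1; ring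
    rw [h3, hz]
    ring
  have hzc : Continuous z := continuous_iff_continuousAt.2 fun τ => (hd τ).continuousAt
  have h := intervalIntegral.integral_eq_sub_of_hasDerivAt (a := 0) (b := t) (fun τ _ => hd τ)
    (Continuous.intervalIntegrable (by fun_prop) _ _)
  have hz0 : z 0 = c := by simp [hz]
  rw [hyz t ht, ← hz0, ← h]
  refine intervalIntegral.integral_congr fun τ hτ => ?_
  rw [uIcc_of_le ht] at hτ
  simp only [hyz τ hτ.1]

/-- A lower bound for supersolutions of `H' = (b - ρ) H`. -/
theorem exp_le_of_integral_le {ρ b : ℝ} (hb : 0 ≤ b) {H : ℝ → ℝ} (hH : Continuous H)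
    (h : ∀ t, 0 ≤ t → Real.exp (-(ρ * t)) * (1 + b * ∫ τ in (0 : ℝ)..t, Real.exp (ρ * τ) * H τ) ≤ H t)
    {t : ℝ} (ht : 0 ≤ t) : Real.exp ((b - ρ) * t) ≤ H t := by
  set I : ℝ → ℝ := fun t => 1 + b * ∫ τ in (0 : ℝ)..t, Real.exp (ρ * τ) * H τ with hI
  have hc : Continuous fun τ => Real.exp (ρ * τ) * H τ := by fun_prop
  have hd : ∀ τ, HasDerivAt (fun t => Real.exp (-(b * t)) * I t)
      (Real.exp (-(b * τ)) * (b * (Real.exp (ρ * τ) * H τ - I τ))) τ := fun τ => by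
    have h1 : HasDerivAt I (b * (Real.exp (ρ * τ) * H τ)) τ :=
      ((hc.integral_hasStrictDerivAt 0 τ).hasDerivAt.const_mul b).const_add 1
    have h2 : HasDerivAt (fun t => Real.exp (-(b * t))) (Real.exp (-(b * τ)) * -(b * 1)) τ :=
      (((hasDerivAt_id τ).const_mul b).neg).exp
    convert! h2.mul h1 using 1
    ring
  -- The hypothesis on H says I ≤ exp (ρ t) H, hence I' ≥ b I, so exp (-b t) I is nondecreasing.
  have hmono : MonotoneOn (fun t => Real.exp (-(b * t)) * I t) (Ici 0) := by
    refine monotoneOn_of_deriv_nonneg (convex_Ici 0)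
      (fun τ _ => (hd τ).continuousAt.continuousWithinAt)
      (fun τ _ => (hd τ).differentiableAt.differentiableWithinAt) fun τ hτ => ?_
    rw [interior_Ici] at hτ
    rw [(hd τ).deriv]
    have h3 := mul_le_mul_of_nonneg_left (h τ (le_of_lt hτ)) (Real.exp_pos (ρ * τ)).le
    rw [← mul_assoc, ← Real.exp_add, add_neg_cancel, Real.exp_zero, one_mul] at h3
    have h4 : 0 ≤ Real.exp (ρ * τ) * H τ - I τ := sub_nonneg.2 h3
    positivity
  have h5 := hmono self_mem_Ici ht ht
  have h6 : I 0 = 1 := by simp [hI]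
  simp only [mul_zero, neg_zero, Real.exp_zero, h6, mul_one] at h5
  calc Real.exp ((b - ρ) * t) = Real.exp (-(ρ * t)) * (Real.exp (b * t) * 1) := by
        rw [mul_one, ← Real.exp_add]; congr 1; ring
    _ ≤ Real.exp (-(ρ * t)) * (Real.exp (b * t) * (Real.exp (-(b * t)) * I t)) := by gcongr
    _ = Real.exp (-(ρ * t)) * I t := by
        rw [← mul_assoc (Real.exp (b * t)), ← Real.exp_add]
        simp
    _ ≤ H t := h t ht

/-! ### Convolution kernels acting on functions of time -/

section ModeKer

variable {ι : Type*} [AddCommGroup ι]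

/-- The kernel `f ↦ c i j D_{i + j} (h f)`. -/
def modeKer (D : ι → (ℝ →ᵇ ℝ) →L[ℝ] (ℝ →ᵇ ℝ)) (c : ι → ι → ℝ) (h : ℝ →ᵇ ℝ) (i j : ι) :
    (ℝ →ᵇ ℝ) →L[ℝ] (ℝ →ᵇ ℝ) :=
  c i j • (D (i + j)).comp (ContinuousLinearMap.mul ℝ (ℝ →ᵇ ℝ) h)

variable {D : ι → (ℝ →ᵇ ℝ) →L[ℝ] (ℝ →ᵇ ℝ)} {c : ι → ι → ℝ} {h : ℝ →ᵇ ℝ} {A : ι → ℝ} {K : ℝ}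

/-- The growth of the coefficients is measured at the output frequency i + j, where the smoothing of
D is available to pay for it. -/
theorem norm_modeKer_le (hA : ∀ i j, |c i j| ≤ A (i + j)) (hD : ∀ i, A i * ‖D i‖ ≤ K) (i j : ι) :
    ‖modeKer D c h i j‖ ≤ K * ‖h‖ := by
  have h1 : ‖(D (i + j)).comp (ContinuousLinearMap.mul ℝ (ℝ →ᵇ ℝ) h)‖ ≤ ‖D (i + j)‖ * ‖h‖ :=
    (ContinuousLinearMap.opNorm_comp_le _ _).trans
      (mul_le_mul_of_nonneg_left (ContinuousLinearMap.opNorm_mul_apply_le _ _ _) (norm_nonneg _))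
  calc _ ≤ |c i j| * ‖(D (i + j)).comp (ContinuousLinearMap.mul ℝ (ℝ →ᵇ ℝ) h)‖ :=
        ContinuousLinearMap.opNorm_smul_le _ _
    _ ≤ A (i + j) * (‖D (i + j)‖ * ‖h‖) :=
        mul_le_mul (hA i j) h1 (norm_nonneg _) ((abs_nonneg _).trans (hA i j))
    _ = A (i + j) * ‖D (i + j)‖ * ‖h‖ := by ring
    _ ≤ _ := mul_le_mul_of_nonneg_right (hD _) (norm_nonneg _)

theorem summable_modeKer_fiber (hA : ∀ i j, |c i j| ≤ A (i + j)) (y z : Seq ι (ℝ →ᵇ ℝ)) (i : ι) :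
    Summable fun j => c j (i - j) • (h * (y j * z (i - j))) := by
  have hs := (summable_conv y.hasSum_norm.summable z.hasSum_norm.summable (fun _ => norm_nonneg _)
    fun _ => norm_nonneg _).prod_factor i
  refine Summable.of_norm_bounded (hs.mul_left (A i * ‖h‖)) fun j => ?_
  have h1 : |c j (i - j)| ≤ A i := by simpa using hA j (i - j)
  rw [norm_smul, Real.norm_eq_abs, mul_assoc]
  refine mul_le_mul h1 ((norm_mul_le _ _).trans ?_) (norm_nonneg _) ((abs_nonneg _).trans h1)
  exact mul_le_mul_of_nonneg_left (norm_mul_le _ _) (norm_nonneg _)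

/-- The operator depends on i + j only, so it is common to all terms of the fibre over i and comes
out of the sum. -/
theorem conv_modeKer_apply (hA : ∀ i j, |c i j| ≤ A (i + j))
    (hT : ∀ i j, ‖modeKer D c h i j‖ ≤ K) (y z : Seq ι (ℝ →ᵇ ℝ)) (i : ι) :
    conv (modeKer D c h) hT y z i = D i (∑' j, c j (i - j) • (h * (y j * z (i - j)))) := by
  rw [conv_apply, (D i).map_tsum (summable_modeKer_fiber hA y z i)]
  refine tsum_congr fun j => ?_
  simp only [modeKer, add_sub_cancel, map_smul]
  rfl

theorem conv_modeKer_mem_oddSeq (τ : ι ≃+ ι) (hc : ∀ i j, c (τ i) (τ j) = -c i j)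
    (hD : ∀ i, D (τ i) = D i) (hT : ∀ i j, ‖modeKer D c h i j‖ ≤ K) {y z : Seq ι (ℝ →ᵇ ℝ)}
    (hy : y ∈ oddSeq τ) (hz : z ∈ oddSeq τ) : conv (modeKer D c h) hT y z ∈ oddSeq τ := by
  refine conv_mem_oddSeq τ _ hT (fun i j => ?_) hy hz
  rw [modeKer, modeKer, hc, ← map_add, hD, neg_smul]

end ModeKer

/-! ### The perturbed equation -/

/-- The weight `2 ^ (|x| + |y|) (1 + |x| + |y|)`. -/
def vw (i : ℤ × ℤ) : ℝ := wt i * sz i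

theorem vw_pos (i : ℤ × ℤ) : 0 < vw i :=
  mul_pos (by linarith [one_le_wt i]) (by linarith [one_le_sz i])

/-- The coefficients of `a sin (m x₃)`. -/
def baseCoeff (a : ℝ) (i : ℤ × ℤ) : ℝ := if i.1 = 0 ∧ |i.2| = 1 then -(a / 2) * i.2 else 0

/-- The coefficients of `4 cos (k₁ x₁ + k₂ x₂) sin (m x₃)`. -/
def pertCoeff (i : ℤ × ℤ) : ℝ := if |i.1| = 1 ∧ |i.2| = 1 then -i.2 else 0

theorem baseCoeff_neg (a : ℝ) (i : ℤ × ℤ) : baseCoeff a (-i) = -baseCoeff a i := by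
  simp only [baseCoeff, Prod.fst_neg, Prod.snd_neg, neg_eq_zero, abs_neg]
  split_ifs <;> simp

theorem baseCoeff_flip (a : ℝ) (i : ℤ × ℤ) : baseCoeff a (flip i) = -baseCoeff a i := by
  simp only [baseCoeff, flip_apply, abs_neg]
  split_ifs <;> simp

theorem pertCoeff_neg (i : ℤ × ℤ) : pertCoeff (-i) = -pertCoeff i := by
  simp only [pertCoeff, Prod.fst_neg, Prod.snd_neg, abs_neg]
  split_ifs <;> simp

theorem pertCoeff_flip (i : ℤ × ℤ) : pertCoeff (flip i) = -pertCoeff i := by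
  simp only [pertCoeff, flip_apply, abs_neg]
  split_ifs <;> simp

theorem abs_eq_one_mem {x : ℤ} (hx : |x| = 1) : x ∈ ({1, -1} : Finset ℤ) := by
  rcases (abs_eq (by norm_num)).1 hx with h | h <;> simp [h]

theorem baseCoeff_support {a : ℝ} {i : ℤ × ℤ}
    (hi : i ∉ ({0} : Finset ℤ) ×ˢ ({1, -1} : Finset ℤ)) : baseCoeff a i = 0 := by
  rw [baseCoeff, if_neg]
  rintro ⟨h1, h2⟩
  exact hi (Finset.mem_product.2 ⟨by simp [h1], abs_eq_one_mem h2⟩)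

theorem pertCoeff_support {i : ℤ × ℤ}
    (hi : i ∉ ({1, -1} : Finset ℤ) ×ˢ ({1, -1} : Finset ℤ)) : pertCoeff i = 0 := by
  rw [pertCoeff, if_neg]
  rintro ⟨h1, h2⟩
  exact hi (Finset.mem_product.2 ⟨abs_eq_one_mem h1, abs_eq_one_mem h2⟩)

/-- The steady state as a weighted sequence. -/
def baseSeq (a : ℝ) : Seq (ℤ × ℤ) (ℝ →ᵇ ℝ) :=
  ⟨fun i => BoundedContinuousFunction.const ℝ (vw i * baseCoeff a i), memℓp_one
    (summable_of_ne_finset_zero (s := ({0} : Finset ℤ) ×ˢ ({1, -1} : Finset ℤ)) fun i hi => by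
      rw [baseCoeff_support hi, mul_zero]
      exact norm_zero)⟩

/-- The evolution of the initial perturbation without interaction, as a weighted sequence. -/
def pertSeq (ρ : ℤ × ℤ → ℝ) (hρ : ∀ i, 0 < ρ i) : Seq (ℤ × ℤ) (ℝ →ᵇ ℝ) :=
  ⟨fun i => (vw i * pertCoeff i) • decay (ρ i) (hρ i), memℓp_one
    (summable_of_ne_finset_zero (s := ({1, -1} : Finset ℤ) ×ˢ ({1, -1} : Finset ℤ)) fun i hi => by
      rw [pertCoeff_support hi, mul_zero, zero_smul, norm_zero])⟩

theorem vw_neg (i : ℤ × ℤ) : vw (-i) = vw i := by rw [vw, vw, wt_neg, sz_neg]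

theorem vw_flip (i : ℤ × ℤ) : vw (flip i) = vw i := by rw [vw, vw, wt_flip, sz_flip]

/-- The kernel of the quadratic term for weighted sequences. -/
def coef (μ Ω : ℝ) (k₁ k₂ m : ℤ) (i j : ℤ × ℤ) : ℝ :=
  vw (i + j) * ker μ Ω k₁ k₂ m i j / (vw i * vw j)

/-- The kernel of the linearised term for weighted sequences. -/
def linCoef (μ Ω : ℝ) (k₁ k₂ m : ℤ) (i j : ℤ × ℤ) : ℝ :=
  if j.1 = 0 ∧ |j.2| = 1 then coef μ Ω k₁ k₂ m i j else 0

section Coef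

variable {μ Ω : ℝ} {k₁ k₂ m : ℤ}

theorem coef_neg (i j : ℤ × ℤ) : coef μ Ω k₁ k₂ m (-i) (-j) = -coef μ Ω k₁ k₂ m i j := by
  rw [coef, coef, ← neg_add, vw_neg, vw_neg, vw_neg, ker_neg, mul_neg, neg_div]

theorem coef_flip (hm : m ≠ 0) (i j : ℤ × ℤ) :
    coef μ Ω k₁ k₂ m (flip i) (flip j) = -coef μ Ω k₁ k₂ m i j := by
  rw [coef, coef, ← map_add, vw_flip, vw_flip, vw_flip, ker_flip hm, mul_neg, neg_div]

theorem linCoef_neg (i j : ℤ × ℤ) : linCoef μ Ω k₁ k₂ m (-i) (-j) = -linCoef μ Ω k₁ k₂ m i j := by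
  simp only [linCoef, coef_neg, Prod.fst_neg, Prod.snd_neg, neg_eq_zero, abs_neg]
  split_ifs <;> simp

theorem linCoef_flip (hm : m ≠ 0) (i j : ℤ × ℤ) :
    linCoef μ Ω k₁ k₂ m (flip i) (flip j) = -linCoef μ Ω k₁ k₂ m i j := by
  have h1 : (flip j).1 = j.1 := rfl
  have h2 : (flip j).2 = -j.2 := rfl
  simp only [linCoef, coef_flip hm, h1, h2, abs_neg]
  split_ifs <;> simp

/-- The exponential weight is submultiplicative and drops out, while sz j in the denominator cancels
the derivative lost on j. There remains sz (i + j) / sz i. The general quadratic term thus loses one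
derivative at the output frequency. When j is a frequency of the base state, sz (i + j) ≤ 2 sz i,
and the linearised term loses none. -/
theorem exists_coef_le (hμ : 0 < μ) (hΩ : 0 < Ω) (hk : k₂ ≠ 0) (hm : m ≠ 0) :
    ∃ C : ℝ, 0 < C ∧ (∀ i j, |coef μ Ω k₁ k₂ m i j| ≤ C * sz (i + j)) ∧
      ∀ i j, |linCoef μ Ω k₁ k₂ m i j| ≤ C := by
  obtain ⟨C, hC, h⟩ := exists_abs_ker_le (k₁ := k₁) hμ hΩ hk hm
  have hmain : ∀ i j, |coef μ Ω k₁ k₂ m i j| * sz i ≤ C * sz (i + j) := fun i j => by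
    have hwi := one_le_wt i
    have hwj := one_le_wt j
    have hsi := one_le_sz i
    have hsj := one_le_sz j
    have hsij := one_le_sz (i + j)
    rw [coef, abs_div, abs_mul, abs_of_pos (vw_pos _), abs_of_pos (mul_pos (vw_pos i) (vw_pos j)),
      div_mul_eq_mul_div, div_le_iff₀ (mul_pos (vw_pos i) (vw_pos j))]
    simp only [vw]
    calc wt (i + j) * sz (i + j) * |ker μ Ω k₁ k₂ m i j| * sz i
        ≤ wt i * wt j * sz (i + j) * (C * sz j) * sz i := by
          gcongr
          · exact wt_add_le i j
          · exact h i j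
      _ = _ := by ring
  refine ⟨2 * C, by positivity, fun i j => ?_, fun i j => ?_⟩
  · have h1 : |coef μ Ω k₁ k₂ m i j| ≤ |coef μ Ω k₁ k₂ m i j| * sz i :=
      le_mul_of_one_le_right (abs_nonneg _) (one_le_sz i)
    have h2 := hmain i j
    have h3 : 0 ≤ C * sz (i + j) := mul_nonneg hC.le (by linarith [one_le_sz (i + j)])
    linarith
  · rw [linCoef]
    split_ifs with hj
    · have hsi : 0 < sz i := by linarith [one_le_sz i]
      have h1 : sz j = 2 := by
        have : |(j.2 : ℝ)| = 1 := by exact_mod_cast hj.2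
        rw [sz, hj.1, this]
        norm_num
      have h2 : sz (i + j) ≤ sz i * 2 := h1 ▸ sz_add_le i j
      refine le_of_mul_le_mul_right ((hmain i j).trans ?_) hsi
      calc C * sz (i + j) ≤ C * (sz i * 2) := by gcongr
        _ = _ := by ring
    · rw [abs_zero]; positivity

theorem ker_unit {j : ℤ × ℤ} (hj : j.1 = 0) (i : ℤ × ℤ) :
    ker μ Ω k₁ k₂ m i j = j.2 * ker μ Ω k₁ k₂ m i (0, 1) := by
  simp only [ker, lat, hj, Fin.sum_univ_three, Matrix.cons_val]
  push_cast
  ring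

/-- The linearised interaction shifts the vertical frequency, with a negative coefficient. -/
theorem linCoef_mul_baseCoeff (a : ℝ) (i j : ℤ × ℤ) :
    linCoef μ Ω k₁ k₂ m i j * (vw j * baseCoeff a j) =
      if j.1 = 0 ∧ |j.2| = 1 then -(a / 2) * (vw (i + j) / vw i) * ker μ Ω k₁ k₂ m i (0, 1) else 0 := by
  rw [linCoef, baseCoeff]
  split_ifs with hj
  · have hj2 : (j.2 : ℝ) * j.2 = 1 := by
      have : |(j.2 : ℝ)| = 1 := by exact_mod_cast hj.2
      rw [← abs_mul_abs_self, this, one_mul]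
    rw [coef, ker_unit hj.1]
    have h1 := (vw_pos i).ne'
    have h2 := (vw_pos j).ne'
    field_simp
    linear_combination (-(a * vw (i + j) * ker μ Ω k₁ k₂ m i (0, 1))) * hj2
  · simp

theorem ker_unit_nonneg (hμ : 0 < μ) (hΩ : 0 < Ω) (hm : 0 < m) (i : ℤ × ℤ) :
    0 ≤ ker μ Ω k₁ k₂ m i (0, 1) := by
  by_cases hi : i.2 = 0
  · rw [ker_of_eq_zero hi]
  · have hD := den_lat_pos (μ := μ) (k₁ := k₁) (k₂ := k₂) hΩ hm.ne' hi
    have hm' : (0 : ℝ) < m := by exact_mod_cast hm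
    rw [ker_eq hm.ne' hi]
    have : (i.1 : ℝ) ^ 3 * (i.1 * ((0, 1) : ℤ × ℤ).2 - i.2 * ((0, 1) : ℤ × ℤ).1) = (i.1 : ℝ) ^ 4 := by
      push_cast; ring
    rw [this]
    positivity

theorem ker_one_one (hm : m ≠ 0) {q : ℤ} (hq : q ≠ 0) :
    ker μ Ω k₁ k₂ m (1, q) (0, 1) = μ * (k₂ : ℝ) ^ 2 * ((k₁ : ℝ) ^ 2 + (k₂ : ℝ) ^ 2) * m /
      (4 * Ω ^ 2 * (q * m : ℝ) ^ 2 * (((k₁ : ℝ) ^ 2 + (k₂ : ℝ) ^ 2) + (q : ℝ) ^ 2 * (m : ℝ) ^ 2) +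
        μ ^ 2 * (k₂ : ℝ) ^ 4) := by
  rw [ker_eq hm hq, den_lat]
  simp

/-- The numerators agree and the denominator increases with the vertical frequency, so the weaker of
the two couplings is the one out of (1, 2). -/
theorem ker_two_le_ker_one (hμ : 0 < μ) (hΩ : 0 < Ω) (hm : 0 < m) :
    ker μ Ω k₁ k₂ m (1, 2) (0, 1) ≤ ker μ Ω k₁ k₂ m (1, 1) (0, 1) := by
  have hm' : (0 : ℝ) < m := by exact_mod_cast hm
  rw [ker_one_one hm.ne' two_ne_zero, ker_one_one hm.ne' one_ne_zero]
  refine div_le_div_of_nonneg_left (by positivity) (by push_cast; positivity) ?_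
  push_cast
  gcongr <;> norm_num

end Coef

/-! ### Growth of the linearised evolution -/

/-- The sign pattern preserved by the linearised evolution. -/
def sg (i : ℤ × ℤ) : ℝ := (Int.sign i.2 : ℝ) * (-1) ^ i.2.natAbs

/-- A unit vertical step changes the parity of y and keeps its sign, unless it lands on y = 0, where
`sg` is zero. -/
theorem sg_step {i j : ℤ × ℤ} (hj : j.2 ≠ 0) (hij : |(i - j).2| = 1) : sg i = -sg j ∨ sg i = 0 := by
  rw [Prod.snd_sub] at hij
  by_cases hi : i.2 = 0
  · right; simp [sg, hi]
  left
  have h1 : i.2 - j.2 = 1 ∨ i.2 - j.2 = -1 := (abs_eq (by norm_num)).1 hij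
  have hs : Int.sign i.2 = Int.sign j.2 := by
    rcases lt_or_gt_of_ne hj with h | h
    · rw [Int.sign_eq_neg_one_of_neg h, Int.sign_eq_neg_one_of_neg (by omega)]
    · rw [Int.sign_eq_one_of_pos h, Int.sign_eq_one_of_pos (by omega)]
  have hp : i.2.natAbs = j.2.natAbs + 1 ∨ j.2.natAbs = i.2.natAbs + 1 := by omega
  rw [sg, sg, hs]
  rcases hp with h | h <;> rw [h, pow_succ] <;> ring

theorem sg_mul_pertCoeff_nonneg (i : ℤ × ℤ) : 0 ≤ sg i * pertCoeff i := by
  rw [sg, pertCoeff]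
  split_ifs with hi
  · rcases (abs_eq (by norm_num)).1 hi.2 with h | h <;> rw [h] <;> norm_num
  · simp

/-- The sequences with the sign pattern `sg`. -/
def signCone : Set (Seq (ℤ × ℤ) (ℝ →ᵇ ℝ)) := {y | ∀ i t, 0 ≤ sg i * y i t}

theorem isClosed_signCone : IsClosed signCone := by
  have h : signCone = ⋂ (i) (t), {y | 0 ≤ sg i * y i t} := by
    ext y
    simp only [mem_iInter]
    rfl
  rw [h]
  refine isClosed_iInter fun i => isClosed_iInter fun t => isClosed_le continuous_const ?_
  exact continuous_const.mul ((BoundedContinuousFunction.evalCLM ℝ t).continuous.comp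
    (lp.evalCLM ℝ (fun _ : ℤ × ℤ => ℝ →ᵇ ℝ) 1 i).continuous)

section Linear

variable {μ Ω a : ℝ} {k₁ k₂ m : ℤ}

theorem linTerm_apply (y : Seq (ℤ × ℤ) (ℝ →ᵇ ℝ)) (i j : ℤ × ℤ) (t : ℝ) :
    (linCoef μ Ω k₁ k₂ m j (i - j) • (1 * (y j * baseSeq a (i - j)))) t =
      (if (i - j).1 = 0 ∧ |(i - j).2| = 1 then
        -(a / 2) * (vw i / vw j) * ker μ Ω k₁ k₂ m j (0, 1) else 0) * y j t := by
  have h := linCoef_mul_baseCoeff (μ := μ) (Ω := Ω) (k₁ := k₁) (k₂ := k₂) (m := m) a j (i - j)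
  rw [add_sub_cancel] at h
  rw [← h]
  show linCoef μ Ω k₁ k₂ m j (i - j) * (1 * (y j t * (vw (i - j) * baseCoeff a (i - j)))) = _
  ring

/-- The coupling to each vertical neighbour is at most zero and `sg` alternates, so the two signs
cancel. The kernel vanishes on modes with y = 0, hence nothing passes between the half planes y > 0
and y < 0, where the pattern would break. -/
theorem linTerm_nonneg (hμ : 0 < μ) (hΩ : 0 < Ω) (ha : 0 < a) (hm : 0 < m)
    {y : Seq (ℤ × ℤ) (ℝ →ᵇ ℝ)} (hy : y ∈ signCone) (i j : ℤ × ℤ) (t : ℝ) :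
    0 ≤ sg i * (linCoef μ Ω k₁ k₂ m j (i - j) • (1 * (y j * baseSeq a (i - j)))) t := by
  rw [linTerm_apply]
  split_ifs with hij
  · by_cases hj : j.2 = 0
    · rw [ker_of_eq_zero hj]
      simp
    · have hM := ker_unit_nonneg (k₁ := k₁) (k₂ := k₂) hμ hΩ hm j
      have hv : 0 ≤ vw i / vw j := (div_pos (vw_pos i) (vw_pos j)).le
      rcases sg_step hj hij.2 with h | h
      · rw [h]
        have := mul_nonneg (mul_nonneg (mul_nonneg (half_pos ha).le hv) hM) (hy j t)
        linarith
      · rw [h, zero_mul]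
  · simp

/-- The forcing of the linearised evolution. -/
def linForce (μ Ω a : ℝ) (k₁ k₂ m : ℤ) (y : Seq (ℤ × ℤ) (ℝ →ᵇ ℝ)) (i : ℤ × ℤ) : ℝ →ᵇ ℝ :=
  ∑' j, linCoef μ Ω k₁ k₂ m j (i - j) • (1 * (y j * baseSeq a (i - j)))

theorem tsum_apply_time {ι : Type*} {f : ι → ℝ →ᵇ ℝ} (hf : Summable f) (t : ℝ) :
    HasSum (fun i => f i t) ((∑' i, f i) t) :=
  (BoundedContinuousFunction.evalCLM ℝ t).hasSum hf.hasSum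

theorem linTerm_le_linForce {A : ℝ} (hA : ∀ i j, |linCoef μ Ω k₁ k₂ m i j| ≤ A) (hμ : 0 < μ)
    (hΩ : 0 < Ω) (ha : 0 < a) (hm : 0 < m) {y : Seq (ℤ × ℤ) (ℝ →ᵇ ℝ)} (hy : y ∈ signCone)
    (i j : ℤ × ℤ) (t : ℝ) :
    sg i * (linCoef μ Ω k₁ k₂ m j (i - j) • (1 * (y j * baseSeq a (i - j)))) t ≤
      sg i * linForce μ Ω a k₁ k₂ m y i t :=
  le_hasSum ((tsum_apply_time (summable_modeKer_fiber (A := fun _ => A) (h := 1) hA y (baseSeq a) i)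
    t).mul_left (sg i)) j fun j' _ => linTerm_nonneg hμ hΩ ha hm hy i j' t

theorem linForce_nonneg {A : ℝ} (hA : ∀ i j, |linCoef μ Ω k₁ k₂ m i j| ≤ A) (hμ : 0 < μ)
    (hΩ : 0 < Ω) (ha : 0 < a) (hm : 0 < m) {y : Seq (ℤ × ℤ) (ℝ →ᵇ ℝ)} (hy : y ∈ signCone)
    (i : ℤ × ℤ) (t : ℝ) : 0 ≤ sg i * linForce μ Ω a k₁ k₂ m y i t :=
  (linTerm_nonneg hμ hΩ ha hm hy i 0 t).trans (linTerm_le_linForce hA hμ hΩ ha hm hy i 0 t)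

variable {ρ : ℤ × ℤ → ℝ} {hρ : ∀ i, 0 < ρ i} {A K : ℝ}

theorem conv_linCoef_apply (hA : ∀ i j, |linCoef μ Ω k₁ k₂ m i j| ≤ A)
    (hT : ∀ i j, ‖modeKer (fun i => duhamel (ρ i) (hρ i)) (linCoef μ Ω k₁ k₂ m) 1 i j‖ ≤ K)
    (y : Seq (ℤ × ℤ) (ℝ →ᵇ ℝ)) (i : ℤ × ℤ) :
    conv _ hT y (baseSeq a) i = duhamel (ρ i) (hρ i) (linForce μ Ω a k₁ k₂ m y i) :=
  conv_modeKer_apply (A := fun _ => A) hA hT y (baseSeq a) i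

/-- The Duhamel operators preserve nonnegativity and the initial perturbation already has the sign
pattern. -/
theorem signCone_mapsTo (hA : ∀ i j, |linCoef μ Ω k₁ k₂ m i j| ≤ A)
    (hT : ∀ i j, ‖modeKer (fun i => duhamel (ρ i) (hρ i)) (linCoef μ Ω k₁ k₂ m) 1 i j‖ ≤ K)
    (hμ : 0 < μ) (hΩ : 0 < Ω) (ha : 0 < a) (hm : 0 < m) {y : Seq (ℤ × ℤ) (ℝ →ᵇ ℝ)}
    (hy : y ∈ signCone) : pertSeq ρ hρ + conv _ hT y (baseSeq a) ∈ signCone := by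
  intro i t
  have h1 : 0 ≤ duhamel (ρ i) (hρ i) (sg i • linForce μ Ω a k₁ k₂ m y i) t :=
    duhamel_nonneg _ (fun t => linForce_nonneg hA hμ hΩ ha hm hy i t) t
  have h2 := mul_nonneg (mul_nonneg (vw_pos i).le (sg_mul_pertCoeff_nonneg i)) (decay_nonneg (hρ i) t)
  rw [map_smul] at h1
  rw [lp.coeFn_add, Pi.add_apply, conv_linCoef_apply hA]
  show 0 ≤ sg i * ((vw i * pertCoeff i) * decay (ρ i) (hρ i) t + duhamel (ρ i) (hρ i) _ t)
  rw [BoundedContinuousFunction.smul_apply, smul_eq_mul] at h1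
  linarith

/-- A component of the linear evolution is driven by its neighbours. -/
theorem linear_lower_bound (hA : ∀ i j, |linCoef μ Ω k₁ k₂ m i j| ≤ A)
    (hT : ∀ i j, ‖modeKer (fun i => duhamel (ρ i) (hρ i)) (linCoef μ Ω k₁ k₂ m) 1 i j‖ ≤ K)
    (hμ : 0 < μ) (hΩ : 0 < Ω) (ha : 0 < a) (hm : 0 < m) {w : Seq (ℤ × ℤ) (ℝ →ᵇ ℝ)}
    (hw : w ∈ signCone) (hfix : pertSeq ρ hρ + conv _ hT w (baseSeq a) = w) {i j : ℤ × ℤ}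
    (hij : (i - j).1 = 0 ∧ |(i - j).2| = 1) (hs : sg i = -sg j) (t : ℝ) :
    sg i * pertCoeff i * decay (ρ i) (hρ i) t +
      a / 2 * ker μ Ω k₁ k₂ m j (0, 1) * duhamel (ρ i) (hρ i) ((sg j / vw j) • w j) t ≤
      ((sg i / vw i) • w i) t := by
  -- All neighbours contribute with the same sign, so keeping only j lowers the forcing.
  have h1 : 0 ≤ duhamel (ρ i) (hρ i) (sg i • linForce μ Ω a k₁ k₂ m w i -
      sg i • (linCoef μ Ω k₁ k₂ m j (i - j) • (1 * (w j * baseSeq a (i - j))))) t :=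
    duhamel_nonneg _ (fun t => sub_nonneg.2 (linTerm_le_linForce hA hμ hΩ ha hm hw i j t)) t
  have h2 : sg i • (linCoef μ Ω k₁ k₂ m j (i - j) • (1 * (w j * baseSeq a (i - j)))) =
      (a / 2 * ker μ Ω k₁ k₂ m j (0, 1) * vw i) • ((sg j / vw j) • w j) := by
    ext t
    have := linTerm_apply (μ := μ) (Ω := Ω) (a := a) (k₁ := k₁) (k₂ := k₂) (m := m) w i j t
    rw [if_pos hij] at this
    rw [BoundedContinuousFunction.smul_apply, this, hs]
    simp only [BoundedContinuousFunction.smul_apply, smul_eq_mul]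
    ring
  rw [h2, map_sub, map_smul, map_smul] at h1
  have h3 : w i t = (vw i * pertCoeff i) * decay (ρ i) (hρ i) t +
      duhamel (ρ i) (hρ i) (linForce μ Ω a k₁ k₂ m w i) t := by
    conv_lhs => rw [← hfix, lp.coeFn_add, Pi.add_apply, conv_linCoef_apply hA]
    rfl
  have hv := vw_pos i
  simp only [BoundedContinuousFunction.sub_apply, BoundedContinuousFunction.smul_apply,
    smul_eq_mul] at h1
  rw [BoundedContinuousFunction.smul_apply, smul_eq_mul, h3, div_mul_eq_mul_div (sg i) (vw i), le_div_iff₀ hv]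
  linarith

/-- Exponential growth of two components of the linear evolution. -/
theorem linear_growth (hA : ∀ i j, |linCoef μ Ω k₁ k₂ m i j| ≤ A)
    (hT : ∀ i j, ‖modeKer (fun i => duhamel (ρ i) (hρ i)) (linCoef μ Ω k₁ k₂ m) 1 i j‖ ≤ K)
    (hμ : 0 < μ) (hΩ : 0 < Ω) (ha : 0 < a) (hm : 0 < m) {w : Seq (ℤ × ℤ) (ℝ →ᵇ ℝ)}
    (hw : w ∈ signCone) (hfix : pertSeq ρ hρ + conv _ hT w (baseSeq a) = w)
    (hρ12 : ρ (1, 1) ≤ ρ (1, 2)) {t : ℝ} (ht : 0 ≤ t) :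
    Real.exp ((a / 2 * ker μ Ω k₁ k₂ m (1, 2) (0, 1) - ρ (1, 2)) * t) ≤
      |w (1, 1) t| / vw (1, 1) + |w (1, 2) t| / vw (1, 2) := by
  have s1 : sg (1, 1) = -1 := by simp [sg]
  have s2 : sg (1, 2) = 1 := by
    have : Int.sign 2 = 1 := rfl
    simp [sg, this]
  set W₁ : ℝ →ᵇ ℝ := (sg (1, 1) / vw (1, 1)) • w (1, 1) with hW₁
  set W₂ : ℝ →ᵇ ℝ := (sg (1, 2) / vw (1, 2)) • w (1, 2) with hW₂
  have hpos : ∀ (i : ℤ × ℤ) (t : ℝ), 0 ≤ ((sg i / vw i) • w i) t := fun i t => by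
    rw [BoundedContinuousFunction.smul_apply, smul_eq_mul, div_mul_eq_mul_div]
    exact div_nonneg (hw i t) (vw_pos i).le
  have e1 := linear_lower_bound hA hT hμ hΩ ha hm hw hfix (i := (1, 1)) (j := (1, 2))
    (by norm_num) (by rw [s1, s2])
  have e2 := linear_lower_bound hA hT hμ hΩ ha hm hw hfix (i := (1, 2)) (j := (1, 1))
    (by norm_num) (by rw [s1, s2]; norm_num)
  rw [← hW₁, ← hW₂] at e1 e2
  have p1 : sg (1, 1) * pertCoeff (1, 1) = 1 := by simp [s1, pertCoeff]
  have p2 : sg (1, 2) * pertCoeff (1, 2) = 0 := by simp [pertCoeff]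
  have hM0 := ker_unit_nonneg (k₁ := k₁) (k₂ := k₂) hμ hΩ hm (1, 2)
  have hM := ker_two_le_ker_one (k₁ := k₁) (k₂ := k₂) hμ hΩ hm
  set M₂ := ker μ Ω k₁ k₂ m (1, 2) (0, 1)
  -- Both inequalities are weakened to the larger decay rate ρ (1, 2) and the smaller coupling M₂.
  -- Their sum is then a scalar inequality for W₁ + W₂ alone.
  have hH : ∀ t, 0 ≤ t → Real.exp (-(ρ (1, 2) * t)) * (1 + a / 2 * M₂ *
      ∫ τ in (0 : ℝ)..t, Real.exp (ρ (1, 2) * τ) * (W₁ + W₂) τ) ≤ (W₁ + W₂) t := fun t ht => by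
    have f1 := e1 t
    have f2 := e2 t
    rw [p1, one_mul, decay_apply _ ht] at f1
    rw [p2, zero_mul, zero_add] at f2
    have f3 : Real.exp (-(ρ (1, 2) * t)) ≤ Real.exp (-(ρ (1, 1) * t)) :=
      Real.exp_le_exp.2 (neg_le_neg (mul_le_mul_of_nonneg_right hρ12 ht))
    have f4 := duhamel_anti (hρ (1, 1)) (hρ (1, 2)) hρ12 (f := W₂) (hpos (1, 2)) ht
    have f5 : 0 ≤ duhamel (ρ (1, 2)) (hρ _) W₁ t := duhamel_nonneg _ (hpos (1, 1)) t
    have f6 : a / 2 * M₂ * duhamel (ρ (1, 2)) (hρ _) W₂ t ≤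
        a / 2 * M₂ * duhamel (ρ (1, 1)) (hρ _) W₂ t := by gcongr
    have f7 : a / 2 * M₂ * duhamel (ρ (1, 2)) (hρ _) W₁ t ≤
        a / 2 * ker μ Ω k₁ k₂ m (1, 1) (0, 1) * duhamel (ρ (1, 2)) (hρ _) W₁ t := by gcongr
    have f8 := duhamel_apply (hρ (1, 2)) (W₁ + W₂) ht
    rw [mul_add, mul_one, mul_left_comm, ← f8, map_add]
    simp only [BoundedContinuousFunction.add_apply]
    linarith
  have h := exp_le_of_integral_le (by positivity) (W₁ + W₂).continuous hH ht
  refine h.trans (le_of_eq ?_)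
  have habs : ∀ i : ℤ × ℤ, |sg i| = 1 → ((sg i / vw i) • w i) t = |w i t| / vw i := fun i hi => by
    rw [BoundedContinuousFunction.smul_apply, smul_eq_mul, div_mul_eq_mul_div,
      ← abs_of_nonneg (hw i t), abs_mul, hi, one_mul]
  rw [BoundedContinuousFunction.add_apply, hW₁, hW₂, habs _ (by simp [s1]), habs _ (by simp [s2])]

end Linear

/-! ### Growing solutions of the equations of the coefficients -/

theorem sqrt_normSq_mul_baseCoeff {k₁ k₂ m : ℤ} (hm : 0 < m) (a : ℝ) (i : ℤ × ℤ) :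
    √(normSq (lat k₁ k₂ m i)) * baseCoeff a i = m * baseCoeff a i := by
  rw [baseCoeff]
  split_ifs with hi
  · have h2 : (i.2 : ℝ) ^ 2 = 1 := by
      have : |(i.2 : ℝ)| = 1 := by exact_mod_cast hi.2
      rw [← sq_abs, this, one_pow]
    rw [normSq_lat, hi.1, h2]
    have hm' : (0 : ℝ) ≤ m := by exact_mod_cast hm.le
    simp [Real.sqrt_sq hm']
  · simp

theorem baseCoeff_mul (c a : ℝ) (i : ℤ × ℤ) : baseCoeff (c * a) i = c * baseCoeff a i := by
  simp only [baseCoeff]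
  split_ifs <;> ring

theorem baseSeq_mem_oddSeq (a : ℝ) (τ : ℤ × ℤ ≃+ ℤ × ℤ) (hv : ∀ i, vw (τ i) = vw i)
    (hb : ∀ i, baseCoeff a (τ i) = -baseCoeff a i) : baseSeq a ∈ oddSeq τ := by
  intro i
  ext t
  show vw (τ i) * baseCoeff a (τ i) = -(vw i * baseCoeff a i)
  rw [hv, hb, mul_neg]

theorem pertSeq_mem_oddSeq {ρ : ℤ × ℤ → ℝ} {hρ : ∀ i, 0 < ρ i} (τ : ℤ × ℤ ≃+ ℤ × ℤ)
    (hv : ∀ i, vw (τ i) = vw i) (hb : ∀ i, pertCoeff (τ i) = -pertCoeff i)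
    (hτ : ∀ i, ρ (τ i) = ρ i) : pertSeq ρ hρ ∈ oddSeq τ := by
  intro i
  show (vw (τ i) * pertCoeff (τ i)) • decay (ρ (τ i)) (hρ _) =
    -((vw i * pertCoeff i) • decay (ρ i) (hρ i))
  simp only [hv, hb, hτ, mul_neg]
  ext t
  show -(vw i * pertCoeff i) * decay (ρ i) (hρ i) t = -(vw i * pertCoeff i * decay (ρ i) (hρ i) t)
  ring

theorem duhamel_congr {ρ : ℤ × ℤ → ℝ} (hρ : ∀ i, 0 < ρ i) {i j : ℤ × ℤ} (h : ρ i = ρ j) :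
    duhamel (ρ i) (hρ i) = duhamel (ρ j) (hρ j) := by
  simp only [h]

section Nonlinear

variable {μ Ω a : ℝ} {k₁ k₂ m : ℤ}

/-- The full coefficients, rebuilt from the weighted unknown `y`. -/
def fullCoeff (a ε β T : ℝ) (y : Seq (ℤ × ℤ) (ℝ →ᵇ ℝ)) (t : ℝ) (i : ℤ × ℤ) : ℝ :=
  baseCoeff a i + ε * growth β T t * (y i t / vw i)

/-- The forcing of the full evolution. -/
def quadForce (μ Ω : ℝ) (k₁ k₂ m : ℤ) (h : ℝ →ᵇ ℝ) (y : Seq (ℤ × ℤ) (ℝ →ᵇ ℝ)) (i : ℤ × ℤ) :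
    ℝ →ᵇ ℝ :=
  ∑' j, coef μ Ω k₁ k₂ m j (i - j) • (h * (y j * y (i - j)))

/-- Since the velocity of the base state is zero, the two products with the base state in the first
slot vanish. The perturbation's velocity acting on the base gives the linear term, and acting on the
perturbation it gives the term with the extra ε. -/
theorem tsum_ker_fullCoeff {A : ℤ × ℤ → ℝ} {A' : ℝ}
    (hA : ∀ i j, |coef μ Ω k₁ k₂ m i j| ≤ A (i + j))
    (hA' : ∀ i j, |linCoef μ Ω k₁ k₂ m i j| ≤ A') (hm : m ≠ 0) (ε β T : ℝ)
    (y : Seq (ℤ × ℤ) (ℝ →ᵇ ℝ)) (t : ℝ) (i : ℤ × ℤ) :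
    ∑' j, ker μ Ω k₁ k₂ m j (i - j) * (fullCoeff a ε β T y t j * fullCoeff a ε β T y t (i - j)) =
      ε * growth β T t / vw i * (linForce μ Ω a k₁ k₂ m y i t +
        ε * quadForce μ Ω k₁ k₂ m (growth β T) y i t) := by
  have h1 := tsum_apply_time (summable_modeKer_fiber (A := fun _ => A') (h := 1) hA' y
    (baseSeq a) i) t
  have h2 := tsum_apply_time (summable_modeKer_fiber (h := growth β T) hA y y i) t
  refine HasSum.tsum_eq ?_
  refine ((h1.add (h2.mul_left ε)).mul_left (ε * growth β T t / vw i)).congr_fun fun j => ?_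
  set k := i - j with hk
  have e1 : (linCoef μ Ω k₁ k₂ m j k • (1 * (y j * baseSeq a k))) t =
      linCoef μ Ω k₁ k₂ m j k * (vw k * baseCoeff a k) * y j t := by
    show linCoef μ Ω k₁ k₂ m j k * (1 * (y j t * (vw k * baseCoeff a k))) = _
    ring
  have e2 : (coef μ Ω k₁ k₂ m j k • (growth β T * (y j * y k))) t =
      coef μ Ω k₁ k₂ m j k * (growth β T t * (y j t * y k t)) := rfl
  have e3 : linCoef μ Ω k₁ k₂ m j k * (vw k * baseCoeff a k) =
      coef μ Ω k₁ k₂ m j k * (vw k * baseCoeff a k) := by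
    rw [linCoef, baseCoeff]
    split_ifs <;> simp
  have e4 : ker μ Ω k₁ k₂ m j k * baseCoeff a j = 0 := by
    by_cases hj : j.1 = 0
    · rw [ker_of_fst_eq_zero hm hj, zero_mul]
    · simp [baseCoeff, hj]
  rw [e1, e2, e3, coef, show j + k = i by rw [hk]; abel, fullCoeff, fullCoeff]
  have hi := (vw_pos i).ne'
  have hj := (vw_pos j).ne'
  have hk' := (vw_pos k).ne'
  field_simp
  linear_combination (vw j * (baseCoeff a k * vw k + ε * growth β T t * y k t)) * e4

/-- The sequences with both symmetries of the perturbation. -/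
def symSeq : Submodule ℝ (Seq (ℤ × ℤ) (ℝ →ᵇ ℝ)) := oddSeq (AddEquiv.neg (ℤ × ℤ)) ⊓ oddSeq flip

theorem isClosed_symSeq : IsClosed (symSeq : Set (Seq (ℤ × ℤ) (ℝ →ᵇ ℝ))) := by
  rw [symSeq, Submodule.coe_inf]
  exact (isClosed_oddSeq _).inter (isClosed_oddSeq _)

theorem mem_symSeq {y : Seq (ℤ × ℤ) (ℝ →ᵇ ℝ)} :
    y ∈ symSeq ↔ (∀ i, y (-i) = -y i) ∧ ∀ i, y (flip i) = -y i := Iff.rfl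

theorem baseSeq_mem_symSeq (a : ℝ) : baseSeq a ∈ symSeq :=
  ⟨baseSeq_mem_oddSeq a (AddEquiv.neg (ℤ × ℤ)) vw_neg (baseCoeff_neg a),
    baseSeq_mem_oddSeq a flip vw_flip (baseCoeff_flip a)⟩

theorem conv_modeKer_mem_symSeq {ρ : ℤ × ℤ → ℝ} {hρ : ∀ i, 0 < ρ i} (hρn : ∀ i, ρ (-i) = ρ i)
    (hρf : ∀ i, ρ (flip i) = ρ i) {c : ℤ × ℤ → ℤ × ℤ → ℝ} (hcn : ∀ i j, c (-i) (-j) = -c i j)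
    (hcf : ∀ i j, c (flip i) (flip j) = -c i j) {h : ℝ →ᵇ ℝ} {K : ℝ}
    (hT : ∀ i j, ‖modeKer (fun i => duhamel (ρ i) (hρ i)) c h i j‖ ≤ K)
    {y z : Seq (ℤ × ℤ) (ℝ →ᵇ ℝ)} (hy : y ∈ symSeq) (hz : z ∈ symSeq) :
    conv _ hT y z ∈ symSeq :=
  ⟨conv_modeKer_mem_oddSeq (AddEquiv.neg (ℤ × ℤ)) hcn (fun i => duhamel_congr hρ (hρn i)) hT
    hy.1 hz.1, conv_modeKer_mem_oddSeq flip hcf (fun i => duhamel_congr hρ (hρf i)) hT hy.2 hz.2⟩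

/-- Solutions of the weighted Duhamel equations near the solution of the linear ones. -/
theorem exists_seq_solution_of_norm_le {C K₁ K₂ : ℝ} (hμ : 0 < μ) (hΩ : 0 < Ω) (ha : 0 < a)
    (hm : 0 < m) (hCc : ∀ i j, |coef μ Ω k₁ k₂ m i j| ≤ C * sz (i + j))
    (hCl : ∀ i j, |linCoef μ Ω k₁ k₂ m i j| ≤ C) {ρ : ℤ × ℤ → ℝ} (hρ : ∀ i, 0 < ρ i)
    (hρn : ∀ i, ρ (-i) = ρ i) (hρf : ∀ i, ρ (flip i) = ρ i) (hρ12 : ρ (1, 1) ≤ ρ (1, 2))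
    (h : ℝ →ᵇ ℝ)
    (hTl : ∀ i j, ‖modeKer (fun i => duhamel (ρ i) (hρ i)) (linCoef μ Ω k₁ k₂ m) 1 i j‖ ≤ K₁)
    (hTq : ∀ i j, ‖modeKer (fun i => duhamel (ρ i) (hρ i)) (coef μ Ω k₁ k₂ m) h i j‖ ≤ K₂)
    {P : Seq (ℤ × ℤ) (ℝ →ᵇ ℝ) →L[ℝ] Seq (ℤ × ℤ) (ℝ →ᵇ ℝ)} (hP : ‖P‖ ≤ 1 / 2)
    (hPy : ∀ y, P y = conv _ hTl y (baseSeq a))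
    {T : ℝ} (hT : 0 ≤ T) {η : ℝ} (hη : 0 < η) :
    ∃ ε₀ : ℝ, 0 < ε₀ ∧ ∀ ε : ℝ, 0 < ε → ε ≤ ε₀ → ∃ w y : Seq (ℤ × ℤ) (ℝ →ᵇ ℝ),
      y ∈ symSeq ∧
      (∀ i, y i = (vw i * pertCoeff i) • decay _ (hρ i) + duhamel _ (hρ i)
        (linForce μ Ω a k₁ k₂ m y i + ε • quadForce μ Ω k₁ k₂ m h y i)) ∧
      Real.exp ((a / 2 * ker μ Ω k₁ k₂ m (1, 2) (0, 1) - ρ (1, 2)) * T) ≤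
        |w (1, 1) T| / vw (1, 1) + |w (1, 2) T| / vw (1, 2) ∧
      ‖y - w‖ ≤ η := by
  have hPS : ∀ y ∈ symSeq, P y ∈ symSeq := fun y hy => by
    rw [hPy]
    exact conv_modeKer_mem_symSeq hρn hρf linCoef_neg (linCoef_flip hm.ne') hTl hy
      (baseSeq_mem_symSeq a)
  have hBS : ∀ y ∈ symSeq, conv _ hTq y y ∈ symSeq := fun y hy =>
    conv_modeKer_mem_symSeq hρn hρf coef_neg (coef_flip hm.ne') hTq hy hy
  have hvS : pertSeq ρ hρ ∈ symSeq :=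
    ⟨pertSeq_mem_oddSeq (AddEquiv.neg (ℤ × ℤ)) vw_neg pertCoeff_neg hρn,
      pertSeq_mem_oddSeq flip vw_flip pertCoeff_flip hρf⟩
  -- Only the linear solution is placed in the sign cone. The nonlinear one need not keep the
  -- pattern; it will inherit the growth by being close to w.
  obtain ⟨w, ⟨hwS, hwC⟩, hw⟩ := exists_linear_fixedPoint (isClosed_symSeq.inter isClosed_signCone)
    ⟨0, symSeq.zero_mem, fun i t => by simp⟩ _ hP (pertSeq ρ hρ) fun y hy =>
      ⟨symSeq.add_mem hvS (hPS y hy.1), by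
        rw [hPy]
        exact signCone_mapsTo hCl hTl hμ hΩ ha hm hy.2⟩
  have hw' := hw
  rw [hPy] at hw'
  obtain ⟨ε₀, hε₀, hmain⟩ := exists_quadratic_fixedPoint symSeq isClosed_symSeq _ hP hPS _ hBS hwS hw hη
  refine ⟨ε₀, hε₀, fun ε hε hεε₀ => ?_⟩
  obtain ⟨y, hyS, hy, hyw⟩ := hmain ε hε hεε₀
  refine ⟨w, y, hyS, fun i => ?_,
    linear_growth hCl hTl hμ hΩ ha hm hwC hw' hρ12 hT, hyw⟩
  rw [hPy] at hy
  have h1 : pertSeq ρ hρ i + conv _ hTl y (baseSeq a) i + ε • conv _ hTq y y i = y i :=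
    congr_arg (fun z : Seq (ℤ × ℤ) (ℝ →ᵇ ℝ) => z i) hy
  rw [conv_linCoef_apply hCl hTl y i, conv_modeKer_apply (A := fun i => C * sz i) hCc hTq y y i] at h1
  rw [← h1, map_add, map_smul, ← add_assoc]
  rfl

/-- Solutions of the weighted Duhamel equations near the solution of the linear ones. -/
theorem exists_seq_solution {β C A : ℝ} (hμ : 0 < μ) (hΩ : 0 < Ω) (ha : 0 < a)
    (hm : 0 < m) (hC : 0 < C) (hCc : ∀ i j, |coef μ Ω k₁ k₂ m i j| ≤ C * sz (i + j))
    (hCl : ∀ i j, |linCoef μ Ω k₁ k₂ m i j| ≤ C) (hβ : 0 < β) (hβC : 2 * C * ‖baseSeq a‖ ≤ β)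
    {ρ : ℤ × ℤ → ℝ} (hρ : ∀ i, 0 < ρ i) (hρβ : ∀ i, β ≤ ρ i) (hρA : ∀ i, sz i ≤ A * ρ i)
    (hρn : ∀ i, ρ (-i) = ρ i) (hρf : ∀ i, ρ (flip i) = ρ i) (hρ12 : ρ (1, 1) ≤ ρ (1, 2))
    (h : ℝ →ᵇ ℝ) {T : ℝ} (hT : 0 ≤ T) {η : ℝ} (hη : 0 < η) :
    ∃ ε₀ : ℝ, 0 < ε₀ ∧ ∀ ε : ℝ, 0 < ε → ε ≤ ε₀ → ∃ w y : Seq (ℤ × ℤ) (ℝ →ᵇ ℝ),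
      y ∈ symSeq ∧
      (∀ i, y i = (vw i * pertCoeff i) • decay _ (hρ i) + duhamel _ (hρ i)
        (linForce μ Ω a k₁ k₂ m y i + ε • quadForce μ Ω k₁ k₂ m h y i)) ∧
      Real.exp ((a / 2 * ker μ Ω k₁ k₂ m (1, 2) (0, 1) - ρ (1, 2)) * T) ≤
        |w (1, 1) T| / vw (1, 1) + |w (1, 2) T| / vw (1, 2) ∧
      ‖y - w‖ ≤ η := by
  have hDn : ∀ i, ‖duhamel (ρ i) (hρ i)‖ ≤ (ρ i)⁻¹ := fun i => norm_duhamel_le (hρ i)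
  -- The linear kernel is bounded without any smoothing, so 1/ρ is spent on the small factor 1/β.
  have hTl : ∀ i j, ‖modeKer (fun i => duhamel (ρ i) (hρ i)) (linCoef μ Ω k₁ k₂ m) 1 i j‖ ≤
      C * β⁻¹ * ‖(1 : ℝ →ᵇ ℝ)‖ :=
    norm_modeKer_le (A := fun _ => C) hCl fun i => by
      gcongr
      exact (hDn i).trans (inv_anti₀ hβ (hρβ i))
  -- Here 1/ρ is spent on the lost derivative; smallness will come from ε instead.
  have hTq : ∀ i j, ‖modeKer (fun i => duhamel (ρ i) (hρ i)) (coef μ Ω k₁ k₂ m) h i j‖ ≤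
      C * A * ‖h‖ :=
    norm_modeKer_le (A := fun i => C * sz i) hCc fun i => by
      have hsz := one_le_sz i
      have hρ0 := hρ i
      calc C * sz i * ‖duhamel (ρ i) (hρ i)‖ ≤ C * (A * ρ i) * (ρ i)⁻¹ := by
            gcongr
            · exact mul_nonneg hC.le ((zero_le_one.trans hsz).trans (hρA i))
            · exact hρA i
            · exact hDn i
        _ = C * A := by field_simp
  have hP : ‖(conv _ hTl).flip (baseSeq a)‖ ≤ 1 / 2 := by
    refine ContinuousLinearMap.opNorm_le_bound _ (by norm_num) fun y => ?_
    refine (norm_conv_apply_le _ hTl y (baseSeq a)).trans ?_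
    rw [norm_one, mul_one, mul_right_comm]
    gcongr
    rw [mul_right_comm, mul_inv_le_iff₀ hβ]
    linarith
  exact exists_seq_solution_of_norm_le hμ hΩ ha hm hCc hCl hρ hρn hρf hρ12 h hTl hTq hP (fun _ => rfl) hT hη

/-- The rescaled solutions of the Duhamel equations solve the equations of the coefficients. -/
theorem fullCoeff_equation {κ β ε T : ℝ} {C : ℝ} (hm : 0 < m)
    (hCc : ∀ i j, |coef μ Ω k₁ k₂ m i j| ≤ C * sz (i + j))
    (hCl : ∀ i j, |linCoef μ Ω k₁ k₂ m i j| ≤ C)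
    (hρ : ∀ i, 0 < κ * √(normSq (lat k₁ k₂ m i)) + β) {y : Seq (ℤ × ℤ) (ℝ →ᵇ ℝ)}
    (hT : 0 ≤ T) {i : ℤ × ℤ}
    (hy : y i = (vw i * pertCoeff i) • decay _ (hρ i) + duhamel _ (hρ i)
        (linForce μ Ω a k₁ k₂ m y i + ε • quadForce μ Ω k₁ k₂ m (growth β T) y i)) :
    fullCoeff a ε β T y 0 i = baseCoeff a i + ε * pertCoeff i ∧
    ∀ t ∈ Icc 0 T, fullCoeff a ε β T y t i - fullCoeff a ε β T y 0 i = ∫ τ in (0 : ℝ)..t,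
      (-(κ * √(normSq (lat k₁ k₂ m i)) * fullCoeff a ε β T y τ i) +
        ∑' j, ker μ Ω k₁ k₂ m j (i - j) * (fullCoeff a ε β T y τ j * fullCoeff a ε β T y τ (i - j)) +
          baseCoeff (κ * m * a) i) := by
  have hycoord : ∀ τ, 0 ≤ τ → y i τ = Real.exp (-((κ * √(normSq (lat k₁ k₂ m i)) + β) * τ)) *
      (vw i * pertCoeff i + ∫ r in (0 : ℝ)..τ,
        Real.exp ((κ * √(normSq (lat k₁ k₂ m i)) + β) * r) * (linForce μ Ω a k₁ k₂ m y i +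
        ε • quadForce μ Ω k₁ k₂ m (growth β T) y i) r) := fun τ hτ => by
    have h2 := congr_arg (fun f : ℝ →ᵇ ℝ => f τ) hy
    have h3 : y i τ = vw i * pertCoeff i * decay _ (hρ i) τ + duhamel _ (hρ i)
        (linForce μ Ω a k₁ k₂ m y i + ε • quadForce μ Ω k₁ k₂ m (growth β T) y i) τ := h2
    rw [h3, duhamel_apply _ _ hτ, decay_apply _ hτ]
    ring
  have hg0 : growth β T 0 = 1 := by rw [growth_apply ⟨le_rfl, hT⟩]; simp
  have hy0 : y i 0 = vw i * pertCoeff i := by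
    rw [hycoord 0 le_rfl]
    simp
  refine ⟨by rw [fullCoeff, hg0, hy0, mul_div_cancel_left₀ _ (vw_pos i).ne', mul_one],
    fun t ht => ?_⟩
  have h1 := duhamel_equation (κ * √(normSq (lat k₁ k₂ m i))) β (vw i * pertCoeff i)
    (linForce μ Ω a k₁ k₂ m y i + ε • quadForce μ Ω k₁ k₂ m (growth β T) y i).continuous ht.1
    hycoord
  have h2 : fullCoeff a ε β T y t i - fullCoeff a ε β T y 0 i =
      ε / vw i * (Real.exp (β * t) * y i t - vw i * pertCoeff i) := by
    rw [fullCoeff, fullCoeff, hg0, hy0, growth_apply ht]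
    ring
  rw [h2, h1, ← intervalIntegral.integral_const_mul]
  refine intervalIntegral.integral_congr fun τ hτ => ?_
  rw [uIcc_of_le ht.1] at hτ
  have hτ' : τ ∈ Icc 0 T := ⟨hτ.1, hτ.2.trans ht.2⟩
  -- The dissipation acts on the base state as multiplication by κ m, which the source cancels.
  have h3 := sqrt_normSq_mul_baseCoeff (k₁ := k₁) (k₂ := k₂) hm a i
  have h4 : (linForce μ Ω a k₁ k₂ m y i + ε • quadForce μ Ω k₁ k₂ m (growth β T) y i) τ =
    linForce μ Ω a k₁ k₂ m y i τ + ε * quadForce μ Ω k₁ k₂ m (growth β T) y i τ := rfl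
  simp only [tsum_ker_fullCoeff (A := fun i => C * sz i) hCc hCl hm.ne', baseCoeff_mul, h4]
  rw [fullCoeff, growth_apply hτ']
  linear_combination κ * h3

/-- Dividing by `vw` returns the exponential weight with a factor 1/sz to spare, and the ℓ¹ norm of
y does the rest. -/
theorem summable_wt_mul_fullCoeff_bound {ε β T : ℝ} (y : Seq (ℤ × ℤ) (ℝ →ᵇ ℝ)) :
    Summable fun i => wt i * (|baseCoeff a i| + ε * ‖growth β T‖ * (‖y i‖ / vw i)) := by
  have h1 : Summable fun i => wt i * |baseCoeff a i| :=
    summable_of_ne_finset_zero (s := ({0} : Finset ℤ) ×ˢ ({1, -1} : Finset ℤ)) fun i hi => by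
      rw [baseCoeff_support hi, abs_zero, mul_zero]
  have h2 : Summable fun i => ε * ‖growth β T‖ * (‖y i‖ / sz i) :=
    (y.hasSum_norm.summable.of_nonneg_of_le
      (fun i => div_nonneg (norm_nonneg _) (by linarith [one_le_sz i]))
      fun i => div_le_self (norm_nonneg _) (one_le_sz i)).mul_left _
  refine (h1.add h2).congr fun i => ?_
  have hw := one_le_wt i
  have hs := one_le_sz i
  rw [vw]
  field_simp

theorem abs_fullCoeff_le {ε β T : ℝ} (hε : 0 < ε) (y : Seq (ℤ × ℤ) (ℝ →ᵇ ℝ)) (t : ℝ) (i : ℤ × ℤ) :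
    |fullCoeff a ε β T y t i| ≤ |baseCoeff a i| + ε * ‖growth β T‖ * (‖y i‖ / vw i) := by
  refine (abs_add_le _ _).trans ?_
  gcongr
  rw [abs_mul, abs_mul, abs_of_pos hε, abs_div, abs_of_pos (vw_pos i)]
  have := vw_pos i
  gcongr
  · exact (growth β T).norm_coe_le_norm t
  · exact (y i).norm_coe_le_norm t

/-- The growth of the full coefficients near a growing linear solution. -/
theorem exp_le_abs_fullCoeff {ε β σ T T' : ℝ} (hε : 0 < ε) (hT : T ∈ Icc 0 T')
    {w y : Seq (ℤ × ℤ) (ℝ →ᵇ ℝ)}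
    (hw : Real.exp ((σ - β) * T) ≤ |w (1, 1) T| / vw (1, 1) + |w (1, 2) T| / vw (1, 2))
    (hyw : ‖y - w‖ ≤ Real.exp ((σ - β) * T) / 4) :
    ε * Real.exp (σ * T) / 2 ≤ |fullCoeff a ε β T' y T (1, 1)| + |fullCoeff a ε β T' y T (1, 2)| := by
  have h1 : ∀ i : ℤ × ℤ, i.1 ≠ 0 →
      |fullCoeff a ε β T' y T i| = ε * Real.exp (β * T) * (|y i T| / vw i) := fun i hi => by
    rw [fullCoeff, growth_apply hT, baseCoeff, if_neg (fun h => hi h.1), zero_add,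
      abs_mul, abs_mul, abs_div, abs_of_pos hε, abs_of_pos (Real.exp_pos _),
      abs_of_pos (vw_pos i)]
  rw [h1 _ one_ne_zero, h1 _ one_ne_zero]
  have h2 : ∀ i, |w i T| / vw i - Real.exp ((σ - β) * T) / 4 ≤ |y i T| / vw i := fun i => by
    have hv : 1 ≤ vw i := one_le_mul_of_one_le_of_one_le (one_le_wt i) (one_le_sz i)
    have h3 : |w i T - y i T| ≤ Real.exp ((σ - β) * T) / 4 := by
      have h4 := (y i - w i).norm_coe_le_norm T
      have h5 := lp.norm_apply_le_norm (p := 1) one_ne_zero (y - w) i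
      rw [abs_sub_comm]
      exact (h4.trans h5).trans hyw
    have h6 : |w i T| ≤ |y i T| + Real.exp ((σ - β) * T) / 4 * vw i := by
      have h7 := abs_sub_abs_le_abs_sub (w i T) (y i T)
      have h8 : Real.exp ((σ - β) * T) / 4 ≤ Real.exp ((σ - β) * T) / 4 * vw i :=
        le_mul_of_one_le_right (by positivity) hv
      linarith
    rw [sub_le_iff_le_add, div_le_iff₀ (vw_pos i), add_mul, div_mul_cancel₀ _ (vw_pos i).ne']
    exact h6
  have h3 : Real.exp (σ * T) = Real.exp (β * T) * Real.exp ((σ - β) * T) := by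
    rw [← Real.exp_add]; congr 1; ring
  have h4 := h2 (1, 1)
  have h5 := h2 (1, 2)
  have h6 : Real.exp ((σ - β) * T) / 2 ≤
      |y (1, 1) T| / vw (1, 1) + |y (1, 2) T| / vw (1, 2) := by linarith
  rw [h3, ← mul_add]
  calc _ = ε * Real.exp (β * T) * (Real.exp ((σ - β) * T) / 2) := by ring
    _ ≤ _ := by gcongr

/-- Solutions of the equations of the coefficients with exponentially growing perturbation. -/
theorem exists_growing_modes {κ : ℝ} (hκ : 0 < κ) (hμ : 0 < μ) (hΩ : 0 < Ω) (ha : 0 < a)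
    (hk : k₂ ≠ 0) (hm : 0 < m) {T T' : ℝ} (hT : 0 ≤ T) (hTT' : T ≤ T') :
    ∃ ε₀ : ℝ, 0 < ε₀ ∧ ∀ ε : ℝ, 0 < ε → ε ≤ ε₀ → ∃ (g : ℝ → ℤ × ℤ → ℝ) (G : ℤ × ℤ → ℝ),
      (Summable fun i => wt i * G i) ∧ (∀ t i, |g t i| ≤ G i) ∧ (∀ i, Continuous fun t => g t i) ∧
      (∀ t i, g t (-i) = -g t i) ∧ (∀ t i, g t (flip i) = -g t i) ∧
      (∀ i, g 0 i = baseCoeff a i + ε * pertCoeff i) ∧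
      (∀ t ∈ Icc 0 T', ∀ i, g t i - g 0 i = ∫ τ in (0 : ℝ)..t,
        (-(κ * √(normSq (lat k₁ k₂ m i)) * g τ i) +
          ∑' j, ker μ Ω k₁ k₂ m j (i - j) * (g τ j * g τ (i - j)) + baseCoeff (κ * m * a) i)) ∧
      ε * Real.exp ((a / 2 * ker μ Ω k₁ k₂ m (1, 2) (0, 1) -
        κ * √(normSq (lat k₁ k₂ m (1, 2)))) * T) / 2 ≤ |g T (1, 1)| + |g T (1, 2)| := by
  obtain ⟨C, hC, hCc, hCl⟩ := exists_coef_le (k₁ := k₁) hμ hΩ hk hm.ne'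
  -- The second summand makes the linear term a contraction with constant 1/2. The summand κ keeps β
  -- positive and gives sz ≤ (2/κ) ρ at low frequencies too.
  obtain ⟨β, hβ⟩ : ∃ β, β = κ + 2 * C * ‖baseSeq a‖ := ⟨_, rfl⟩
  have h0 : 0 ≤ 2 * C * ‖baseSeq a‖ := by positivity
  have hρ : ∀ i, 0 < κ * √(normSq (lat k₁ k₂ m i)) + β := fun i =>
    add_pos_of_nonneg_of_pos (by positivity) (by linarith)
  obtain ⟨σ, hσ⟩ : ∃ σ, σ = a / 2 * ker μ Ω k₁ k₂ m (1, 2) (0, 1) -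
    κ * √(normSq (lat k₁ k₂ m (1, 2))) := ⟨_, rfl⟩
  have hnf : ∀ i, normSq (lat k₁ k₂ m (flip i)) = normSq (lat k₁ k₂ m i) := fun i => by
    rw [normSq_lat, normSq_lat]
    simp
  obtain ⟨ε₀, hε₀, h⟩ := exists_seq_solution (A := 2 / κ) hμ hΩ ha hm hC hCc hCl
    (show 0 < β by linarith) (by linarith) hρ (fun i => le_add_of_nonneg_left (by positivity))
    (fun i => by
      have h1 := sz_le_sqrt_normSq_lat (k₁ := k₁) hk hm.ne' i
      rw [div_mul_eq_mul_div, le_div_iff₀ hκ]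
      nlinarith)
    (fun i => by rw [lat_neg, normSq_neg]) (fun i => by rw [hnf])
    (by
      rw [normSq_lat, normSq_lat]
      push_cast
      gcongr
      norm_num)
    -- An error of one quarter in each of two components leaves half of the linear growth.
    (growth β T') hT (η := Real.exp ((σ - β) * T) / 4) (by positivity)
  refine ⟨ε₀, hε₀, fun ε hε hεε₀ => ?_⟩
  obtain ⟨w, y, hyS, hy, hw, hyw⟩ := h ε hε hεε₀
  obtain ⟨hyn, hyf⟩ := mem_symSeq.1 hyS
  rw [← sub_sub, ← hσ] at hw
  have hT' := hT.trans hTT'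
  refine ⟨fullCoeff a ε β T' y, _, summable_wt_mul_fullCoeff_bound y, abs_fullCoeff_le hε y,
    fun i => ?_, fun t i => ?_, fun t i => ?_,
    fun i => (fullCoeff_equation hm hCc hCl hρ hT' (hy i)).1,
    fun t ht i => (fullCoeff_equation hm hCc hCl hρ hT' (hy i)).2 t ht, ?_⟩
  · unfold fullCoeff
    fun_prop
  · simp only [fullCoeff, baseCoeff_neg, hyn, vw_neg, BoundedContinuousFunction.neg_apply]
    ring
  · rw [fullCoeff, fullCoeff, baseCoeff_flip, hyf, vw_flip, BoundedContinuousFunction.neg_apply]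
    ring
  · rw [← hσ]
    exact exp_le_abs_fullCoeff hε ⟨hT, hTT'⟩ hw hyw

end Nonlinear

/-! ### The steady state -/

theorem summable_baseCoeff (a : ℝ) : Summable (baseCoeff a) :=
  summable_of_ne_finset_zero (s := ({0} : Finset ℤ) ×ˢ ({1, -1} : Finset ℤ)) fun _ =>
    baseCoeff_support

theorem summable_pertCoeff : Summable pertCoeff :=
  summable_of_ne_finset_zero (s := ({1, -1} : Finset ℤ) ×ˢ ({1, -1} : Finset ℤ)) fun _ =>
    pertCoeff_support

theorem mFourier_vertical (n : ℤ) (y : Torus) : mFourier ![0, 0, n] y = fourier n (y 2) := by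
  simp [mFourier, Fin.prod_univ_three]

/-- The steady state only has the frequencies (0, 0, ±m), so it lies on every lattice. One and the
same state can thus be perturbed at arbitrarily high horizontal frequency. -/
theorem synth_baseCoeff (k₁ k₂ : ℤ) (m : ℕ) (a : ℝ) :
    synth k₁ k₂ m (baseCoeff a) = sinL2 a m := by
  show ContinuousMap.toLp 2 vol ℝ _ = ContinuousMap.toLp 2 vol ℝ _
  congr 1
  ext y
  show (synthFun k₁ k₂ m (baseCoeff a) y).re = a * (fourier (T := 1) (m : ℤ) (y 2)).im
  have h1 := hasSum_trig_apply (lat k₁ k₂ m) (summable_coeff (summable_baseCoeff a)) y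
  have h2 := hasSum_sum_of_ne_finset_zero (L := SummationFilter.unconditional _)
    (f := fun i => Complex.I * (baseCoeff a i : ℂ) * mFourier (lat k₁ k₂ m i) y)
    (s := ({0} : Finset ℤ) ×ˢ ({1, -1} : Finset ℤ)) fun i hi => by simp [baseCoeff_support hi]
  have e1 : lat k₁ k₂ m (0, 1) = ![0, 0, (m : ℤ)] := by simp [lat]
  have e2 : lat k₁ k₂ m (0, -1) = ![0, 0, -(m : ℤ)] := by simp [lat]
  rw [synthFun, h1.unique h2, Finset.sum_product, Finset.sum_singleton,
    Finset.sum_pair (by norm_num), e1, e2, mFourier_vertical, mFourier_vertical, fourier_neg]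
  simp [baseCoeff]
  ring

theorem sobolevNorm_synth_lt_top {k₁ k₂ m : ℤ} {g : ℤ × ℤ → ℝ} (s : ℝ) (p : ℝ≥0∞)
    {F : Finset (ℤ × ℤ)} (hF : ∀ i ∉ F, g i = 0) (ho : ∀ i, g (-i) = -g i) :
    sobolevNorm s p (synth k₁ k₂ m g) < ∞ :=
  (sobolevNorm_synth_le s p (summable_of_ne_finset_zero hF) ho
    (summable_of_ne_finset_zero (s := F) fun i hi => by rw [hF i hi, abs_zero, mul_zero])).trans_lt
    ENNReal.ofReal_lt_top

theorem sobolevNorm_sinL2_lt_top (s : ℝ) (p : ℝ≥0∞) (a : ℝ) (m : ℕ) :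
    sobolevNorm s p (sinL2 a m) < ∞ := by
  rw [← synth_baseCoeff 1 1]
  exact sobolevNorm_synth_lt_top s p (fun _ => baseCoeff_support) (baseCoeff_neg a)

theorem hasZeroVerticalMean_sinL2 (a : ℝ) {m : ℕ} (hm : 1 ≤ m) :
    HasZeroVerticalMean (sinL2 a m) := by
  rw [← synth_baseCoeff 1 1]
  exact hasZeroVerticalMean_synth (by omega) (summable_baseCoeff a) (baseCoeff_neg a)
    (baseCoeff_flip a)

theorem isSolution_sinL2 (κ a : ℝ) {μ Ω : ℝ} (hμ : 0 < μ) (hΩ : 0 < Ω) {m : ℕ} (hm : 1 ≤ m)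
    (s : ℝ) (p : ℝ≥0∞) (T : ℝ) :
    IsSolution κ μ Ω (1 / 2) (sinL2 (κ * a * m) m) s p T (sinL2 a m) fun _ => sinL2 a m := by
  have hm' : (0 : ℤ) < m := by omega
  rw [← synth_baseCoeff 1 1, ← synth_baseCoeff 1 1]
  refine isSolution_synth (g := fun _ => baseCoeff a) (G := fun i => |baseCoeff a i|) hμ hΩ
    one_ne_zero hm'.ne' (summable_of_ne_finset_zero
      (s := ({0} : Finset ℤ) ×ˢ ({1, -1} : Finset ℤ)) fun i hi => by
        rw [baseCoeff_support hi, abs_zero, mul_zero])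
    (fun _ _ => le_rfl) (fun _ => continuous_const) (fun _ => baseCoeff_neg a)
    (summable_baseCoeff _) (baseCoeff_neg _) fun t _ i => ?_
  have h1 : ∀ j, ker μ Ω 1 1 m j (i - j) * (baseCoeff a j * baseCoeff a (i - j)) = 0 := fun j => by
    by_cases hj : j.1 = 0
    · rw [ker_of_fst_eq_zero hm'.ne' hj, zero_mul]
    · simp [baseCoeff, hj]
  have h2 := sqrt_normSq_mul_baseCoeff (k₁ := 1) (k₂ := 1) hm' a i
  rw [mul_assoc κ a, mul_comm a, ← mul_assoc, baseCoeff_mul]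
  simp only [h1, tsum_zero, sub_self, mul_assoc κ, h2]
  simp

theorem IsSolution.mono {κ μ Ω γ s T T' : ℝ} {S Θ₀ : L2} {p : ℝ≥0∞} {Θ : ℝ → L2}
    (h : IsSolution κ μ Ω γ S s p T' Θ₀ Θ) (hT : T ≤ T') : IsSolution κ μ Ω γ S s p T Θ₀ Θ := by
  have hs : Icc 0 T ⊆ Icc 0 T' := Icc_subset_Icc_right hT
  obtain ⟨C, hC⟩ := h.bounded
  obtain ⟨U, hU, hw⟩ := h.weak
  exact ⟨h.measurable.mono_measure (Measure.restrict_mono hs le_rfl), ⟨C, fun t ht => hC t (hs ht)⟩,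
    U, fun t ht => hU t (hs ht), fun φ ψ hφ hψ t ht => hw φ ψ hφ hψ t (hs ht)⟩

/-! ### The growth rates -/

/-- On k₁ = j², k₂ = j, k₃ = 2m both the coupling and the dissipation are asymptotic to multiples of
j². The limit of the rate divided by j² is the difference of the two sides of the assumption on `a`;
the constant 2⁵ is 2 · 4 · (k₃/m)². -/
theorem exists_growth_rate {κ μ Ω a : ℝ} (hμ : 0 < μ) {m : ℕ} (hm : 1 ≤ m)
    (hlarge : κ < a * μ * m / (2 ^ 5 * Ω ^ 2 * (m : ℝ) ^ 2 + 2 * μ ^ 2)) :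
    ∃ c : ℝ, 0 < c ∧ ∀ᶠ j : ℕ in atTop, c * (j : ℝ) ^ 2 ≤
      a / 2 * ker μ Ω ((j : ℤ) ^ 2) j m (1, 2) (0, 1) -
        κ * √(normSq (lat ((j : ℤ) ^ 2) j m (1, 2))) := by
  -- F is the rate divided by j², as a function of u = j⁻². It is continuous at 0 and positive
  -- there.
  set F : ℝ → ℝ := fun u => a / 2 * (μ * m * (1 + u) /
    (16 * Ω ^ 2 * (m : ℝ) ^ 2 * (1 + u + 4 * (m : ℝ) ^ 2 * u ^ 2) + μ ^ 2)) -
      κ * √(1 + u + 4 * (m : ℝ) ^ 2 * u ^ 2) with hF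
  have hF0 : F 0 = a * μ * m / (2 ^ 5 * Ω ^ 2 * (m : ℝ) ^ 2 + 2 * μ ^ 2) - κ := by
    have : 16 * Ω ^ 2 * (m : ℝ) ^ 2 + μ ^ 2 ≠ 0 := by positivity
    simp only [hF, mul_zero, add_zero, mul_one, Real.sqrt_one, ne_eq, OfNat.ofNat_ne_zero,
      not_false_eq_true, zero_pow]
    congr 1
    rw [show (2 : ℝ) ^ 5 * Ω ^ 2 * (m : ℝ) ^ 2 + 2 * μ ^ 2 =
      2 * (16 * Ω ^ 2 * (m : ℝ) ^ 2 + μ ^ 2) by ring]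
    field_simp
  have hFc : ContinuousAt F 0 := by
    have : 16 * Ω ^ 2 * (m : ℝ) ^ 2 * (1 + 0 + 4 * (m : ℝ) ^ 2 * 0 ^ 2) + μ ^ 2 ≠ 0 := by positivity
    fun_prop (disch := assumption)
  have hu : Tendsto (fun j : ℕ => ((j : ℝ) ^ 2)⁻¹) atTop (𝓝 0) :=
    tendsto_inv_atTop_zero.comp ((tendsto_pow_atTop two_ne_zero).comp tendsto_natCast_atTop_atTop)
  have hpos : 0 < F 0 := by rw [hF0]; linarith
  refine ⟨F 0 / 2, by positivity, ?_⟩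
  filter_upwards [(hFc.tendsto.comp hu).eventually (lt_mem_nhds (half_lt_self hpos)),
    eventually_gt_atTop 0] with j hj hj0
  have hm0 : (0 : ℝ) < m := by exact_mod_cast hm
  have hx : (0 : ℝ) < (j : ℝ) ^ 2 := by positivity
  have hm' : (m : ℤ) ≠ 0 := by omega
  rw [ker_one_one hm' two_ne_zero, normSq_lat]
  push_cast
  set x : ℝ := (j : ℝ) ^ 2 with hxdef
  have hs : √(1 ^ 2 * (x ^ 2 + x) + 2 ^ 2 * (m : ℝ) ^ 2) =
      x * √(1 + x⁻¹ + 4 * (m : ℝ) ^ 2 * x⁻¹ ^ 2) := by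
    rw [← Real.sqrt_sq hx.le, ← Real.sqrt_mul (sq_nonneg _), Real.sqrt_sq hx.le]
    congr 1
    field_simp
    ring
  have hk : μ * x * (x ^ 2 + x) * m / (4 * Ω ^ 2 * (2 * m) ^ 2 * (x ^ 2 + x + 2 ^ 2 * (m : ℝ) ^ 2) +
      μ ^ 2 * (j : ℝ) ^ 4) = x * (μ * m * (1 + x⁻¹) /
        (16 * Ω ^ 2 * (m : ℝ) ^ 2 * (1 + x⁻¹ + 4 * (m : ℝ) ^ 2 * x⁻¹ ^ 2) + μ ^ 2)) := by
    rw [show (j : ℝ) ^ 4 = x ^ 2 by rw [hxdef]; ring, mul_div_assoc']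
    have d1 : 4 * Ω ^ 2 * (2 * m) ^ 2 * (x ^ 2 + x + 2 ^ 2 * (m : ℝ) ^ 2) + μ ^ 2 * x ^ 2 =
      x ^ 2 * (16 * Ω ^ 2 * (m : ℝ) ^ 2 * (1 + x⁻¹ + 4 * (m : ℝ) ^ 2 * x⁻¹ ^ 2) + μ ^ 2) := by
      field_simp
      ring
    have d2 : 0 < 16 * Ω ^ 2 * (m : ℝ) ^ 2 * (1 + x⁻¹ + 4 * (m : ℝ) ^ 2 * x⁻¹ ^ 2) + μ ^ 2 := by
      positivity
    rw [d1, div_eq_div_iff (by positivity) d2.ne']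
    field_simp
  rw [hs, hk]
  have := mul_le_mul_of_nonneg_left (show F 0 / 2 ≤ F x⁻¹ from hj.le) hx.le
  refine (mul_comm _ _).le.trans (this.trans_eq ?_)
  simp only [hF]
  ring

/-- Exponentials dominate powers of the size of the frequencies. -/
theorem eventually_rpow_le_exp {c : ℝ} (hc : 0 < c) (A e : ℝ) (m : ℕ) :
    ∀ᶠ j : ℕ in atTop, A * (1 + normSq (lat ((j : ℤ) ^ 2) j m (1, 2))) ^ e ≤
      Real.exp (c * (j : ℝ) ^ 2) := by
  obtain ⟨n, hn⟩ := exists_nat_ge e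
  have hx : Tendsto (fun j : ℕ => (j : ℝ) ^ 2) atTop atTop :=
    (tendsto_pow_atTop two_ne_zero).comp tendsto_natCast_atTop_atTop
  have h1 := hx.eventually ((isLittleO_pow_exp_pos_mul_atTop (2 * n) hc).def
    (show 0 < (|A| * 4 ^ n + 1)⁻¹ by positivity))
  filter_upwards [h1, eventually_ge_atTop (2 * m + 1)] with j hj hjm
  have hj1 : 2 * (m : ℝ) + 1 ≤ j := by exact_mod_cast hjm
  have hm0 : (0 : ℝ) ≤ m := m.cast_nonneg
  set x : ℝ := (j : ℝ) ^ 2 with hxdef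
  have hx1 : 4 * (m : ℝ) ^ 2 + 1 ≤ x := by nlinarith
  have hB : 1 + normSq (lat ((j : ℤ) ^ 2) j m (1, 2)) ≤ 4 * x ^ 2 := by
    rw [normSq_lat]
    push_cast
    rw [← hxdef]
    nlinarith
  have hB1 : 1 ≤ 1 + normSq (lat ((j : ℤ) ^ 2) j m (1, 2)) := by linarith [normSq_nonneg (lat ((j : ℤ) ^ 2) j m (1, 2))]
  have h2 : (1 + normSq (lat ((j : ℤ) ^ 2) j m (1, 2))) ^ e ≤ 4 ^ n * x ^ (2 * n) := by
    calc _ ≤ (1 + normSq (lat ((j : ℤ) ^ 2) j m (1, 2))) ^ (n : ℝ) :=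
          Real.rpow_le_rpow_of_exponent_le hB1 hn
      _ ≤ (4 * x ^ 2) ^ n := by
          rw [Real.rpow_natCast]
          exact pow_le_pow_left₀ (by linarith) hB n
      _ = _ := by rw [mul_pow, ← pow_mul]
  rw [Real.norm_of_nonneg (by positivity), Real.norm_of_nonneg (Real.exp_pos _).le,
    le_inv_mul_iff₀ (by positivity)] at hj
  have h3 : 0 ≤ (1 + normSq (lat ((j : ℤ) ^ 2) j m (1, 2))) ^ e :=
    Real.rpow_nonneg (by linarith) _
  calc _ ≤ |A| * (4 ^ n * x ^ (2 * n)) := mul_le_mul (le_abs_self A) h2 h3 (abs_nonneg A)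
    _ ≤ (|A| * 4 ^ n + 1) * x ^ (2 * n) := by
        have : 0 ≤ x ^ (2 * n) := by positivity
        linarith
    _ ≤ _ := hj

/-! ### Ill-posedness -/

/-- The Sobolev exponents may be negative; passing to |s| gives a bound by the largest frequency in
either case. -/
theorem rpow_le_rpow_abs {A B s : ℝ} (hA : 1 ≤ A) (hAB : A ≤ B) : A ^ (s / 2) ≤ B ^ (|s| / 2) :=
  (Real.rpow_le_rpow_of_exponent_le hA (by linarith [le_abs_self s])).trans
    (Real.rpow_le_rpow (by linarith) hAB (by positivity))

theorem inv_rpow_abs_le_rpow {A B s : ℝ} (hA : 1 ≤ A) (hAB : A ≤ B) :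
    (B ^ (|s| / 2))⁻¹ ≤ A ^ (s / 2) := by
  have h := rpow_le_rpow_abs (s := -s) hA hAB
  rw [abs_neg] at h
  have hA0 : 0 < A := by linarith
  have hB0 : 0 < B := by linarith
  rw [inv_le_comm₀ (by positivity) (by positivity), ← Real.rpow_neg hA0.le, ← neg_div]
  exact h

theorem normSq_lat_le_of_abs_eq_one (k₁ k₂ m : ℤ) {i : ℤ × ℤ} (h1 : |i.1| = 1) (h2 : |i.2| ≤ 2) :
    normSq (lat k₁ k₂ m i) ≤ normSq (lat k₁ k₂ m (1, 2)) := by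
  have h1' : (i.1 : ℝ) ^ 2 = 1 := by
    have : |(i.1 : ℝ)| = 1 := by exact_mod_cast h1
    rw [← sq_abs, this, one_pow]
  have h2' : (i.2 : ℝ) ^ 2 ≤ 2 ^ 2 := by
    have : |(i.2 : ℝ)| ≤ 2 := by exact_mod_cast h2
    rw [← sq_abs]
    gcongr
  rw [normSq_lat, normSq_lat, h1']
  push_cast
  gcongr
  norm_num

theorem sobolevNorm_synth_pertCoeff_le (k₁ k₂ m : ℤ) (r : ℝ) (q : ℝ≥0∞) {ε : ℝ} (hε : 0 ≤ ε) :
    sobolevNorm r q (synth k₁ k₂ m fun i => ε * pertCoeff i) ≤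
      ENNReal.ofReal (4 * ε * (1 + normSq (lat k₁ k₂ m (1, 2))) ^ (|r| / 2)) := by
  have hF : ∀ i ∉ ({1, -1} : Finset ℤ) ×ˢ ({1, -1} : Finset ℤ),
      (1 + normSq (lat k₁ k₂ m i)) ^ (r / 2) * |ε * pertCoeff i| = 0 := fun i hi => by
    rw [pertCoeff_support hi, mul_zero, abs_zero, mul_zero]
  refine (sobolevNorm_synth_le r q (summable_pertCoeff.mul_left ε)
    (fun i => by rw [pertCoeff_neg, mul_neg]) (summable_of_ne_finset_zero hF)).trans
    (ENNReal.ofReal_le_ofReal ?_)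
  rw [tsum_eq_sum hF]
  refine (Finset.sum_le_card_nsmul _ _
    (ε * (1 + normSq (lat k₁ k₂ m (1, 2))) ^ (|r| / 2)) fun i hi => ?_).trans_eq ?_
  · have h12 : |i.1| = 1 ∧ |i.2| = 1 := by
      rw [Finset.mem_product, Finset.mem_insert, Finset.mem_singleton, Finset.mem_insert,
        Finset.mem_singleton] at hi
      rcases hi with ⟨h1 | h1, h2 | h2⟩ <;> simp [h1, h2]
    have hp : |pertCoeff i| = 1 := by
      rw [pertCoeff, if_pos h12, abs_neg]
      exact_mod_cast h12.2
    rw [abs_mul, hp, mul_one, abs_of_nonneg hε, mul_comm]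
    gcongr
    exact rpow_le_rpow_abs (by linarith [normSq_nonneg (lat k₁ k₂ m i)]) (by
      linarith [normSq_lat_le_of_abs_eq_one k₁ k₂ m h12.1 (by omega)])
  · rw [Finset.card_product]
    simp
    ring

/-- Arbitrarily small perturbations of the steady state grow by arbitrarily large factors. -/
theorem exists_growing_solution {κ μ Ω a : ℝ} (hκ : 0 < κ) (hμ : 0 < μ) (hΩ : 0 < Ω) (ha : 0 < a)
    {m : ℕ} (hm : 1 ≤ m)
    (hlarge : κ < a * μ * m / (2 ^ 5 * Ω ^ 2 * (m : ℝ) ^ 2 + 2 * μ ^ 2))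
    (s r : ℝ) {p q : ℝ≥0∞} (hp : 1 ≤ p) (hq : 1 ≤ q) {T T' : ℝ} (hT : 0 < T) (hTT' : T ≤ T')
    {K : ℝ} (hK : 0 < K) {δ : ℝ≥0∞} (hδ : 0 < δ) :
    ∃ (Θ₀ : L2) (Θ : ℝ → L2),
      0 < sobolevNorm r q (Θ₀ - sinL2 a m) ∧ sobolevNorm r q (Θ₀ - sinL2 a m) < δ ∧
      sobolevNorm r q Θ₀ < ∞ ∧ HasZeroVerticalMean Θ₀ ∧
      IsSolution κ μ Ω (1 / 2) (sinL2 (κ * a * m) m) s p T' Θ₀ Θ ∧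
      (∀ t, HasZeroVerticalMean (Θ t)) ∧
      ENNReal.ofReal (2 * K) * sobolevNorm r q (Θ₀ - sinL2 a m) ≤
        sobolevNorm s p (Θ T - sinL2 a m) := by
  obtain ⟨c, hc, hrate⟩ := exists_growth_rate (Ω := Ω) hμ hm hlarge
  obtain ⟨j, ⟨hσ, hexp⟩, hj⟩ := ((hrate.and (eventually_rpow_le_exp (mul_pos hc hT) (32 * K)
    (|r| / 2 + |s| / 2) m)).and (eventually_gt_atTop 0)).exists
  have hm' : (0 : ℤ) < m := by omega
  have hk : (j : ℤ) ≠ 0 := by omega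
  generalize ((j : ℤ) ^ 2) = k₁ at hσ hexp
  obtain ⟨ε₀, hε₀, hmain⟩ := exists_growing_modes (k₁ := k₁) hκ hμ hΩ ha hk hm' hT.le hTT'
  set B : ℝ := 1 + normSq (lat k₁ j m (1, 2)) with hB
  have hB1 : 1 ≤ B := by linarith [normSq_nonneg (lat k₁ j m (1, 2))]
  have hB0 : 0 < B := by linarith
  obtain ⟨d, hd0, hd⟩ := ENNReal.lt_iff_exists_nnreal_btwn.1 hδ
  have hd0' : (0 : ℝ) < d := by exact_mod_cast hd0
  -- The frequency is already fixed, so ε may depend on it, both through ε₀ and through the size of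
  -- the Sobolev weight.
  obtain ⟨ε, hε, hεε₀, hεd⟩ : ∃ ε : ℝ, 0 < ε ∧ ε ≤ ε₀ ∧ 4 * ε * B ^ (|r| / 2) ≤ d := by
    refine ⟨min ε₀ (d / (4 * B ^ (|r| / 2))), by positivity, min_le_left _ _, ?_⟩
    have := min_le_right ε₀ (d / (4 * B ^ (|r| / 2)))
    rw [le_div_iff₀ (by positivity)] at this
    linarith
  obtain ⟨g, G, hG, hgG, hgc, ho, hf, hg0, hmode, hgrow⟩ := hmain ε hε hεε₀
  have hG0 : ∀ i, 0 ≤ G i := fun i => (abs_nonneg _).trans (hgG 0 i)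
  have hgs : ∀ t, Summable (g t) := fun t => Summable.of_norm_bounded
    (hG.of_nonneg_of_le hG0 fun i => le_mul_of_one_le_left (hG0 i) (one_le_wt i)) (hgG t)
  have hdiff : ∀ t, synth k₁ j m (g t) - sinL2 a m = synth k₁ j m (g t - baseCoeff a) := fun t => by
    rw [← synth_baseCoeff k₁ j, synth_sub (hgs t) (summable_baseCoeff a)]
  have hds : ∀ t, Summable (g t - baseCoeff a) := fun t => (hgs t).sub (summable_baseCoeff a)
  have hdo : ∀ t i, (g t - baseCoeff a) (-i) = -(g t - baseCoeff a) i := fun t i => by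
    simp only [Pi.sub_apply, ho, baseCoeff_neg]
    ring
  have h0 : g 0 - baseCoeff a = fun i => ε * pertCoeff i := by
    funext i
    rw [Pi.sub_apply, hg0, add_sub_cancel_left]
  have hY : sobolevNorm r q (synth k₁ j m (g 0) - sinL2 a m) ≤
      ENNReal.ofReal (4 * ε * B ^ (|r| / 2)) := by
    rw [hdiff, h0]
    exact sobolevNorm_synth_pertCoeff_le k₁ j m r q hε.le
  have hYpos : 0 < sobolevNorm r q (synth k₁ j m (g 0) - sinL2 a m) := by
    rw [hdiff]
    refine lt_of_lt_of_le ?_ (coeff_le_sobolevNorm_synth hq hk hm'.ne' (hds 0) (hdo 0) (1, 1))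
    have h11 := normSq_nonneg (lat k₁ j m (1, 1))
    rw [h0, ENNReal.ofReal_pos]
    have : |ε * pertCoeff (1, 1)| = ε := by simp [pertCoeff, abs_of_pos hε]
    rw [this]
    positivity
  have hYδ : sobolevNorm r q (synth k₁ j m (g 0) - sinL2 a m) < δ := by
    refine (hY.trans (ENNReal.ofReal_le_ofReal hεd)).trans_lt ?_
    rwa [ENNReal.ofReal_coe_nnreal]
  refine ⟨synth k₁ j m (g 0), fun t => synth k₁ j m (g t), hYpos, hYδ, ?_,
    hasZeroVerticalMean_synth hm'.ne' (hgs 0) (ho 0) (hf 0), ?_,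
    fun t => hasZeroVerticalMean_synth hm'.ne' (hgs t) (ho t) (hf t), ?_⟩
  · have h1 := sobolevNorm_add_le (s := r) hq (synth k₁ j m (g 0) - sinL2 a m) (sinL2 a m)
    rw [sub_add_cancel] at h1
    exact h1.trans_lt (ENNReal.add_lt_top.2
      ⟨hY.trans_lt ENNReal.ofReal_lt_top, sobolevNorm_sinL2_lt_top r q a m⟩)
  · rw [← synth_baseCoeff k₁ j]
    refine isSolution_synth hμ hΩ hk hm'.ne' hG hgG hgc ho (summable_baseCoeff _)
      (baseCoeff_neg _) fun t ht i => ?_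
    rw [show κ * a * m = κ * ((m : ℤ) : ℝ) * a by push_cast; ring]
    exact hmode t ht i
  -- The X norm is bounded below by a single Fourier coefficient; the base state has none at
  -- horizontal index 1.
  · have hX : ∀ n : ℤ, |n| ≤ 2 → ENNReal.ofReal ((B ^ (|s| / 2))⁻¹ * |g T (1, n)|) ≤
        sobolevNorm s p (synth k₁ j m (g T) - sinL2 a m) := fun n hn => by
      rw [hdiff]
      refine le_trans (ENNReal.ofReal_le_ofReal ?_)
        (coeff_le_sobolevNorm_synth hp hk hm'.ne' (hds T) (hdo T) (1, n))
      have : (g T - baseCoeff a) (1, n) = g T (1, n) := by simp [baseCoeff]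
      rw [this]
      gcongr
      exact inv_rpow_abs_le_rpow (by linarith [normSq_nonneg (lat k₁ j m (1, n))]) (by
        linarith [normSq_lat_le_of_abs_eq_one k₁ j m (i := (1, n)) (by simp) hn])
    have hBs : 0 < B ^ (|s| / 2) := by positivity
    -- The 32 collects the 2 of the claim, the four initial modes, one 2 from the growth bound and
    -- one from keeping only the larger of two coefficients.
    have hkey : 2 * K * (4 * ε * B ^ (|r| / 2)) ≤
        (B ^ (|s| / 2))⁻¹ * (|g T (1, 1)| + |g T (1, 2)|) / 2 := by
      have h1 : Real.exp (c * T * (j : ℝ) ^ 2) ≤ Real.exp ((a / 2 * ker μ Ω k₁ j m (1, 2) (0, 1) -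
          κ * √(normSq (lat k₁ j m (1, 2)))) * T) := by
        rw [Real.exp_le_exp, mul_right_comm]
        gcongr
      have h2 := hexp.trans h1
      rw [Real.rpow_add hB0] at h2
      have h3 : ε * (32 * K * (B ^ (|r| / 2) * B ^ (|s| / 2))) / 2 ≤
          |g T (1, 1)| + |g T (1, 2)| := le_trans (by gcongr) hgrow
      rw [inv_mul_eq_div, div_div, le_div_iff₀ (by positivity)]
      linarith
    have h1 := hX 1 (by norm_num)
    have h2 := hX 2 (by norm_num)
    have h3 : ENNReal.ofReal (2 * K * (4 * ε * B ^ (|r| / 2))) ≤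
        sobolevNorm s p (synth k₁ j m (g T) - sinL2 a m) := by
      rcases le_total |g T (1, 1)| |g T (1, 2)| with h | h
      · refine le_trans (ENNReal.ofReal_le_ofReal (hkey.trans ?_)) h2
        rw [mul_div_assoc]
        gcongr
        linarith
      · refine le_trans (ENNReal.ofReal_le_ofReal (hkey.trans ?_)) h1
        rw [mul_div_assoc]
        gcongr
        linarith
    refine le_trans ?_ h3
    rw [ENNReal.ofReal_mul (show 0 ≤ 2 * K by positivity)]
    exact mul_le_mul' le_rfl hY

/-- Near the steady datum the existence time and the Lipschitz constant stay comparable to their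
values there. Growing solutions start from arbitrarily close data, uniqueness identifies them with
those of the definition, and their growth exceeds the constant. -/
theorem not_lipschitzWellPosed {κ μ Ω a : ℝ} (hκ : 0 < κ) (hμ : 0 < μ) (hΩ : 0 < Ω) (ha : 0 < a)
    {m : ℕ} (hm : 1 ≤ m)
    (hlarge : κ < a * μ * m / (2 ^ 5 * Ω ^ 2 * (m : ℝ) ^ 2 + 2 * μ ^ 2))
    (s r : ℝ) {p q : ℝ≥0∞} (hp : 1 ≤ p) (hq : 1 ≤ q) :
    ¬ LipschitzWellPosed κ μ Ω (1 / 2) (sinL2 (κ * a * m) m) s p r q := by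
  rintro ⟨T, K, hTc, hKc, hT, hK, h⟩
  have hbase := sobolevNorm_sinL2_lt_top r q a m
  set N := sobolevNorm r q (sinL2 a m) with hN
  set z₀ : ℝ≥0 × ℝ≥0 := (N.toNNReal, N.toNNReal) with hz₀
  have hev : ∀ᶠ z in 𝓝 z₀, T z₀ / 2 < T z ∧ T z < 2 * T z₀ ∧ K z < 2 * K z₀ := by
    have hT0 := hT z₀
    have hK0 := hK z₀
    exact (hTc.continuousAt.eventually (lt_mem_nhds (by linarith))).and
      ((hTc.continuousAt.eventually (gt_mem_nhds (by linarith))).and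
        (hKc.continuousAt.eventually (gt_mem_nhds (by linarith))))
  -- The existence time of the perturbed datum is known only to lie between T z₀ / 2 and 2 T z₀. The
  -- growing solution is therefore built on the longer interval, and its growth is measured at the
  -- earlier time.
  obtain ⟨η, hη, hball⟩ := Metric.eventually_nhds_iff.1 hev
  obtain ⟨Θ₀, Θ, hpos, hlt, hfin, hmean, hsol, -, hgrow⟩ := exists_growing_solution hκ hμ hΩ ha hm
    hlarge s r hp hq (half_pos (hT z₀)) (show T z₀ / 2 ≤ 2 * T z₀ by linarith [hT z₀]) (hK z₀)
    (ENNReal.ofReal_pos.2 hη)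
  set d := sobolevNorm r q (Θ₀ - sinL2 a m) with hd
  have hdtop : d < ∞ := hlt.trans ENNReal.ofReal_lt_top
  set z : ℝ≥0 × ℝ≥0 := ((sobolevNorm r q Θ₀).toNNReal, N.toNNReal) with hz
  have hdz : dist z z₀ < η := by
    have h1 := sobolevNorm_add_le (s := r) hq (Θ₀ - sinL2 a m) (sinL2 a m)
    have h2 := sobolevNorm_add_le (s := r) hq (sinL2 a m - Θ₀) Θ₀
    rw [sub_add_cancel, ← hN, ← hd] at h1
    rw [sub_add_cancel, sobolevNorm_sub_comm, ← hN, ← hd] at h2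
    have h1' := ENNReal.toReal_mono (ENNReal.add_lt_top.2 ⟨hdtop, hbase⟩).ne h1
    have h2' := ENNReal.toReal_mono (ENNReal.add_lt_top.2 ⟨hdtop, hfin⟩).ne h2
    rw [ENNReal.toReal_add hdtop.ne hbase.ne] at h1'
    rw [ENNReal.toReal_add hdtop.ne hfin.ne] at h2'
    have h3 : d.toReal < η := (ENNReal.lt_ofReal_iff_toReal_lt hdtop.ne).1 hlt
    rw [hz, hz₀, Prod.dist_eq, dist_self, max_eq_left dist_nonneg, NNReal.dist_eq, abs_lt]
    show -η < (sobolevNorm r q Θ₀).toReal - N.toReal ∧ (sobolevNorm r q Θ₀).toReal - N.toReal < η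
    constructor <;> linarith
  obtain ⟨hT1, hT2, hKz⟩ := hball hdz
  obtain ⟨Θ₁, Θ₂, -, hu₁, -, hu₂, hL⟩ := h Θ₀ (sinL2 a m) hmean (hasZeroVerticalMean_sinL2 a hm)
    hfin hbase z rfl
  have ht : T z₀ / 2 ∈ Icc 0 (T z) := ⟨(half_pos (hT z₀)).le, hT1.le⟩
  have h1 := hL _ ht
  rw [← hu₁ Θ (hsol.mono hT2.le) _ ht,
    ← hu₂ _ (isSolution_sinL2 κ a hμ hΩ hm s p (T z)) _ ht] at h1
  have h2 := hgrow.trans h1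
  rw [← hd, ENNReal.mul_le_mul_iff_left hpos.ne' hdtop.ne, ENNReal.ofReal_le_ofReal_iff (hK z).le] at h2
  linarith

end MG
end

open MG in
theorem mainTheorem6 (κ μ Ω a : ℝ) (hκ : 0 < κ) (hμ : 0 < μ) (hΩ : 0 < Ω) (ha : 0 < a)
    (m : ℕ) (hm : 1 ≤ m)
    (hlarge : κ < a * μ * m / (2 ^ 5 * Ω ^ 2 * (m : ℝ) ^ 2 + 2 * μ ^ 2))
    (s r : ℝ) (p q : ℝ≥0∞) (hp₁ : 1 < p) (hp : p < ∞) (hq₁ : 1 < q) (hq : q < ∞)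
    (hYX : Embeds (sobolevNorm r q) (sobolevNorm s p))
    (hXW : Embeds (sobolevNorm s p) w14Norm) :
    (sobolevNorm r q (sinL2 a m) < ∞ ∧ HasZeroVerticalMean (sinL2 a m) ∧
      ∀ T : ℝ, 0 < T →
        IsSolution κ μ Ω (1 / 2) (sinL2 (κ * a * m) m) s p T
          (sinL2 a m) (fun _ => sinL2 a m)) ∧
    (∀ T : ℝ, 0 < T → ∀ K : ℝ, 0 < K → ∀ δ : ℝ≥0∞, 0 < δ →
      ∃ (Θ₀ : L2) (Θ : ℝ → L2),
        0 < sobolevNorm r q (Θ₀ - sinL2 a m) ∧ sobolevNorm r q (Θ₀ - sinL2 a m) < δ ∧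
        sobolevNorm r q Θ₀ < ∞ ∧
        IsSolution κ μ Ω (1 / 2) (sinL2 (κ * a * m) m) s p T Θ₀ Θ ∧
        (∀ t ∈ Set.Icc 0 T, HasZeroVerticalMean (Θ t)) ∧
        ENNReal.ofReal (2 * K) * sobolevNorm r q (Θ₀ - sinL2 a m) ≤
          ⨆ t ∈ Set.Icc 0 T, sobolevNorm s p (Θ t - sinL2 a m)) ∧
    ¬ LipschitzWellPosed κ μ Ω (1 / 2) (sinL2 (κ * a * m) m) s p r q := by
  refine ⟨⟨sobolevNorm_sinL2_lt_top r q a m, hasZeroVerticalMean_sinL2 a hm,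
    fun T _ => isSolution_sinL2 κ a hμ hΩ hm s p T⟩, fun T hT K hK δ hδ => ?_,
    not_lipschitzWellPosed hκ hμ hΩ ha hm hlarge s r hp₁.le hq₁.le⟩
  obtain ⟨Θ₀, Θ, hpos, hlt, hfin, -, hsol, hmean, hgrow⟩ := exists_growing_solution hκ hμ hΩ ha hm
    hlarge s r hp₁.le hq₁.le hT le_rfl hK hδ
  exact ⟨Θ₀, Θ, hpos, hlt, hfin, hsol, fun t _ => hmean t, hgrow.trans
    (le_iSup₂_of_le (f := fun t (_ : t ∈ Set.Icc 0 T) => sobolevNorm s p (Θ t - sinL2 a m)) T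
      ⟨hT.le, le_rfl⟩ le_rfl)⟩
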